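/- Fix a sign $\pm$, put $F(z)=\pm|z|^2z$, and fix a smooth even function $m_{\le1}:\mathbb R\to[0,1]$ with $m_{\le 1}(\xi)=1$ for $|\xi|\le1$ and $m_{\le 1}(\xi)=0$ for $|\xi|\ge2$. For $N>0$ let $P_{\le N}$ be the Fourier multiplier on $L^2(\mathbb R)$ with symbol $m_{\le1}(\xi/N)$. A (global) solution of $$i\partial_tu+\Delta u=P_{\le N}F(P_{\le N}u)\qquad(\ast)_N$$ is a measurable function $u:\mathbb R\times\mathbb R\to\mathbb C$, $(t,x)\mapsto u(t,x)$, that lies in $C_tL^2_x(K\times\mathbb R)\cap L^6_{t,x}(K\times\mathbb R)$ for every compact $K\subset\mathbb R$ and satisfies $$u(t)=e^{it\Delta}u(0)-i\int_0^te^{i(t-s)\Delta}P_{\le N}F\bigl(P_{\le N}u(s)\bigr)\,ds\quad\text{in }L^2(\mathbb R),\text{ for all }t\in\mathbb R.$$ **Proposition 4.2.** Let $(N_n)_{n}$ be an arbitrary sequence of positive real numbers and, for each $n$, let $u_n:\mathbb R\times\mathbb R\to\mathbb C$ be a solution of $(\ast)_{N_n}$. Assume that $\sup_n\|u_n(0)\|_{L^2(\mathbb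 R)}<\infty$. Then there exist a measurable function $v:\mathbb R\times\mathbb R\to\mathbb C$ and a subsequence $(u_{n_k})_k$ such that $$\lim_{k\to\infty}\|u_{n_k}-v\|_{L^p_{t,x}([-T,T]\times[-R,R])}=0$$ for all $R>0$, all $T>0$ and all $1\le p<6$ (with the same $v$ and the same subsequence for all $R,T,p$). -/

import Mathlib

open MeasureTheory FourierTransform Filter
open scoped ENNReal ContDiff Topology

noncomputable section

namespace TruncatedNLS

/-- The Hilbert space `L²(ℝ; ℂ)`. -/
abbrev L2 : Type := Lp ℂ 2 (volume : Measure ℝ)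

/-- The Fourier multiplier operator `f ↦ 𝓕⁻¹ (m · 𝓕 f)` on `L²(ℝ)`, for a bounded symbol `m`.
Here `𝓕` is the unitary Fourier transform on `L²` with kernel `exp (-2πi x η)`. -/
def fourierMultiplier (m : ℝ → ℂ) (hm : MemLp m ∞ volume) (f : L2) : L2 :=
  𝓕⁻ (hm.toLp m • 𝓕 f : L2)

/-- With kernel `exp (-2πi x η)` the frequency is `ξ = 2πη`, so that `e^{itΔ}` has the
symbol `exp (-i t ξ²) = exp (-i t (2πη)²)`. -/
def schrodingerSymbol (t : ℝ) (η : ℝ) : ℂ :=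
  Complex.exp (-Complex.I * t * (2 * Real.pi * η) ^ 2)

lemma norm_schrodingerSymbol (t η : ℝ) : ‖schrodingerSymbol t η‖ = 1 := by
  have h : -Complex.I * t * (2 * Real.pi * η) ^ 2
      = ((-(t * (2 * Real.pi * η) ^ 2) : ℝ) : ℂ) * Complex.I := by
    push_cast; ring
  rw [schrodingerSymbol, h, Complex.norm_exp_ofReal_mul_I]

lemma memLp_schrodingerSymbol (t : ℝ) : MemLp (schrodingerSymbol t) ∞ volume := by
  refine memLp_top_of_bound ?_ 1 (.of_forall fun η => (norm_schrodingerSymbol t η).le)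
  unfold schrodingerSymbol
  exact Continuous.aestronglyMeasurable (by fun_prop)

/-- The free Schrödinger propagator `e^{itΔ}` on `L²(ℝ)`. -/
def propagator (t : ℝ) : L2 → L2 :=
  fourierMultiplier (schrodingerSymbol t) (memLp_schrodingerSymbol t)

/-- A smooth even cutoff `m_{≤1} : ℝ → [0,1]`, equal to `1` on `|ξ| ≤ 1` and to `0` on `|ξ| ≥ 2`. -/
structure LowFreqCutoff where
  toFun : ℝ → ℝ
  smooth : ContDiff ℝ ∞ toFun
  even : ∀ ξ, toFun (-ξ) = toFun ξ
  mem_Icc : ∀ ξ, toFun ξ ∈ Set.Icc (0 : ℝ) 1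
  eq_one : ∀ ξ, |ξ| ≤ 1 → toFun ξ = 1
  eq_zero : ∀ ξ, 2 ≤ |ξ| → toFun ξ = 0

/-- The symbol `m_{≤1}(ξ / N)` of `P_{≤ N}`, at `ξ = 2πη`. -/
def lowFreqSymbol (χ : LowFreqCutoff) (N : ℝ) (η : ℝ) : ℂ :=
  (χ.toFun (2 * Real.pi * η / N) : ℂ)

lemma continuous_lowFreqSymbol (χ : LowFreqCutoff) (N : ℝ) : Continuous (lowFreqSymbol χ N) := by
  have := χ.smooth.continuous
  unfold lowFreqSymbol
  fun_prop

lemma norm_lowFreqSymbol_le (χ : LowFreqCutoff) (N η : ℝ) : ‖lowFreqSymbol χ N η‖ ≤ 1 := by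
  have h := χ.mem_Icc (2 * Real.pi * η / N)
  rw [lowFreqSymbol, Complex.norm_real, Real.norm_eq_abs, abs_of_nonneg h.1]
  exact h.2

lemma memLp_lowFreqSymbol (χ : LowFreqCutoff) (N : ℝ) : MemLp (lowFreqSymbol χ N) ∞ volume :=
  memLp_top_of_bound (continuous_lowFreqSymbol χ N).aestronglyMeasurable 1
    (.of_forall fun η => norm_lowFreqSymbol_le χ N η)

/-- The Littlewood–Paley projection `P_{≤ N}` on `L²(ℝ)`. -/
def lowFreq (χ : LowFreqCutoff) (N : ℝ) : L2 → L2 :=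
  fourierMultiplier (lowFreqSymbol χ N) (memLp_lowFreqSymbol χ N)

/-- The nonlinearity `F(z) = σ |z|² z`; `σ = 1` is defocusing, `σ = -1` is focusing. -/
def cubic (σ : ℝ) (z : ℂ) : ℂ := σ * (‖z‖ : ℂ) ^ 2 * z

/-- The inverse Fourier transform of a function in `L¹ ∩ L²` is essentially bounded. -/
lemma fourierInv_bounded (g : L2) (hg : Integrable g volume) :
    ∃ C : ℝ, ∀ᵐ x, ‖(𝓕⁻ g : L2) x‖ ≤ C := by
  have hL : Continuous fun p : ℝ × ℝ => (-innerₗ ℝ : ℝ →ₗ[ℝ] ℝ →ₗ[ℝ] ℝ) p.1 p.2 := by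
    simp only [LinearMap.neg_apply, innerₗ_apply_apply]
    fun_prop
  have hcont : Continuous (𝓕⁻ (g : ℝ → ℂ)) :=
    VectorFourier.fourierIntegral_continuous Real.continuous_fourierChar
      (L := -innerₗ ℝ) hL hg
  have key : ∀ᵐ x, (𝓕⁻ g : L2) x = 𝓕⁻ (g : ℝ → ℂ) x := by
    refine ae_eq_of_integral_contDiff_smul_eq
      ((Lp.memLp (𝓕⁻ g : L2)).locallyIntegrable (by norm_num)) hcont.locallyIntegrable ?_
    intro φ hφ hφc
    have hc : HasCompactSupport (fun x => (φ x : ℂ)) := hφc.comp_left (g := Complex.ofReal) rfl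
    have hs : ContDiff ℝ ∞ (fun x => (φ x : ℂ)) := Complex.ofRealCLM.contDiff.comp hφ
    let Φ : SchwartzMap ℝ ℂ := hc.toSchwartzMap hs
    have h1 : (𝓕⁻ (g : TemperedDistribution ℝ ℂ)) Φ
        = ((𝓕⁻ g : L2) : TemperedDistribution ℝ ℂ) Φ := by
      rw [Lp.fourierInv_toTemperedDistribution_eq]
    rw [TemperedDistribution.fourierInv_apply, Lp.toTemperedDistribution_apply,
      Lp.toTemperedDistribution_apply] at h1
    have h2 := VectorFourier.integral_fourierIntegral_smul_eq_flip (L := -innerₗ ℝ)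
      (μ := (volume : Measure ℝ)) (ν := (volume : Measure ℝ)) Real.continuous_fourierChar
      hL Φ.integrable hg
    have h3 : ∫ x, Φ x • (𝓕⁻ g : L2) x = ∫ x, Φ x • 𝓕⁻ (g : ℝ → ℂ) x := by
      rw [← h1]
      have hflip : (-innerₗ ℝ).flip = (-innerₗ ℝ : ℝ →ₗ[ℝ] ℝ →ₗ[ℝ] ℝ) := by
        ext; simp
      rw [hflip] at h2
      rw [SchwartzMap.fourierInv_coe]
      exact h2
    simpa [Φ] using! h3
  refine ⟨∫ x, ‖g x‖, ?_⟩
  filter_upwards [key] with x hx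
  rw [hx]
  exact VectorFourier.norm_fourierIntegral_le_integral_norm _ _ _ _ _

lemma hasCompactSupport_lowFreqSymbol (χ : LowFreqCutoff) {N : ℝ} (hN : 0 < N) :
    HasCompactSupport (lowFreqSymbol χ N) := by
  refine HasCompactSupport.intro (isCompact_Icc (a := -N) (b := N)) fun η hη => ?_
  have h : N < |η| := by
    by_contra! h
    exact hη (abs_le.mp h)
  have h2 : 2 ≤ |2 * Real.pi * η / N| := by
    rw [abs_div, abs_mul, abs_of_pos hN, abs_of_pos Real.two_pi_pos, le_div_iff₀ hN]
    nlinarith [Real.pi_gt_three]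
  simp [lowFreqSymbol, χ.eq_zero _ h2]

lemma integrable_symbol_mul (χ : LowFreqCutoff) {N : ℝ} (hN : 0 < N) (f : L2) :
    Integrable (((memLp_lowFreqSymbol χ N).toLp _ • 𝓕 f : L2) : ℝ → ℂ) volume := by
  have hm : MemLp (lowFreqSymbol χ N) 2 volume :=
    (continuous_lowFreqSymbol χ N).memLp_of_hasCompactSupport
      (hasCompactSupport_lowFreqSymbol χ hN)
  refine (hm.integrable_mul (Lp.memLp (𝓕 f : L2))).congr ?_
  filter_upwards [Lp.coeFn_lpSMul (r := 2) ((memLp_lowFreqSymbol χ N).toLp _) (𝓕 f : L2),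
    (memLp_lowFreqSymbol χ N).coeFn_toLp] with x h1 h2
  rw [h1]
  simp [h2]

/-- For `f ∈ L²` and `N > 0`, also `F(P_{≤ N} f) ∈ L²`, because `P_{≤ N} f ∈ L² ∩ L^∞`. -/
lemma memLp_cubic_lowFreq (χ : LowFreqCutoff) (σ : ℝ) {N : ℝ} (hN : 0 < N) (f : L2) :
    MemLp (fun x => cubic σ (lowFreq χ N f x)) 2 volume := by
  obtain ⟨C, hC⟩ := fourierInv_bounded _ (integrable_symbol_mul χ hN f)
  have hm := Lp.memLp (lowFreq χ N f)
  refine MemLp.of_le_mul (c := |σ| * C ^ 2) hm ?_ ?_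
  · have := hm.aestronglyMeasurable
    have hc : Continuous (cubic σ) := by unfold cubic; fun_prop
    exact hc.comp_aestronglyMeasurable this
  · filter_upwards [hC] with x hx
    change ‖lowFreq χ N f x‖ ≤ C at hx
    simp only [cubic, norm_mul, norm_pow, Complex.norm_real, Real.norm_eq_abs, abs_norm]
    gcongr

/-- The truncated nonlinearity `f ↦ P_{≤ N} F(P_{≤ N} f)` on `L²(ℝ)`. -/
def truncatedCubic (χ : LowFreqCutoff) (σ : ℝ) {N : ℝ} (hN : 0 < N) (f : L2) : L2 :=
  lowFreq χ N ((memLp_cubic_lowFreq χ σ hN f).toLp _)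

/-- `u : ℝ × ℝ → ℂ`, `(t, x) ↦ u (t, x)`, is a (global) solution of
`i u_t + Δ u = P_{≤ N} F(P_{≤ N} u)` with initial data `u(0)`: it lies in `C_t L²_x(K × ℝ)` and
`L⁶_{t,x}(K × ℝ)` for every compact `K ⊆ ℝ` and obeys the Duhamel formula for all `t`
(as an identity in `L²(ℝ)`, with an `L²(ℝ)`-valued Bochner integral). -/
structure IsSolution (χ : LowFreqCutoff) (σ : ℝ) {N : ℝ} (hN : 0 < N) (u : ℝ × ℝ → ℂ) : Prop where
  aestronglyMeasurable : AEStronglyMeasurable u volume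
  memLp_two : ∀ t, MemLp (fun x => u (t, x)) 2 volume
  continuous : Continuous fun t => ((memLp_two t).toLp _ : L2)
  memLp_six : ∀ K : Set ℝ, IsCompact K → MemLp u 6 (volume.restrict (K ×ˢ Set.univ))
  duhamel : ∀ t, ((memLp_two t).toLp _ : L2) =
    propagator t ((memLp_two 0).toLp _) -
      Complex.I • ∫ s in (0 : ℝ)..t,
        propagator (t - s) (truncatedCubic χ σ hN ((memLp_two s).toLp _))

end TruncatedNLS

end

/-!
The bounds on the solutions do not depend on the truncation parameters `N n`, so no relation between
them is needed. What makes a bounded sequence of solutions compact is local smoothing for the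
Schrödinger equation, together with equicontinuity in time.

*Linear estimates.* At a fixed point `x`, Plancherel in time shows that a free wave with frequencies
above `K` has square integral `O(1 / K)` in time (`lintegral_time_freeWave_sq_le`). The `L⁶`
Strichartz estimate (`strichartz`) needs neither dispersive estimates nor fractional integration:
Plancherel in space and time shows that half a derivative of the mass density `|u|²` of a free wave
is in `L²` of space-time (the Planchon–Vega estimate, `lintegral_density_gagliardo_le`), and an
elementary Gagliardo–Nirenberg inequality (`cube_le_mul_lintegral_increment`) interpolates this with
the conserved mass. Both estimates carry over to inhomogeneous solutions with force in `L¹_t L²_x`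
(`lintegral_propagator_path_le`), because the `L⁶` norm and the weighted `L²` norm are suprema of
continuous functionals on `L²` (`IsDualNorm`).

*Uniform bounds.* The mass is conserved (`IsSolution.norm_path`), and a continuity argument in `L⁶`
for `P_{≤ N} u` gives bounds on time intervals whose length depends only on the mass; these add up
to bounds on any bounded time interval (`exists_uniform_bound`). Since `P_{≤ N}` is a contraction
that commutes with the propagator, `N` does not enter.

*Compactness.* In the interaction picture `e^{-itΔ} u(t)` the solutions are equicontinuous in `L²`,
so a subsequence converges weakly at every time (`exists_subseq_weakly_cauchy`). On low frequencies,
with a spatial weight, this implies strong convergence (`tendsto_weightOperator_sharpLow`), while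
the high frequencies are uniformly small by local smoothing. Hence the subsequence is Cauchy in a
weighted `L²` space on space-time (`tendsto_lintegral_weight_weightOperator`). Hölder's inequality
with the uniform `L⁶` bound gives convergence in `L^p` on boxes for `p < 6`
(`tendsto_eLpNorm_of_two_of_six`).
-/

noncomputable section

namespace TruncatedNLS

/-! ### The Fourier integral and Plancherel's inequality -/

/-- On `L¹ ∩ L²` the inverse Fourier transform of `L²` is given by the Fourier integral. -/
lemma coeFn_fourierInv (g : L2) (hg : Integrable g volume) :
    ⇑(𝓕⁻ g : L2) =ᵐ[volume] 𝓕⁻ (g : ℝ → ℂ) := by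
  have hL : Continuous fun p : ℝ × ℝ => (-innerₗ ℝ : ℝ →ₗ[ℝ] ℝ →ₗ[ℝ] ℝ) p.1 p.2 := by
    simp only [LinearMap.neg_apply, innerₗ_apply_apply]
    fun_prop
  have hcont : Continuous (𝓕⁻ (g : ℝ → ℂ)) :=
    VectorFourier.fourierIntegral_continuous Real.continuous_fourierChar
      (L := -innerₗ ℝ) hL hg
  refine ae_eq_of_integral_contDiff_smul_eq
    ((Lp.memLp (𝓕⁻ g : L2)).locallyIntegrable (by norm_num)) hcont.locallyIntegrable ?_
  intro φ hφ hφc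
  have hc : HasCompactSupport (fun x => (φ x : ℂ)) := hφc.comp_left (g := Complex.ofReal) rfl
  have hs : ContDiff ℝ ∞ (fun x => (φ x : ℂ)) := Complex.ofRealCLM.contDiff.comp hφ
  let Φ : SchwartzMap ℝ ℂ := hc.toSchwartzMap hs
  -- The identity holds in the sense of tempered distributions; test it against `φ`.
  have h1 : (𝓕⁻ (g : TemperedDistribution ℝ ℂ)) Φ
      = ((𝓕⁻ g : L2) : TemperedDistribution ℝ ℂ) Φ := by
    rw [Lp.fourierInv_toTemperedDistribution_eq]
  rw [TemperedDistribution.fourierInv_apply, Lp.toTemperedDistribution_apply,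
    Lp.toTemperedDistribution_apply] at h1
  have h2 := VectorFourier.integral_fourierIntegral_smul_eq_flip (L := -innerₗ ℝ)
    (μ := (volume : Measure ℝ)) (ν := (volume : Measure ℝ)) Real.continuous_fourierChar
    hL Φ.integrable hg
  have h3 : ∫ x, Φ x • (𝓕⁻ g : L2) x = ∫ x, Φ x • 𝓕⁻ (g : ℝ → ℂ) x := by
    rw [← h1]
    have hflip : (-innerₗ ℝ).flip = (-innerₗ ℝ : ℝ →ₗ[ℝ] ℝ →ₗ[ℝ] ℝ) := by
      ext; simp
    rw [hflip] at h2
    rw [SchwartzMap.fourierInv_coe]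
    exact h2
  simpa [Φ] using! h3

lemma enorm_sq_L2 (f : L2) : ‖f‖ₑ ^ 2 = ∫⁻ x, ‖f x‖ₑ ^ 2 := by
  rw [Lp.enorm_def, eLpNorm_eq_lintegral_rpow_enorm_toReal (by norm_num) (by norm_num)]
  simp only [ENNReal.toReal_ofNat, ENNReal.rpow_ofNat, one_div]
  rw [← ENNReal.rpow_natCast, ← ENNReal.rpow_mul]
  norm_num

lemma fourierInv_eq_zero_of_not_integrable {b : ℝ → ℂ} (hb : ¬ Integrable b) (x : ℝ) :
    𝓕⁻ b x = 0 := by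
  rw [Real.fourierInv_eq_fourier_neg, Real.fourier_eq]
  exact integral_undef fun h => hb ((Real.fourierIntegral_convergent_iff _).1 h)

/-- Plancherel's inequality for the Fourier integral. No hypothesis on `b` is needed: the Fourier
integral of a function that is not integrable is `0` by convention, and the right-hand side is
infinite for a measurable function that is not square integrable. -/
lemma lintegral_fourierInv_sq_le (b : ℝ → ℂ) :
    ∫⁻ x, ‖𝓕⁻ b x‖ₑ ^ 2 ≤ ∫⁻ ξ, ‖b ξ‖ₑ ^ 2 := by
  by_cases hb : Integrable b
  swap
  · simp [fourierInv_eq_zero_of_not_integrable hb]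
  by_cases hb2 : MemLp b 2 volume
  swap
  · have : ∫⁻ ξ, ‖b ξ‖ₑ ^ 2 = ⊤ := by
      by_contra h
      refine hb2 ⟨hb.aestronglyMeasurable, ?_⟩
      rw [eLpNorm_lt_top_iff_lintegral_rpow_enorm_lt_top (by norm_num) (by norm_num)]
      simpa using Ne.lt_top h
    simp [this]
  let g : L2 := hb2.toLp b
  have hg : ⇑g =ᵐ[volume] b := hb2.coeFn_toLp
  have hgi : Integrable g volume := hb.congr hg.symm
  have h1 : 𝓕⁻ b = 𝓕⁻ (g : ℝ → ℂ) := by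
    ext x
    simp only [Real.fourierInv_eq]
    exact integral_congr_ae (hg.symm.mono fun v hv => by simp only [hv])
  have h2 : ∫⁻ x, ‖𝓕⁻ b x‖ₑ ^ 2 = ‖(𝓕⁻ g : L2)‖ₑ ^ 2 := by
    rw [h1, enorm_sq_L2]
    exact lintegral_congr_ae ((coeFn_fourierInv g hgi).symm.mono fun v hv => by simp only [hv])
  have h3 : ‖(𝓕⁻ g : L2)‖ₑ = ‖g‖ₑ := by
    have : ‖(𝓕⁻ g : L2)‖ = ‖g‖ := (Lp.fourierTransformₗᵢ ℝ ℂ).symm.norm_map g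
    rw [← ofReal_norm, this, ofReal_norm]
  rw [h2, h3, enorm_sq_L2]
  exact (lintegral_congr_ae (hg.mono fun v hv => by simp only [hv])).le

lemma lintegral_comp_const_mul (f : ℝ → ℝ≥0∞) (hf : Measurable f) {c : ℝ} (hc : c ≠ 0) :
    ∫⁻ t, f (c * t) = ENNReal.ofReal |c⁻¹| * ∫⁻ t, f t := by
  rw [← smul_eq_mul, ← lintegral_smul_measure, ← Real.map_volume_mul_left hc,
    lintegral_map hf (measurable_const_mul c)]

lemma measurable_fourierInv (b : ℝ → ℂ) : Measurable (𝓕⁻ b) := by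
  by_cases hb : Integrable b
  · have hL : Continuous fun p : ℝ × ℝ => (-innerₗ ℝ : ℝ →ₗ[ℝ] ℝ →ₗ[ℝ] ℝ) p.1 p.2 := by
      simp only [LinearMap.neg_apply, innerₗ_apply_apply]
      fun_prop
    exact (VectorFourier.fourierIntegral_continuous Real.continuous_fourierChar
      (L := -innerₗ ℝ) hL hb).measurable
  · have : 𝓕⁻ b = fun _ => 0 := funext (fourierInv_eq_zero_of_not_integrable hb)
    rw [this]; exact measurable_const

/-- Plancherel's inequality after a linear change of the frequency variable. -/
lemma lintegral_fourierInv_const_mul_sq_le (b : ℝ → ℂ) {c : ℝ} (hc : c ≠ 0) :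
    ∫⁻ t, ‖𝓕⁻ b (c * t)‖ₑ ^ 2 ≤ ENNReal.ofReal |c⁻¹| * ∫⁻ ξ, ‖b ξ‖ₑ ^ 2 := by
  rw [lintegral_comp_const_mul (fun t => ‖𝓕⁻ b t‖ₑ ^ 2)
    ((measurable_fourierInv b).enorm.pow_const 2) hc]
  exact mul_le_mul_right (lintegral_fourierInv_sq_le b) _

/-! ### Free waves and local smoothing -/

/-- The free Schrödinger wave with frequency profile `a`, as a function of `(t, x)` that is defined
pointwise by the Fourier integral. -/
def freeWave (a : ℝ → ℂ) (t x : ℝ) : ℂ := 𝓕⁻ (fun ξ => schrodingerSymbol t ξ * a ξ) x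

lemma measurable_schrodingerSymbol_uncurry :
    Measurable fun p : ℝ × ℝ => schrodingerSymbol p.1 p.2 := by
  unfold schrodingerSymbol
  exact Continuous.measurable (by fun_prop)

lemma measurable_freeWave {a : ℝ → ℂ} (ha : Measurable a) :
    Measurable fun p : ℝ × ℝ => freeWave a p.1 p.2 := by
  simp only [freeWave, Real.fourierInv_eq']
  refine StronglyMeasurable.measurable ?_
  refine StronglyMeasurable.integral_prod_right (f := fun (p : ℝ × ℝ) (v : ℝ) =>
    Complex.exp (↑(2 * Real.pi * inner ℝ v p.2) * Complex.I) •
      (schrodingerSymbol p.1 v * a v)) ?_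
  refine Measurable.stronglyMeasurable ?_
  have h1 : Measurable fun q : (ℝ × ℝ) × ℝ =>
      Complex.exp (↑(2 * Real.pi * inner ℝ q.2 q.1.2) * Complex.I) :=
    Continuous.measurable (by fun_prop)
  have h2 : Measurable fun q : (ℝ × ℝ) × ℝ => schrodingerSymbol q.1.1 q.2 :=
    measurable_schrodingerSymbol_uncurry.comp (by fun_prop : Measurable fun q : (ℝ × ℝ) × ℝ =>
      (q.1.1, q.2))
  exact h1.smul (h2.mul (ha.comp measurable_snd))

lemma measurable_freeWave_right {a : ℝ → ℂ} (ha : Measurable a) (t : ℝ) :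
    Measurable (freeWave a t) :=
  Measurable.of_uncurry_left (f := freeWave a) (measurable_freeWave ha)

lemma lintegral_freeWave_sq_le (a : ℝ → ℂ) (t : ℝ) :
    ∫⁻ x, ‖freeWave a t x‖ₑ ^ 2 ≤ ∫⁻ ξ, ‖a ξ‖ₑ ^ 2 := by
  refine (lintegral_fourierInv_sq_le _).trans (le_of_eq ?_)
  congr with ξ
  rw [enorm_mul, ← ofReal_norm (schrodingerSymbol t ξ), norm_schrodingerSymbol]
  simp

/-- Folding an integral over the line onto the half line. -/
lemma lintegral_eq_lintegral_Ioi_add_neg {f : ℝ → ℝ≥0∞} (hf : Measurable f) :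
    ∫⁻ x, f x = ∫⁻ x in Set.Ioi 0, (f x + f (-x)) := by
  rw [lintegral_add_left hf, ← lintegral_add_compl f measurableSet_Ioi (A := Set.Ioi (0 : ℝ))]
  congr 1
  rw [Set.compl_Ioi]
  have h := (Measure.measurePreserving_neg (volume : Measure ℝ)).setLIntegral_comp_preimage
    (s := Set.Iic 0) measurableSet_Iic hf
  rw [← h]
  refine setLIntegral_congr ?_
  have : (Neg.neg ⁻¹' Set.Iic (0 : ℝ)) = Set.Ici 0 := by ext; simp
  rw [this]
  exact Ioi_ae_eq_Ici.symm

lemma integral_eq_integral_Ioi_add_neg {f : ℝ → ℂ} (hf : Integrable f) :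
    ∫ x, f x = ∫ x in Set.Ioi 0, (f x + f (-x)) := by
  rw [integral_add hf.integrableOn hf.comp_neg.integrableOn, integral_comp_neg_Ioi, neg_zero,
    add_comm, intervalIntegral.integral_Iic_add_Ioi hf.integrableOn hf.integrableOn]

lemma image_sq_Ioi : (fun x : ℝ => x ^ 2) '' Set.Ioi 0 = Set.Ioi 0 := by
  ext y
  simp only [Set.mem_image, Set.mem_Ioi]
  constructor
  · rintro ⟨x, hx, rfl⟩; positivity
  · intro hy; exact ⟨√y, Real.sqrt_pos.2 hy, Real.sq_sqrt hy.le⟩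

lemma injOn_sq_Ioi : Set.InjOn (fun x : ℝ => x ^ 2) (Set.Ioi 0) := by
  intro x hx y hy h
  exact (pow_left_inj₀ (le_of_lt hx) (le_of_lt hy) two_ne_zero).1 h

/-- Local smoothing: at each fixed position `x`, a free wave of frequency at least `K` is square
integrable in time with a gain of `1 / K`. The time frequency is the square of the space
frequency, and the gain is the Jacobian of this change of variables. -/
lemma lintegral_time_freeWave_sq_le {a : ℝ → ℂ} (ham : Measurable a) (ha : Integrable a)
    {K : ℝ} (hK : 0 < K) (hsupp : ∀ ξ, |ξ| ≤ K → a ξ = 0) (x : ℝ) :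
    ∫⁻ t, ‖freeWave a t x‖ₑ ^ 2 ≤ ENNReal.ofReal (1 / K) * ∫⁻ ξ, ‖a ξ‖ₑ ^ 2 := by
  let A : ℝ → ℂ := fun ξ => Complex.exp (↑(2 * Real.pi * (ξ * x)) * Complex.I) * a ξ
  have hAn : ∀ ξ, ‖A ξ‖ₑ = ‖a ξ‖ₑ := fun ξ => by
    simp only [A, enorm_mul]
    rw [← ofReal_norm (Complex.exp _), Complex.norm_exp_ofReal_mul_I]
    simp
  -- Folding `ξ` and `-ξ`, which have the same time frequency, and then substituting `y = ξ²` turns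
  -- the wave at the point `x` into the Fourier integral in time of the function `b` below.
  let c : ℝ → ℂ := fun ξ => A ξ + A (-ξ)
  have hcs : ∀ ξ, |ξ| ≤ K → c ξ = 0 := fun ξ h => by
    simp [c, A, hsupp ξ h, hsupp (-ξ) (by rwa [abs_neg])]
  let b : ℝ → ℂ := (Set.Ioi 0).indicator fun y => ((2 * √y)⁻¹ : ℝ) • c (√y)
  -- `b` carries the Jacobian `1 / (2√y)`, so that `∫ |b|² dy = ∫ |c|² / (2ξ) dξ`.
  have hder : ∀ y ∈ Set.Ioi (0 : ℝ), HasDerivWithinAt (fun x : ℝ => x ^ 2) (2 * y)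
      (Set.Ioi 0) y := fun y _ => by
    simpa using (hasDerivAt_pow 2 y).hasDerivWithinAt
  have hwave : ∀ t, freeWave a t x = 𝓕⁻ b (-(2 * Real.pi) * t) := by
    intro t
    have e1 : ∀ ξ, Complex.exp (↑(2 * Real.pi * inner ℝ ξ x) * Complex.I) •
        (schrodingerSymbol t ξ * a ξ) = schrodingerSymbol t ξ * A ξ := fun ξ => by
      simp only [A, smul_eq_mul, RCLike.inner_apply, conj_trivial]
      rw [mul_comm x ξ]
      ring
    have hint : Integrable fun ξ => schrodingerSymbol t ξ * A ξ := by
      have h1 : Measurable fun ξ => schrodingerSymbol t ξ * A ξ := by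
        refine Measurable.mul ?_ (Measurable.mul ?_ ham)
        · exact measurable_schrodingerSymbol_uncurry.comp (measurable_prodMk_left (x := t))
        · exact Continuous.measurable (by fun_prop)
      refine ha.mono h1.aestronglyMeasurable (.of_forall fun ξ => ?_)
      rw [norm_mul, norm_schrodingerSymbol, one_mul, ← toReal_enorm, hAn, toReal_enorm]
    rw [freeWave, Real.fourierInv_eq', Real.fourierInv_eq']
    simp only [e1]
    rw [integral_eq_integral_Ioi_add_neg hint]
    have e2 : ∀ v : ℝ, Complex.exp (↑(2 * Real.pi * inner ℝ v (-(2 * Real.pi) * t)) * Complex.I)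
        • b v = (Set.Ioi 0).indicator (fun y => Complex.exp (↑(2 * Real.pi *
          (-(2 * Real.pi) * t * y)) * Complex.I) • ((2 * √y)⁻¹ : ℝ) • c (√y)) v := fun v => by
      by_cases hv : v ∈ Set.Ioi (0 : ℝ)
      · simp only [b, Set.indicator_of_mem hv, RCLike.inner_apply, conj_trivial]
      · simp only [b, Set.indicator_of_notMem hv, smul_zero]
    simp only [e2]
    rw [integral_indicator measurableSet_Ioi]
    have e3 := integral_image_eq_integral_abs_deriv_smul measurableSet_Ioi hder injOn_sq_Ioi
      (fun y => Complex.exp (↑(2 * Real.pi *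
          (-(2 * Real.pi) * t * y)) * Complex.I) • ((2 * √y)⁻¹ : ℝ) • c (√y))
    rw [image_sq_Ioi] at e3
    rw [e3]
    refine setIntegral_congr_fun measurableSet_Ioi fun ξ hξ => ?_
    have hξ' : (0 : ℝ) < ξ := hξ
    have hs : schrodingerSymbol t (-ξ) = schrodingerSymbol t ξ := by
      simp [schrodingerSymbol]
    simp only [hs]
    rw [Real.sqrt_sq hξ'.le, abs_of_pos (by positivity), smul_comm (2 * ξ), smul_smul (2 * ξ),
      mul_inv_cancel₀ (by positivity), one_smul, smul_eq_mul, ← mul_add]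
    congr 1
    rw [schrodingerSymbol]
    congr 1
    push_cast
    ring
  simp only [hwave]
  refine (lintegral_fourierInv_const_mul_sq_le b (by simp [Real.pi_ne_zero])).trans ?_
  have hb : ∫⁻ ξ, ‖b ξ‖ₑ ^ 2 ≤ ENNReal.ofReal (1 / K) * ∫⁻ ξ, ‖a ξ‖ₑ ^ 2 := by
    have e1 : ∀ v, ‖b v‖ₑ ^ 2 = (Set.Ioi 0).indicator
        (fun y => ‖((2 * √y)⁻¹ : ℝ) • c (√y)‖ₑ ^ 2) v := fun v => by
      by_cases hv : v ∈ Set.Ioi (0 : ℝ)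
      · simp only [b, Set.indicator_of_mem hv]
      · simp only [b, Set.indicator_of_notMem hv]; simp
    simp only [e1]
    rw [lintegral_indicator measurableSet_Ioi]
    have e3 := lintegral_image_eq_lintegral_abs_deriv_mul measurableSet_Ioi hder injOn_sq_Ioi
      (fun y => ‖((2 * √y)⁻¹ : ℝ) • c (√y)‖ₑ ^ 2)
    rw [image_sq_Ioi] at e3
    rw [e3, lintegral_eq_lintegral_Ioi_add_neg (ham.enorm.pow_const 2),
      ← lintegral_const_mul _ (by fun_prop)]
    refine setLIntegral_mono (by fun_prop) fun ξ hξ => ?_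
    have hξ' : (0 : ℝ) < ξ := hξ
    rw [Real.sqrt_sq hξ'.le]
    by_cases hKξ : |ξ| ≤ K
    · simp [hcs ξ hKξ]
    rw [not_le, abs_of_pos hξ'] at hKξ
    have hc2 : ‖c ξ‖ ^ 2 ≤ 2 * (‖a ξ‖ ^ 2 + ‖a (-ξ)‖ ^ 2) := by
      have h1 : ‖c ξ‖ ≤ ‖a ξ‖ + ‖a (-ξ)‖ := by
        refine (norm_add_le _ _).trans (le_of_eq ?_)
        simp only [← toReal_enorm, hAn]
      nlinarith [sq_nonneg (‖a ξ‖ - ‖a (-ξ)‖), norm_nonneg (c ξ)]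
    simp only [← ofReal_norm]
    simp only [← ENNReal.ofReal_pow (norm_nonneg _)]
    rw [← ENNReal.ofReal_mul (abs_nonneg _), ← ENNReal.ofReal_add (by positivity) (by positivity),
      ← ENNReal.ofReal_mul (by positivity)]
    refine ENNReal.ofReal_le_ofReal ?_
    rw [abs_of_pos (by positivity), norm_smul, mul_pow, Real.norm_eq_abs, sq_abs]
    calc 2 * ξ * ((2 * ξ)⁻¹ ^ 2 * ‖c ξ‖ ^ 2)
        = (1 / (2 * ξ)) * ‖c ξ‖ ^ 2 := by field_simp
      _ ≤ (1 / (2 * K)) * (2 * (‖a ξ‖ ^ 2 + ‖a (-ξ)‖ ^ 2)) := by gcongr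
      _ = 1 / K * (‖a ξ‖ ^ 2 + ‖a (-ξ)‖ ^ 2) := by field_simp
  -- The dilation by `2π` contributes the factor `1 / (2π) ≤ 1`.
  calc _ ≤ 1 * ∫⁻ ξ, ‖b ξ‖ₑ ^ 2 := by
        gcongr
        rw [ENNReal.ofReal_le_one, abs_inv, abs_neg, abs_of_pos (by positivity)]
        exact inv_le_one_of_one_le₀ (by linarith [Real.pi_gt_three])
    _ ≤ _ := by rw [one_mul]; exact hb

/-! ### The `L⁶` Strichartz estimate for free waves -/

/-- The Fourier integral turns the autocorrelation of `A` into the squared modulus. -/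
lemma fourierInv_autocorrelation {A : ℝ → ℂ} (hA : Integrable A) (x : ℝ) :
    𝓕⁻ (fun ζ => ∫ ξ, A ξ * starRingEnd ℂ (A (ξ - ζ))) x = ((‖𝓕⁻ A x‖ ^ 2 : ℝ) : ℂ) := by
  -- The autocorrelation is the convolution of `A` with its reflected conjugate.
  let B : ℝ → ℂ := fun y => starRingEnd ℂ (A (-y))
  have hB : Integrable B :=
    (Complex.conjLIE.toContinuousLinearEquiv.toContinuousLinearMap.integrable_comp hA).comp_neg
  have h1 : (fun ζ => ∫ ξ, A ξ * starRingEnd ℂ (A (ξ - ζ)))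
      = MeasureTheory.convolution A B (ContinuousLinearMap.mul ℂ ℂ) volume := by
    ext ζ
    simp [MeasureTheory.convolution_def, B]
  have h2 : 𝓕 B (-x) = starRingEnd ℂ (𝓕 A (-x)) := by
    rw [Real.fourier_eq', Real.fourier_eq', ← integral_conj, ← integral_neg_eq_self]
    congr with v
    simp only [B, smul_eq_mul, map_mul, neg_neg, ← Complex.exp_conj, Complex.conj_ofReal,
      Complex.conj_I, inner_neg_left, inner_neg_right]
    congr 2
    push_cast
    ring
  rw [h1, Real.fourierInv_eq_fourier_neg, Real.fourier_mul_convolution_eq hA hB, h2,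
    Complex.mul_conj, Complex.normSq_eq_norm_sq, Real.fourierInv_eq_fourier_neg]

lemma integrable_autocorrelation {A : ℝ → ℂ} (hA : Integrable A) :
    Integrable fun ζ => ∫ ξ, A ξ * starRingEnd ℂ (A (ξ - ζ)) := by
  let B : ℝ → ℂ := fun y => starRingEnd ℂ (A (-y))
  have hB : Integrable B :=
    (Complex.conjLIE.toContinuousLinearEquiv.toContinuousLinearMap.integrable_comp hA).comp_neg
  have h1 : (fun ζ => ∫ ξ, A ξ * starRingEnd ℂ (A (ξ - ζ)))
      = MeasureTheory.convolution A B (ContinuousLinearMap.mul ℂ ℂ) volume := by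
    ext ζ
    simp [MeasureTheory.convolution_def, B]
  rw [h1]
  exact hA.integrable_convolution _ hB

/-- The spatial Fourier transform of the mass density `|u(t)|²` of the free wave `u` with
frequency profile `a`. -/
def densityTransform (a : ℝ → ℂ) (t ζ : ℝ) : ℂ :=
  ∫ ξ, (schrodingerSymbol t ξ * a ξ) *
    starRingEnd ℂ (schrodingerSymbol t (ξ - ζ) * a (ξ - ζ))

lemma integrable_symbol_mul_profile {a : ℝ → ℂ} (ham : Measurable a) (ha : Integrable a) (t : ℝ) :
    Integrable fun ξ => schrodingerSymbol t ξ * a ξ := by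
  have h1 : Measurable fun ξ => schrodingerSymbol t ξ * a ξ :=
    (measurable_schrodingerSymbol_uncurry.comp (measurable_prodMk_left (x := t))).mul ham
  refine ha.mono h1.aestronglyMeasurable (.of_forall fun ξ => ?_)
  rw [norm_mul, norm_schrodingerSymbol, one_mul]

lemma measurable_densityTransform {a : ℝ → ℂ} (ham : Measurable a) :
    Measurable fun p : ℝ × ℝ => densityTransform a p.1 p.2 := by
  unfold densityTransform
  refine StronglyMeasurable.measurable ?_
  refine StronglyMeasurable.integral_prod_right (f := fun (p : ℝ × ℝ) (ξ : ℝ) =>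
    (schrodingerSymbol p.1 ξ * a ξ) *
    starRingEnd ℂ (schrodingerSymbol p.1 (ξ - p.2) * a (ξ - p.2))) ?_
  refine Measurable.stronglyMeasurable ?_
  have h1 : Measurable fun p : ℝ × ℝ => schrodingerSymbol p.1 p.2 * a p.2 :=
    measurable_schrodingerSymbol_uncurry.mul (ham.comp measurable_snd)
  have h2 : Measurable fun q : (ℝ × ℝ) × ℝ => (q.1.1, q.2) := by fun_prop
  have h3 : Measurable fun q : (ℝ × ℝ) × ℝ => (q.1.1, q.2 - q.1.2) := by fun_prop
  exact (h1.comp h2).mul (Complex.continuous_conj.measurable.comp (h1.comp h3))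

lemma measurable_densityTransform_right {a : ℝ → ℂ} (ha : Measurable a) (t : ℝ) :
    Measurable (densityTransform a t) :=
  Measurable.of_uncurry_left (f := densityTransform a) (measurable_densityTransform ha)

/-- Plancherel in space for the increments of the mass density. -/
lemma lintegral_density_increment_le {a : ℝ → ℂ} (ham : Measurable a) (ha : Integrable a)
    (t h : ℝ) :
    ∫⁻ x, ENNReal.ofReal ((‖freeWave a t (x + h)‖ ^ 2 - ‖freeWave a t x‖ ^ 2) ^ 2) ≤
      ∫⁻ ζ, ‖Complex.exp (↑(2 * Real.pi * (h * ζ)) * Complex.I) - 1‖ₑ ^ 2 *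
        ‖densityTransform a t ζ‖ₑ ^ 2 := by
  have hA := integrable_symbol_mul_profile ham ha t
  have hG : Integrable (densityTransform a t) := integrable_autocorrelation hA
  have hconv : ∀ x, Integrable fun v : ℝ =>
      Complex.exp (↑(2 * Real.pi * (x * v)) * Complex.I) * densityTransform a t v := fun x => by
    refine hG.bdd_mul (c := 1) (Continuous.aestronglyMeasurable (by fun_prop))
      (.of_forall fun v => ?_)
    rw [Complex.norm_exp_ofReal_mul_I]
  have hq : ∀ x, ((‖freeWave a t x‖ ^ 2 : ℝ) : ℂ) = 𝓕⁻ (densityTransform a t) x := fun x =>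
    (fourierInv_autocorrelation hA x).symm
  have hd : ∀ x, ((‖freeWave a t (x + h)‖ ^ 2 - ‖freeWave a t x‖ ^ 2 : ℝ) : ℂ)
      = 𝓕⁻ (fun ζ => (Complex.exp (↑(2 * Real.pi * (h * ζ)) * Complex.I) - 1) *
          densityTransform a t ζ) x := fun x => by
    rw [Complex.ofReal_sub, hq, hq]
    simp only [Real.fourierInv_eq', smul_eq_mul, RCLike.inner_apply, conj_trivial]
    rw [← integral_sub (hconv _) (hconv _)]
    congr with v
    rw [show (↑(2 * Real.pi * ((x + h) * v)) * Complex.I : ℂ)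
      = ↑(2 * Real.pi * (x * v)) * Complex.I + ↑(2 * Real.pi * (h * v)) * Complex.I by
        push_cast; ring, Complex.exp_add]
    ring
  calc _ = ∫⁻ x, ‖𝓕⁻ (fun ζ => (Complex.exp (↑(2 * Real.pi * (h * ζ)) * Complex.I) - 1) *
          densityTransform a t ζ) x‖ₑ ^ 2 := by
        congr with x
        rw [← hd, ← ofReal_norm, ← ENNReal.ofReal_pow (norm_nonneg _), Complex.norm_real,
          Real.norm_eq_abs, sq_abs]
    _ ≤ _ := lintegral_fourierInv_sq_le _
    _ = _ := by simp only [enorm_mul, mul_pow]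

/-- Plancherel in time for the transform of the mass density. At a fixed frequency `ζ` the phase
`ξ² - (ξ - ζ)² = 2ξζ - ζ²` is affine in `ξ`, with slope `2ζ`, which produces the gain `1 / |ζ|`. -/
lemma lintegral_time_densityTransform_le {a : ℝ → ℂ} {ζ : ℝ} (hζ : ζ ≠ 0) :
    ∫⁻ t, ‖densityTransform a t ζ‖ₑ ^ 2 ≤
      ENNReal.ofReal (1 / (4 * Real.pi * |ζ|)) * ∫⁻ ξ, ‖a ξ‖ₑ ^ 2 * ‖a (ξ - ζ)‖ₑ ^ 2 := by
  let p : ℝ → ℂ := fun ξ => a ξ * starRingEnd ℂ (a (ξ - ζ))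
  have h1 : ∀ t, ‖densityTransform a t ζ‖ₑ = ‖𝓕⁻ p (-(4 * Real.pi * ζ) * t)‖ₑ := fun t => by
    have : densityTransform a t ζ = Complex.exp (((t * (2 * Real.pi * ζ) ^ 2 : ℝ) : ℂ) * Complex.I) *
        𝓕⁻ p (-(4 * Real.pi * ζ) * t) := by
      rw [Real.fourierInv_eq', densityTransform, ← integral_const_mul]
      congr with ξ
      have e : schrodingerSymbol t ξ * starRingEnd ℂ (schrodingerSymbol t (ξ - ζ))
          = Complex.exp (((t * (2 * Real.pi * ζ) ^ 2 : ℝ) : ℂ) * Complex.I) *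
            Complex.exp (↑(2 * Real.pi * inner ℝ ξ (-(4 * Real.pi * ζ) * t)) * Complex.I) := by
        rw [schrodingerSymbol, schrodingerSymbol, ← Complex.exp_conj, ← Complex.exp_add,
          ← Complex.exp_add]
        congr 1
        simp only [map_mul, map_neg, map_pow, Complex.conj_I, Complex.conj_ofReal,
          RCLike.inner_apply, conj_trivial, Complex.ofReal_sub, map_sub, map_ofNat]
        push_cast
        ring
      calc _ = (schrodingerSymbol t ξ * starRingEnd ℂ (schrodingerSymbol t (ξ - ζ))) * p ξ := by
            simp only [p, map_mul]; ring
        _ = _ := by rw [e, smul_eq_mul]; ring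
    rw [this, enorm_mul, ← ofReal_norm (Complex.exp _), Complex.norm_exp_ofReal_mul_I]
    simp
  simp only [h1]
  have hc : -(4 * Real.pi * ζ) ≠ 0 := by simp [Real.pi_ne_zero, hζ]
  refine (lintegral_fourierInv_const_mul_sq_le p hc).trans (le_of_eq ?_)
  congr 1
  · congr 1
    rw [abs_inv, abs_neg, abs_mul, abs_of_pos (by positivity), one_div]
  · congr with ξ
    rw [← mul_pow]
    simp [p, enorm_mul]

lemma norm_exp_sub_one_sq_le (θ : ℝ) : ‖Complex.exp (θ * Complex.I) - 1‖ ^ 2 ≤ min (θ ^ 2) 4 := by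
  refine le_min ?_ ?_
  · have h := Real.norm_exp_I_mul_ofReal_sub_one_le (x := θ)
    rw [mul_comm, Real.norm_eq_abs] at h
    rw [← sq_abs θ]
    gcongr
  · have h : ‖Complex.exp (θ * Complex.I) - 1‖ ≤ 2 := by
      refine (norm_sub_le _ _).trans ?_
      rw [Complex.norm_exp_ofReal_mul_I, norm_one]; norm_num
    nlinarith [norm_nonneg (Complex.exp (θ * Complex.I) - 1)]

/-- The weight `dh / h²` on the increments produces a factor `|ζ|` on the Fourier side, which
compensates the gain in `lintegral_time_densityTransform_le`. -/
lemma lintegral_increment_symbol_le (ζ : ℝ) :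
    ∫⁻ h in Set.Ioi (0 : ℝ), ENNReal.ofReal (1 / h ^ 2) *
      ‖Complex.exp (↑(2 * Real.pi * (h * ζ)) * Complex.I) - 1‖ₑ ^ 2
      ≤ ENNReal.ofReal ((4 * Real.pi ^ 2 + 4) * |ζ|) := by
  by_cases hζ : ζ = 0
  · simp [hζ]
  have hz : 0 < |ζ| := abs_pos.2 hζ
  have hb : ∀ h : ℝ, ENNReal.ofReal (1 / h ^ 2) *
      ‖Complex.exp (↑(2 * Real.pi * (h * ζ)) * Complex.I) - 1‖ₑ ^ 2
      ≤ ENNReal.ofReal (1 / h ^ 2 * min ((2 * Real.pi * (h * ζ)) ^ 2) 4) := fun h => by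
    rw [← ofReal_norm, ← ENNReal.ofReal_pow (norm_nonneg _), ← ENNReal.ofReal_mul (by positivity)]
    refine ENNReal.ofReal_le_ofReal (mul_le_mul_of_nonneg_left ?_ (by positivity))
    exact norm_exp_sub_one_sq_le _
  -- Split at `h = 1 / |ζ|`, where the two bounds on the oscillating factor are comparable.
  have hsplit : Set.Ioi (0 : ℝ) = Set.Ioc 0 (1 / |ζ|) ∪ Set.Ioi (1 / |ζ|) :=
    (Set.Ioc_union_Ioi_eq_Ioi (by positivity)).symm
  rw [hsplit]
  refine (lintegral_union_le _ _ _).trans ?_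
  rw [add_mul, ENNReal.ofReal_add (by positivity) (by positivity)]
  gcongr
  · calc _ ≤ ∫⁻ _ in Set.Ioc 0 (1 / |ζ|), ENNReal.ofReal (4 * Real.pi ^ 2 * |ζ| ^ 2) := by
          refine setLIntegral_mono measurable_const fun h hh => (hb h).trans ?_
          refine ENNReal.ofReal_le_ofReal ?_
          have hh0 : 0 < h := hh.1
          refine (mul_le_mul_of_nonneg_left (min_le_left _ _) (by positivity)).trans (le_of_eq ?_)
          rw [sq_abs]
          field_simp
          ring
      _ = ENNReal.ofReal (4 * Real.pi ^ 2 * |ζ|) := by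
          rw [setLIntegral_const, Real.volume_Ioc, ← ENNReal.ofReal_mul (by positivity)]
          congr 1
          field_simp
          ring
      _ ≤ _ := le_rfl
  · calc _ ≤ ∫⁻ h in Set.Ioi (1 / |ζ|), ENNReal.ofReal (4 * h ^ (-2 : ℝ)) := by
          refine setLIntegral_mono (by fun_prop) fun h hh => (hb h).trans ?_
          refine ENNReal.ofReal_le_ofReal ?_
          have hh0 : 0 < h := lt_trans (by positivity) hh
          refine (mul_le_mul_of_nonneg_left (min_le_right _ _) (by positivity)).trans (le_of_eq ?_)
          rw [Real.rpow_neg hh0.le, Real.rpow_two]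
          ring
      _ = ENNReal.ofReal (4 * |ζ|) := by
          have hc : 0 < 1 / |ζ| := by positivity
          rw [← ofReal_integral_eq_lintegral_ofReal]
          · rw [integral_const_mul, integral_Ioi_rpow_of_lt (by norm_num) hc]
            congr 2
            norm_num
            rw [Real.rpow_neg_one, inv_inv]
          · exact (integrableOn_Ioi_rpow_of_lt (by norm_num) hc).const_mul 4
          · filter_upwards [ae_restrict_mem measurableSet_Ioi] with h hh
            have hh0 : 0 < h := lt_trans hc hh
            simp only [Pi.zero_apply]
            positivity
      _ ≤ _ := le_rfl

/-- The Planchon–Vega bilinear estimate: half a derivative of the mass density `|u|²` of a free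
wave is square integrable in space-time. Half a derivative is measured by increments. -/
lemma lintegral_density_gagliardo_le {a : ℝ → ℂ} (ham : Measurable a) (ha : Integrable a) :
    ∫⁻ t, ∫⁻ x, ∫⁻ h in Set.Ioi (0 : ℝ), ENNReal.ofReal
        ((‖freeWave a t (x + h)‖ ^ 2 - ‖freeWave a t x‖ ^ 2) ^ 2 / h ^ 2)
      ≤ 4 * (∫⁻ ξ, ‖a ξ‖ₑ ^ 2) ^ 2 := by
  have hwm := measurable_freeWave ham
  have hGm := measurable_densityTransform ham
  have hem : Measurable fun p : ℝ × ℝ => ENNReal.ofReal (1 / p.1 ^ 2) *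
      ‖Complex.exp (↑(2 * Real.pi * (p.1 * p.2)) * Complex.I) - 1‖ₑ ^ 2 := by fun_prop
  -- At a fixed time: Plancherel in space, then integrate in `h`.
  have step : ∀ t, ∫⁻ x, ∫⁻ h in Set.Ioi (0 : ℝ), ENNReal.ofReal
        ((‖freeWave a t (x + h)‖ ^ 2 - ‖freeWave a t x‖ ^ 2) ^ 2 / h ^ 2)
      ≤ ∫⁻ ζ, ENNReal.ofReal ((4 * Real.pi ^ 2 + 4) * |ζ|) * ‖densityTransform a t ζ‖ₑ ^ 2 := by
    intro t
    have hw1 : Measurable (freeWave a t) := measurable_freeWave_right ham t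
    have hG1 : Measurable (densityTransform a t) := measurable_densityTransform_right ham t
    rw [lintegral_lintegral_swap]
    swap
    · have h1 : Measurable fun p : ℝ × ℝ => freeWave a t (p.1 + p.2) :=
        hw1.comp (measurable_fst.add measurable_snd)
      have h2 : Measurable fun p : ℝ × ℝ => freeWave a t p.1 := hw1.comp measurable_fst
      have h3 : Measurable fun p : ℝ × ℝ => ENNReal.ofReal
          ((‖freeWave a t (p.1 + p.2)‖ ^ 2 - ‖freeWave a t p.1‖ ^ 2) ^ 2 / p.2 ^ 2) := by
        fun_prop
      exact h3.aemeasurable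
    calc _ ≤ ∫⁻ h in Set.Ioi (0 : ℝ), ∫⁻ ζ, (ENNReal.ofReal (1 / h ^ 2) *
            ‖Complex.exp (↑(2 * Real.pi * (h * ζ)) * Complex.I) - 1‖ₑ ^ 2) *
              ‖densityTransform a t ζ‖ₑ ^ 2 := by
          refine lintegral_mono fun h => ?_
          simp only [mul_assoc (ENNReal.ofReal (1 / h ^ 2))]
          rw [lintegral_const_mul _ (by fun_prop)]
          refine le_trans (le_of_eq ?_)
            (mul_le_mul_right (lintegral_density_increment_le ham ha t h) _)
          rw [← lintegral_const_mul]
          · congr with x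
            rw [← ENNReal.ofReal_mul (by positivity)]
            congr 1
            ring
          · have : Measurable fun x : ℝ => freeWave a t (x + h) := hw1.comp (by fun_prop)
            fun_prop
      _ = ∫⁻ ζ, (∫⁻ h in Set.Ioi (0 : ℝ), (ENNReal.ofReal (1 / h ^ 2) *
            ‖Complex.exp (↑(2 * Real.pi * (h * ζ)) * Complex.I) - 1‖ₑ ^ 2)) *
              ‖densityTransform a t ζ‖ₑ ^ 2 := by
          rw [lintegral_lintegral_swap]
          · congr with ζ
            rw [lintegral_mul_const]
            fun_prop
          · have hG2 : Measurable fun p : ℝ × ℝ => ‖densityTransform a t p.2‖ₑ ^ 2 :=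
              (hG1.comp measurable_snd).enorm.pow_const 2
            exact (hem.mul hG2).aemeasurable
      _ ≤ _ := lintegral_mono fun ζ => mul_le_mul_left (lintegral_increment_symbol_le ζ) _
  -- Integrating in time gains the factor `1 / |ζ|`, which cancels the weight.
  calc _ ≤ ∫⁻ t, ∫⁻ ζ, ENNReal.ofReal ((4 * Real.pi ^ 2 + 4) * |ζ|) *
          ‖densityTransform a t ζ‖ₑ ^ 2 := lintegral_mono step
    _ = ∫⁻ ζ, ENNReal.ofReal ((4 * Real.pi ^ 2 + 4) * |ζ|) *
          ∫⁻ t, ‖densityTransform a t ζ‖ₑ ^ 2 := by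
        rw [lintegral_lintegral_swap]
        · congr with ζ
          rw [lintegral_const_mul]
          exact (Measurable.of_uncurry_right (f := densityTransform a) hGm).enorm.pow_const 2
        · have h1 : Measurable fun p : ℝ × ℝ =>
              ENNReal.ofReal ((4 * Real.pi ^ 2 + 4) * |p.2|) := by fun_prop
          exact (h1.mul (hGm.enorm.pow_const 2)).aemeasurable
    _ ≤ ∫⁻ ζ, 4 * ∫⁻ ξ, ‖a ξ‖ₑ ^ 2 * ‖a (ξ - ζ)‖ₑ ^ 2 := by
        refine lintegral_mono_ae ?_
        filter_upwards [compl_mem_ae_iff.2 (measure_singleton (0 : ℝ))] with ζ hζ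
        have hζ' : ζ ≠ 0 := hζ
        refine (mul_le_mul_right (lintegral_time_densityTransform_le hζ') _).trans ?_
        rw [← mul_assoc, ← ENNReal.ofReal_mul (by positivity)]
        gcongr
        rw [ENNReal.ofReal_le_iff_le_toReal (by norm_num)]
        have hz : 0 < |ζ| := abs_pos.2 hζ'
        have hpi := Real.pi_pos
        rw [mul_one_div, div_le_iff₀ (by positivity)]
        have : 4 * Real.pi ^ 2 + 4 ≤ 16 * Real.pi := by
          nlinarith [Real.pi_gt_three, Real.pi_lt_d2]
        calc (4 * Real.pi ^ 2 + 4) * |ζ| ≤ 16 * Real.pi * |ζ| := by gcongr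
          _ = _ := by simp; ring
    _ = 4 * (∫⁻ ξ, ‖a ξ‖ₑ ^ 2) ^ 2 := by
        have hm1 : Measurable fun p : ℝ × ℝ => ‖a p.2‖ₑ ^ 2 * ‖a (p.2 - p.1)‖ₑ ^ 2 :=
          ((ham.comp measurable_snd).enorm.pow_const 2).mul
            ((ham.comp (by fun_prop : Measurable fun p : ℝ × ℝ => p.2 - p.1)).enorm.pow_const 2)
        rw [lintegral_const_mul _ hm1.lintegral_prod_right', lintegral_lintegral_swap
          hm1.aemeasurable, sq (∫⁻ ξ, ‖a ξ‖ₑ ^ 2),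
          ← lintegral_mul_const _ (by fun_prop)]
        congr with ξ
        change ∫⁻ ζ, ‖a ξ‖ₑ ^ 2 * ‖a (ξ - ζ)‖ₑ ^ 2 = _
        rw [lintegral_const_mul]
        · congr 1
          exact lintegral_sub_left_eq_self (fun ζ => ‖a ζ‖ₑ ^ 2) ξ
        · exact (ham.comp (by fun_prop : Measurable fun ζ : ℝ => ξ - ζ)).enorm.pow_const 2

/-- A pointwise form of the Gagliardo–Nirenberg inequality `‖q‖₃³ ≲ ‖q‖₁ ‖|∂|^{1/2} q‖₂²`: compare
`q x` with the average of `q` over `[x, x + H]`, where `H = 2L / q x` is so large that the average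
is at most `q x / 2`. -/
lemma cube_le_mul_lintegral_increment {q : ℝ → ℝ} (hqm : Measurable q) (hq : ∀ x, 0 ≤ q x) {L : ℝ}
    (hL : 0 < L) (hqL : ∫⁻ x, ENNReal.ofReal (q x) ≤ ENNReal.ofReal L) (x : ℝ) :
    ENNReal.ofReal (q x ^ 3) ≤ ENNReal.ofReal (8 / 3 * L) *
      ∫⁻ h in Set.Ioi (0 : ℝ), ENNReal.ofReal ((q (x + h) - q x) ^ 2 / h ^ 2) := by
  set D := ∫⁻ h in Set.Ioi (0 : ℝ), ENNReal.ofReal ((q (x + h) - q x) ^ 2 / h ^ 2) with hD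
  rcases (hq x).eq_or_lt with h0 | hm
  · simp [← h0]
  by_cases hDt : D = ⊤
  · rw [hDt, ENNReal.mul_top]
    · exact le_top
    · simp [hL]
  set m := q x
  set H := 2 * L / m
  have hH : 0 < H := by positivity
  have hmH : m * H = 2 * L := by simp only [H]; field_simp
  have hqx : Measurable fun h => q (x + h) := hqm.comp (by fun_prop)
  -- Integrate `q x ≤ |q (x + h) - q x| + q (x + h)` over `0 < h ≤ H`; the last term contributes
  -- at most `L`, half of the left-hand side `H * q x = 2L`.
  have h1 : ENNReal.ofReal (2 * L) ≤
      (∫⁻ h in Set.Ioc 0 H, ENNReal.ofReal |q (x + h) - m|) + ENNReal.ofReal L := by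
    calc ENNReal.ofReal (2 * L) = ∫⁻ _ in Set.Ioc 0 H, ENNReal.ofReal m := by
          rw [setLIntegral_const, Real.volume_Ioc, ← ENNReal.ofReal_mul hm.le, sub_zero, hmH]
      _ ≤ ∫⁻ h in Set.Ioc 0 H, (ENNReal.ofReal |q (x + h) - m| + ENNReal.ofReal (q (x + h))) := by
          refine lintegral_mono fun h => ?_
          rw [← ENNReal.ofReal_add (abs_nonneg _) (hq _)]
          refine ENNReal.ofReal_le_ofReal ?_
          have := neg_abs_le (q (x + h) - m)
          linarith
      _ = (∫⁻ h in Set.Ioc 0 H, ENNReal.ofReal |q (x + h) - m|)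
            + ∫⁻ h in Set.Ioc 0 H, ENNReal.ofReal (q (x + h)) :=
          lintegral_add_right _ (by fun_prop)
      _ ≤ _ := by
          gcongr
          refine (setLIntegral_le_lintegral _ _).trans ?_
          rw [lintegral_add_left_eq_self (fun y => ENNReal.ofReal (q y)) x]
          exact hqL
  -- Cauchy–Schwarz with the splitting `|q (x + h) - q x| = (|q (x + h) - q x| / h) * h`.
  have h2 : ∫⁻ h in Set.Ioc 0 H, ENNReal.ofReal |q (x + h) - m|
      ≤ D ^ (1 / 2 : ℝ) * ENNReal.ofReal (H ^ 3 / 3) ^ (1 / 2 : ℝ) := by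
    have hol := ENNReal.lintegral_mul_le_Lp_mul_Lq (volume.restrict (Set.Ioc 0 H))
      Real.HolderConjugate.two_two
      (f := fun h => ENNReal.ofReal (|q (x + h) - m| / h)) (g := fun h => ENNReal.ofReal h)
      (by fun_prop) (by fun_prop)
    refine le_trans (le_of_eq ?_) (hol.trans ?_)
    · refine setLIntegral_congr_fun measurableSet_Ioc fun h hh => ?_
      have hh0 : 0 < h := hh.1
      simp only [Pi.mul_apply]
      rw [← ENNReal.ofReal_mul (by positivity), div_mul_cancel₀ _ hh0.ne']
    · gcongr
      · simp only [ENNReal.rpow_ofNat]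
        refine le_trans (setLIntegral_mono (by fun_prop) fun h hh => ?_)
          (lintegral_mono_set Set.Ioc_subset_Ioi_self)
        have hh0 : 0 < h := hh.1
        rw [← ENNReal.ofReal_pow (by positivity), div_pow, sq_abs]
      · have e1 : ∫⁻ h in Set.Ioc 0 H, ENNReal.ofReal h ^ (2 : ℝ)
            = ∫⁻ h in Set.Ioc 0 H, ENNReal.ofReal (h ^ 2) := by
          refine setLIntegral_congr_fun measurableSet_Ioc fun h hh => ?_
          simp only [ENNReal.rpow_ofNat]
          rw [ENNReal.ofReal_pow (le_of_lt hh.1)]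
        rw [e1, ← ofReal_integral_eq_lintegral_ofReal, ← intervalIntegral.integral_of_le hH.le,
          integral_pow]
        · norm_num
        · exact (intervalIntegral.intervalIntegrable_pow 2 (a := 0) (b := H)).1
        · exact .of_forall fun h => by simp only [Pi.zero_apply]; positivity
  obtain ⟨d, hd, hDd⟩ : ∃ d : ℝ, 0 ≤ d ∧ D = ENNReal.ofReal d :=
    ⟨D.toReal, ENNReal.toReal_nonneg, (ENNReal.ofReal_toReal hDt).symm⟩
  rw [hDd] at h2 ⊢
  have h3 : L ≤ √d * √(H ^ 3 / 3) := by
    have := h1.trans (add_le_add_left h2 _)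
    rw [ENNReal.ofReal_rpow_of_nonneg hd (by norm_num),
      ENNReal.ofReal_rpow_of_nonneg (by positivity) (by norm_num),
      ← ENNReal.ofReal_mul (by positivity), ← ENNReal.ofReal_add (by positivity) hL.le,
      ENNReal.ofReal_le_ofReal_iff (by positivity), ← Real.sqrt_eq_rpow, ← Real.sqrt_eq_rpow] at this
    linarith
  have h4 : L ^ 2 ≤ d * (H ^ 3 / 3) := by
    calc L ^ 2 ≤ (√d * √(H ^ 3 / 3)) ^ 2 := by gcongr
      _ = _ := by rw [mul_pow, Real.sq_sqrt hd, Real.sq_sqrt (by positivity)]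
  rw [← ENNReal.ofReal_mul (by positivity)]
  refine ENNReal.ofReal_le_ofReal ?_
  have h5 : L ^ 2 * m ^ 3 ≤ L ^ 2 * (8 / 3 * L * d) := by
    calc L ^ 2 * m ^ 3 ≤ d * (H ^ 3 / 3) * m ^ 3 := by gcongr
      _ = d * (m * H) ^ 3 / 3 := by ring
      _ = _ := by rw [hmH]; ring
  exact le_of_mul_le_mul_left h5 (by positivity)

/-- The `L⁶` Strichartz estimate for free waves with integrable frequency profile. -/
lemma lintegral_freeWave_pow_six_le {a : ℝ → ℂ} (ham : Measurable a) (ha : Integrable a) :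
    ∫⁻ t, ∫⁻ x, ‖freeWave a t x‖ₑ ^ 6 ≤ 11 * (∫⁻ ξ, ‖a ξ‖ₑ ^ 2) ^ 3 := by
  by_cases htop : ∫⁻ ξ, ‖a ξ‖ₑ ^ 2 = ⊤
  · rw [htop]; simp
  -- The pointwise inequality below needs a positive and finite mass.
  by_cases hzero : ∫⁻ ξ, ‖a ξ‖ₑ ^ 2 = 0
  · have h0 : ∀ t, ∫⁻ x, ‖freeWave a t x‖ₑ ^ 6 = 0 := fun t => by
      have h1 := le_antisymm ((lintegral_freeWave_sq_le a t).trans hzero.le) zero_le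
      have hm : Measurable (freeWave a t) := measurable_freeWave_right ham t
      rw [lintegral_eq_zero_iff (by fun_prop)] at h1 ⊢
      filter_upwards [h1] with x hx
      simpa using hx
    simp [h0]
  set L := (∫⁻ ξ, ‖a ξ‖ₑ ^ 2).toReal with hLdef
  have hL : 0 < L := ENNReal.toReal_pos hzero htop
  have hLe : ENNReal.ofReal L = ∫⁻ ξ, ‖a ξ‖ₑ ^ 2 := ENNReal.ofReal_toReal htop
  have hm : ∀ t, Measurable (freeWave a t) := measurable_freeWave_right ham
  have e : ∀ z : ℂ, ENNReal.ofReal (‖z‖ ^ 2) = ‖z‖ₑ ^ 2 := fun z => by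
    rw [ENNReal.ofReal_pow (norm_nonneg _), ofReal_norm]
  have key : ∀ t x, ‖freeWave a t x‖ₑ ^ 6 ≤ ENNReal.ofReal (8 / 3 * L) *
      ∫⁻ h in Set.Ioi (0 : ℝ), ENNReal.ofReal
        ((‖freeWave a t (x + h)‖ ^ 2 - ‖freeWave a t x‖ ^ 2) ^ 2 / h ^ 2) := fun t x => by
    have := cube_le_mul_lintegral_increment (q := fun x => ‖freeWave a t x‖ ^ 2)
      ((hm t).norm.pow_const 2) (fun x => by positivity) hL
      (by simp only [e]; rw [hLe]; exact lintegral_freeWave_sq_le a t) x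
    refine le_trans (le_of_eq ?_) this
    rw [ENNReal.ofReal_pow (by positivity), e, ← pow_mul]
  calc _ ≤ ∫⁻ t, ∫⁻ x, ENNReal.ofReal (8 / 3 * L) *
      ∫⁻ h in Set.Ioi (0 : ℝ), ENNReal.ofReal
        ((‖freeWave a t (x + h)‖ ^ 2 - ‖freeWave a t x‖ ^ 2) ^ 2 / h ^ 2) :=
        lintegral_mono fun t => lintegral_mono fun x => key t x
    _ = ENNReal.ofReal (8 / 3 * L) * ∫⁻ t, ∫⁻ x, ∫⁻ h in Set.Ioi (0 : ℝ), ENNReal.ofReal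
        ((‖freeWave a t (x + h)‖ ^ 2 - ‖freeWave a t x‖ ^ 2) ^ 2 / h ^ 2) := by
        simp only [lintegral_const_mul' _ _ ENNReal.ofReal_ne_top]
    _ ≤ ENNReal.ofReal (8 / 3 * L) * (4 * (∫⁻ ξ, ‖a ξ‖ₑ ^ 2) ^ 2) :=
        mul_le_mul_right (lintegral_density_gagliardo_le ham ha) _
    _ ≤ _ := by
        rw [ENNReal.ofReal_mul (by norm_num), hLe]
        calc ENNReal.ofReal (8 / 3) * (∫⁻ ξ, ‖a ξ‖ₑ ^ 2) * (4 * (∫⁻ ξ, ‖a ξ‖ₑ ^ 2) ^ 2)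
            = (ENNReal.ofReal (8 / 3) * 4) * (∫⁻ ξ, ‖a ξ‖ₑ ^ 2) ^ 3 := by ring
          _ ≤ _ := by
            gcongr
            rw [← ENNReal.ofReal_ofNat 4, ← ENNReal.ofReal_mul (by norm_num),
              ← ENNReal.ofReal_ofNat 11]
            exact ENNReal.ofReal_le_ofReal (by norm_num)

/-! ### Multiplication operators and Fourier multipliers on `L²` -/

/-- Multiplication by a function bounded by `1`, as an operator on `L²(ℝ)`. -/
def mulOperator (m : ℝ → ℂ) (hm : MemLp m ∞ volume) (hb : ∀ x, ‖m x‖ ≤ 1) : L2 →L[ℂ] L2 :=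
  LinearMap.mkContinuous
    { toFun := fun f => (hm.toLp m • f : L2)
      map_add' := fun f g => by
        refine Lp.ext ?_
        filter_upwards [Lp.coeFn_lpSMul (r := 2) (hm.toLp m) (f + g),
          Lp.coeFn_lpSMul (r := 2) (hm.toLp m) f, Lp.coeFn_lpSMul (r := 2) (hm.toLp m) g,
          Lp.coeFn_add f g, Lp.coeFn_add (hm.toLp m • f : L2) (hm.toLp m • g : L2)]
          with x h1 h2 h3 h4 h5
        rw [h5, Pi.add_apply, h1, h2, h3]
        simp only [Pi.smul_apply', h4, Pi.add_apply, smul_add]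
      map_smul' := fun c f => by
        refine Lp.ext ?_
        filter_upwards [Lp.coeFn_lpSMul (r := 2) (hm.toLp m) (c • f),
          Lp.coeFn_lpSMul (r := 2) (hm.toLp m) f,
          Lp.coeFn_smul c f, Lp.coeFn_smul c (hm.toLp m • f : L2)] with x h1 h2 h3 h4
        simp only [RingHom.id_apply]
        rw [h4, Pi.smul_apply, h1, h2]
        simp only [Pi.smul_apply', h3, Pi.smul_apply, smul_eq_mul]
        ring } 1 fun f => by
      rw [one_mul]
      refine Lp.norm_le_norm_of_ae_le ?_
      filter_upwards [Lp.coeFn_lpSMul (r := 2) (hm.toLp m) f, hm.coeFn_toLp] with x h1 h2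
      simp only [LinearMap.coe_mk, AddHom.coe_mk]
      rw [h1, Pi.smul_apply', h2, norm_smul]
      exact mul_le_of_le_one_left (norm_nonneg _) (hb x)

lemma enorm_le_one_of_norm_le_one {z : ℂ} (hz : ‖z‖ ≤ 1) : ‖z‖ₑ ≤ 1 := by
  rw [← ofReal_norm]
  exact ENNReal.ofReal_le_one.2 hz

lemma tendsto_zero_of_sq {ι : Type*} {l : Filter ι} {f : ι → ℝ≥0∞}
    (h : Tendsto (fun i => f i ^ 2) l (𝓝 0)) : Tendsto f l (𝓝 0) := by
  have := (ENNReal.continuous_rpow_const (y := 1 / 2)).tendsto 0 |>.comp h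
  rw [ENNReal.zero_rpow_of_pos (by norm_num)] at this
  refine this.congr fun i => ?_
  simp only [Function.comp_apply]
  rw [← ENNReal.rpow_ofNat, ← ENNReal.rpow_mul]
  norm_num

section mulOperator

variable {m m' : ℝ → ℂ} {hm : MemLp m ∞ volume} {hb : ∀ x, ‖m x‖ ≤ 1}
  {hm' : MemLp m' ∞ volume} {hb' : ∀ x, ‖m' x‖ ≤ 1}

lemma coeFn_mulOperator (f : L2) : ⇑(mulOperator m hm hb f) =ᵐ[volume] fun x => m x * f x := by
  filter_upwards [Lp.coeFn_lpSMul (r := 2) (hm.toLp m) f, hm.coeFn_toLp] with x h1 h2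
  change (hm.toLp m • f : L2) x = _
  rw [h1, Pi.smul_apply', h2, smul_eq_mul]

lemma norm_mulOperator_le (f : L2) : ‖mulOperator m hm hb f‖ ≤ ‖f‖ := by
  refine Lp.norm_le_norm_of_ae_le ?_
  filter_upwards [coeFn_mulOperator (hm := hm) (hb := hb) f] with x h1
  rw [h1, norm_mul]
  exact mul_le_of_le_one_left (norm_nonneg _) (hb x)

lemma norm_mulOperator_eq (h1 : ∀ x, ‖m x‖ = 1) (f : L2) : ‖mulOperator m hm hb f‖ = ‖f‖ := by
  refine le_antisymm (norm_mulOperator_le f) (Lp.norm_le_norm_of_ae_le ?_)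
  filter_upwards [coeFn_mulOperator (hm := hm) (hb := hb) f] with x h
  rw [h, norm_mul, h1, one_mul]

lemma mulOperator_comm (f : L2) :
    mulOperator m hm hb (mulOperator m' hm' hb' f)
      = mulOperator m' hm' hb' (mulOperator m hm hb f) := by
  refine Lp.ext ?_
  filter_upwards [coeFn_mulOperator (hm := hm) (hb := hb) f,
    coeFn_mulOperator (hm := hm') (hb := hb') f,
    coeFn_mulOperator (hm := hm) (hb := hb) (mulOperator m' hm' hb' f),
    coeFn_mulOperator (hm := hm') (hb := hb') (mulOperator m hm hb f)] with x h1 h2 h3 h4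
  rw [h3, h4, h1, h2]
  ring

/-- Multiplication by a real function is symmetric. -/
lemma inner_mulOperator_left (hreal : ∀ x, starRingEnd ℂ (m x) = m x) (f g : L2) :
    inner ℂ (mulOperator m hm hb f) g = inner ℂ f (mulOperator m hm hb g) := by
  rw [L2.inner_def, L2.inner_def]
  refine integral_congr_ae ?_
  filter_upwards [coeFn_mulOperator (hm := hm) (hb := hb) f,
    coeFn_mulOperator (hm := hm) (hb := hb) g] with x h1 h2
  rw [h1, h2]
  simp only [RCLike.inner_apply, map_mul, hreal]
  ring

/-- Multiplication operators converge strongly if their symbols converge pointwise. -/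
lemma tendsto_mulOperator {ι : Type*} {l : Filter ι} [l.IsCountablyGenerated] {M : ι → ℝ → ℂ}
    {hM : ∀ i, MemLp (M i) ∞ volume} {hMb : ∀ i x, ‖M i x‖ ≤ 1}
    (hlim : ∀ x, Tendsto (fun i => M i x) l (𝓝 (m x))) (f : L2) :
    Tendsto (fun i => mulOperator (M i) (hM i) (hMb i) f) l (𝓝 (mulOperator m hm hb f)) := by
  rw [tendsto_iff_edist_tendsto_0]
  have h1 : ∀ i, edist (mulOperator (M i) (hM i) (hMb i) f) (mulOperator m hm hb f) ^ 2
      = ∫⁻ x, ‖(M i x - m x) * f x‖ₑ ^ 2 := fun i => by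
    rw [edist_eq_enorm_sub, enorm_sq_L2]
    refine lintegral_congr_ae ?_
    filter_upwards [coeFn_mulOperator (hm := hM i) (hb := hMb i) f,
      coeFn_mulOperator (hm := hm) (hb := hb) f,
      Lp.coeFn_sub (mulOperator (M i) (hM i) (hMb i) f) (mulOperator m hm hb f)] with x h1 h2 h3
    rw [h3, Pi.sub_apply, h1, h2]
    ring_nf
  have h2 : Tendsto (fun i => ∫⁻ x, ‖(M i x - m x) * f x‖ₑ ^ 2) l (𝓝 0) := by
    have hf := Lp.aestronglyMeasurable f
    have := tendsto_lintegral_filter_of_dominated_convergence' (μ := (volume : Measure ℝ)) (l := l)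
      (F := fun i x => ‖(M i x - m x) * f x‖ₑ ^ 2) (f := fun _ => 0)
      (fun x => 4 * ‖f x‖ₑ ^ 2)
      (.of_forall fun i => ((((hM i).1.sub hm.1).mul hf).enorm.pow_const 2))
      (.of_forall fun i => .of_forall fun x => ?_) ?_ ?_
    · simpa using this
    · have : ‖M i x - m x‖ₑ ≤ 2 := by
        refine (enorm_sub_le (a := M i x) (b := m x)).trans ?_
        rw [← one_add_one_eq_two]
        gcongr
        · exact enorm_le_one_of_norm_le_one (hMb i x)
        · exact enorm_le_one_of_norm_le_one (hb x)
      rw [enorm_mul, mul_pow]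
      gcongr
      calc ‖M i x - m x‖ₑ ^ 2 ≤ 2 ^ 2 := by gcongr
        _ = 4 := by norm_num
    · rw [lintegral_const_mul'' _ (hf.enorm.pow_const 2), ← enorm_sq_L2]
      exact ENNReal.mul_ne_top (by norm_num) (by simp)
    · refine .of_forall fun x => ?_
      have h := ENNReal.Tendsto.pow (n := 2) (((hlim x).sub_const (m x)).mul_const (f x)).enorm
      simpa using h
  simp only [← h1] at h2
  exact tendsto_zero_of_sq h2

end mulOperator

/-- The Fourier multiplier with a symbol bounded by `1`, as a continuous linear operator. -/
def multiplierOperator (m : ℝ → ℂ) (hm : MemLp m ∞ volume) (hb : ∀ x, ‖m x‖ ≤ 1) : L2 →L[ℂ] L2 :=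
  ((Lp.fourierTransformₗᵢ ℝ ℂ).symm.toContinuousLinearEquiv.toContinuousLinearMap).comp
    ((mulOperator m hm hb).comp
      (Lp.fourierTransformₗᵢ ℝ ℂ).toContinuousLinearEquiv.toContinuousLinearMap)

section multiplierOperator

variable {m m' : ℝ → ℂ} {hm : MemLp m ∞ volume} {hb : ∀ x, ‖m x‖ ≤ 1}
  {hm' : MemLp m' ∞ volume} {hb' : ∀ x, ‖m' x‖ ≤ 1}

lemma multiplierOperator_apply (f : L2) :
    multiplierOperator m hm hb f = 𝓕⁻ (mulOperator m hm hb (𝓕 f)) := rfl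

lemma fourier_multiplierOperator (f : L2) :
    𝓕 (multiplierOperator m hm hb f) = mulOperator m hm hb (𝓕 f) := by
  rw [multiplierOperator_apply, FourierTransform.fourier_fourierInv_eq]

lemma norm_fourierInv_L2 (f : L2) : ‖(𝓕⁻ f : L2)‖ = ‖f‖ :=
  (Lp.fourierTransformₗᵢ ℝ ℂ).symm.norm_map f

lemma norm_multiplierOperator_le (f : L2) : ‖multiplierOperator m hm hb f‖ ≤ ‖f‖ := by
  rw [multiplierOperator_apply, norm_fourierInv_L2]
  exact (norm_mulOperator_le _).trans (Lp.norm_fourier_eq f).le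

lemma norm_multiplierOperator_eq (h1 : ∀ x, ‖m x‖ = 1) (f : L2) :
    ‖multiplierOperator m hm hb f‖ = ‖f‖ := by
  rw [multiplierOperator_apply, norm_fourierInv_L2, norm_mulOperator_eq h1, Lp.norm_fourier_eq f]

lemma multiplierOperator_comm (f : L2) :
    multiplierOperator m hm hb (multiplierOperator m' hm' hb' f)
      = multiplierOperator m' hm' hb' (multiplierOperator m hm hb f) := by
  rw [multiplierOperator_apply, fourier_multiplierOperator, mulOperator_comm,
    ← fourier_multiplierOperator (m := m), ← multiplierOperator_apply]

lemma inner_multiplierOperator_left (hreal : ∀ x, starRingEnd ℂ (m x) = m x) (f g : L2) :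
    inner ℂ (multiplierOperator m hm hb f) g = inner ℂ f (multiplierOperator m hm hb g) := by
  rw [← Lp.inner_fourier_eq, ← Lp.inner_fourier_eq f, fourier_multiplierOperator,
    fourier_multiplierOperator, inner_mulOperator_left hreal]

lemma tendsto_multiplierOperator {ι : Type*} {l : Filter ι} [l.IsCountablyGenerated]
    {M : ι → ℝ → ℂ} {hM : ∀ i, MemLp (M i) ∞ volume} {hMb : ∀ i x, ‖M i x‖ ≤ 1}
    (hlim : ∀ x, Tendsto (fun i => M i x) l (𝓝 (m x))) (f : L2) :
    Tendsto (fun i => multiplierOperator (M i) (hM i) (hMb i) f) l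
      (𝓝 (multiplierOperator m hm hb f)) :=
  ((Lp.fourierTransformₗᵢ ℝ ℂ).symm.continuous.tendsto _).comp
    (tendsto_mulOperator (hMb := hMb) (hb := hb) hlim _)

end multiplierOperator

/-! ### The propagator -/

/-- The propagator as a linear isometry. -/
def propagatorIsometry (t : ℝ) : L2 →ₗᵢ[ℂ] L2 where
  toLinearMap := (multiplierOperator (schrodingerSymbol t) (memLp_schrodingerSymbol t)
    fun η => (norm_schrodingerSymbol t η).le).toLinearMap
  norm_map' := norm_multiplierOperator_eq (norm_schrodingerSymbol t)

lemma propagatorIsometry_apply (t : ℝ) (f : L2) : propagatorIsometry t f = propagator t f := rfl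

lemma propagator_eq_multiplierOperator (t : ℝ) (f : L2) :
    propagator t f = multiplierOperator (schrodingerSymbol t) (memLp_schrodingerSymbol t)
      (fun η => (norm_schrodingerSymbol t η).le) f := rfl

lemma norm_propagator (t : ℝ) (f : L2) : ‖propagator t f‖ = ‖f‖ :=
  (propagatorIsometry t).norm_map f

lemma propagator_add (t : ℝ) (f g : L2) :
    propagator t (f + g) = propagator t f + propagator t g := (propagatorIsometry t).map_add f g

lemma propagator_sub (t : ℝ) (f g : L2) :
    propagator t (f - g) = propagator t f - propagator t g := (propagatorIsometry t).map_sub f g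

lemma propagator_smul (t : ℝ) (c : ℂ) (f : L2) :
    propagator t (c • f) = c • propagator t f := (propagatorIsometry t).map_smul c f

lemma propagator_propagator (s t : ℝ) (f : L2) :
    propagator s (propagator t f) = propagator (s + t) f := by
  simp only [propagator_eq_multiplierOperator]
  rw [multiplierOperator_apply, fourier_multiplierOperator, multiplierOperator_apply]
  congr 1
  refine Lp.ext ?_
  filter_upwards [coeFn_mulOperator (m := schrodingerSymbol t) (hm := memLp_schrodingerSymbol t)
      (hb := fun η => (norm_schrodingerSymbol t η).le) (𝓕 f),
    coeFn_mulOperator (m := schrodingerSymbol (s + t)) (hm := memLp_schrodingerSymbol (s + t))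
      (hb := fun η => (norm_schrodingerSymbol (s + t) η).le) (𝓕 f),
    coeFn_mulOperator (m := schrodingerSymbol s) (hm := memLp_schrodingerSymbol s)
      (hb := fun η => (norm_schrodingerSymbol s η).le)
      (mulOperator (schrodingerSymbol t) (memLp_schrodingerSymbol t)
        (fun η => (norm_schrodingerSymbol t η).le) (𝓕 f))] with x h1 h2 h3
  rw [h3, h1, h2, ← mul_assoc]
  congr 1
  rw [schrodingerSymbol, schrodingerSymbol, schrodingerSymbol, ← Complex.exp_add]
  congr 1
  push_cast
  ring

lemma propagator_zero (f : L2) : propagator 0 f = f := by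
  rw [propagator_eq_multiplierOperator, multiplierOperator_apply]
  have : mulOperator (schrodingerSymbol 0) (memLp_schrodingerSymbol 0)
      (fun η => (norm_schrodingerSymbol 0 η).le) (𝓕 f) = 𝓕 f := by
    refine Lp.ext ?_
    filter_upwards [coeFn_mulOperator (m := schrodingerSymbol 0) (hm := memLp_schrodingerSymbol 0)
      (hb := fun η => (norm_schrodingerSymbol 0 η).le) (𝓕 f)] with x h1
    rw [h1]
    simp [schrodingerSymbol]
  rw [this, FourierTransform.fourierInv_fourier_eq]

lemma inner_propagator_left (t : ℝ) (f g : L2) :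
    inner ℂ (propagator t f) g = inner ℂ f (propagator (-t) g) := by
  have h := (propagatorIsometry t).inner_map_map f (propagator (-t) g)
  rw [propagatorIsometry_apply, propagatorIsometry_apply, propagator_propagator, add_neg_cancel,
    propagator_zero] at h
  exact h

lemma continuous_propagator_time (f : L2) : Continuous fun t => propagator t f := by
  rw [continuous_iff_continuousAt]
  intro t
  refine tendsto_multiplierOperator (hMb := fun t η => (norm_schrodingerSymbol t η).le)
    (hb := fun η => (norm_schrodingerSymbol t η).le) (fun x => ?_) f
  have : Continuous fun t : ℝ => schrodingerSymbol t x := by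
    unfold schrodingerSymbol; fun_prop
  exact this.tendsto t

/-- Strong continuity, jointly in the time and in the data: the propagators are isometries. -/
lemma continuous_propagator : Continuous fun p : ℝ × L2 => propagator p.1 p.2 := by
  rw [continuous_iff_continuousAt]
  rintro ⟨t, f⟩
  rw [ContinuousAt, tendsto_iff_norm_sub_tendsto_zero]
  have h1 : Tendsto (fun p : ℝ × L2 => ‖p.2 - f‖ + ‖propagator p.1 f - propagator t f‖)
      (𝓝 (t, f)) (𝓝 0) := by
    have : Continuous fun p : ℝ × L2 => ‖p.2 - f‖ + ‖propagator p.1 f - propagator t f‖ := by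
      have := (continuous_propagator_time f).comp (continuous_fst (X := ℝ) (Y := L2))
      exact (continuous_snd.sub continuous_const).norm.add (this.sub continuous_const).norm
    simpa using this.tendsto (t, f)
  refine squeeze_zero (fun _ => norm_nonneg _) (fun p => ?_) h1
  rw [← norm_propagator p.1 (p.2 - f), propagator_sub]
  refine le_trans (le_of_eq ?_) (norm_add_le _ _)
  congr 1
  abel

lemma continuous_propagator_comp {X : Type*} [TopologicalSpace X] {τ : X → ℝ} {f : X → L2}
    (hτ : Continuous τ) (hf : Continuous f) : Continuous fun x => propagator (τ x) (f x) := by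
  have h : Continuous fun x => (τ x, f x) := hτ.prodMk hf
  exact (Continuous.comp continuous_propagator h).congr fun x => rfl

/-- The propagator commutes with Fourier multipliers. -/
lemma propagator_multiplierOperator {m : ℝ → ℂ} {hm : MemLp m ∞ volume} {hb : ∀ x, ‖m x‖ ≤ 1}
    (t : ℝ) (f : L2) :
    propagator t (multiplierOperator m hm hb f) = multiplierOperator m hm hb (propagator t f) := by
  rw [propagator_eq_multiplierOperator, propagator_eq_multiplierOperator, multiplierOperator_comm]

/-- For integrable frequency profiles the abstract propagator is given by the free wave. -/
lemma coeFn_propagator_fourierInv {a : ℝ → ℂ} (ham : Measurable a) (ha : Integrable a) {g : L2}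
    (hg : ⇑g =ᵐ[volume] a) (t : ℝ) :
    ⇑(propagator t (𝓕⁻ g)) =ᵐ[volume] freeWave a t := by
  rw [propagator_eq_multiplierOperator, multiplierOperator_apply,
    FourierTransform.fourier_fourierInv_eq]
  set G := mulOperator (schrodingerSymbol t) (memLp_schrodingerSymbol t)
      (fun η => (norm_schrodingerSymbol t η).le) g
  have hG : ⇑G =ᵐ[volume] fun ξ => schrodingerSymbol t ξ * a ξ := by
    filter_upwards [coeFn_mulOperator (m := schrodingerSymbol t) (hm := memLp_schrodingerSymbol t)
      (hb := fun η => (norm_schrodingerSymbol t η).le) g, hg] with x h1 h2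
    rw [h1, h2]
  have hGi : Integrable G := (integrable_symbol_mul_profile ham ha t).congr hG.symm
  refine (coeFn_fourierInv G hGi).trans (.of_forall fun x => ?_)
  rw [freeWave, Real.fourierInv_eq, Real.fourierInv_eq]
  exact integral_congr_ae (hG.mono fun v hv => by simp only [hv])

/-! ### Sharp frequency truncation -/

/-- The symbol of the sharp projection onto the frequencies `|η| ≤ K`. -/
def sharpSymbol (K : ℝ) : ℝ → ℂ := (Set.Icc (-K) K).indicator 1

lemma norm_sharpSymbol_le (K η : ℝ) : ‖sharpSymbol K η‖ ≤ 1 := by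
  unfold sharpSymbol
  by_cases h : η ∈ Set.Icc (-K) K <;> simp [h]

lemma measurable_sharpSymbol (K : ℝ) : Measurable (sharpSymbol K) :=
  measurable_one.indicator measurableSet_Icc

lemma memLp_sharpSymbol (K : ℝ) : MemLp (sharpSymbol K) ∞ volume :=
  memLp_top_of_bound (measurable_sharpSymbol K).aestronglyMeasurable 1
    (.of_forall (norm_sharpSymbol_le K))

/-- The sharp projection onto the frequencies `|η| ≤ K`. -/
def sharpLow (K : ℝ) : L2 →L[ℂ] L2 :=
  multiplierOperator (sharpSymbol K) (memLp_sharpSymbol K) (norm_sharpSymbol_le K)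

lemma tendsto_sharpLow (f : L2) : Tendsto (fun J : ℕ => sharpLow J f) atTop (𝓝 f) := by
  -- The limiting symbol is `1`, written as `schrodingerSymbol 0`.
  have h := tendsto_multiplierOperator (l := atTop) (M := fun J : ℕ => sharpSymbol J)
    (hM := fun J => memLp_sharpSymbol J) (hMb := fun J => norm_sharpSymbol_le J)
    (m := schrodingerSymbol 0) (hm := memLp_schrodingerSymbol 0)
    (hb := fun η => (norm_schrodingerSymbol 0 η).le) (fun x => ?_) f
  · rw [← propagator_eq_multiplierOperator, propagator_zero] at h
    exact h
  · refine tendsto_const_nhds.congr' ?_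
    filter_upwards [tendsto_natCast_atTop_atTop.eventually_ge_atTop |x|] with J hJ
    have hx : x ∈ Set.Icc (-(J : ℝ)) J := abs_le.1 hJ
    rw [sharpSymbol, Set.indicator_of_mem hx]
    simp [schrodingerSymbol]

lemma memLp_two_sharpSymbol (K : ℝ) : MemLp (sharpSymbol K) 2 volume := by
  unfold sharpSymbol
  exact memLp_indicator_const 2 measurableSet_Icc (1 : ℂ) (Or.inr (by simp))

lemma integrable_sharpSymbol_mul (K : ℝ) (f : L2) :
    Integrable fun ξ => sharpSymbol K ξ * f ξ :=
  (memLp_two_sharpSymbol K).integrable_mul (Lp.memLp f)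

/-! ### Dual norms on `L²` -/

/-- An extended seminorm on `L²` that is a supremum of absolute values of continuous functionals.
Such a seminorm is lower semicontinuous and obeys Minkowski's inequality for vector valued
integrals. -/
def IsDualNorm (N : L2 → ℝ≥0∞) : Prop :=
  ∃ S : Set L2, ∀ f, N f = ⨆ φ ∈ S, ‖(inner ℂ φ f : ℂ)‖ₑ

namespace IsDualNorm

variable {N : L2 → ℝ≥0∞}

lemma lowerSemicontinuous (hN : IsDualNorm N) : LowerSemicontinuous N := by
  obtain ⟨S, hS⟩ := hN
  have : N = fun f => ⨆ φ ∈ S, ‖(inner ℂ φ f : ℂ)‖ₑ := funext hS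
  rw [this]
  refine lowerSemicontinuous_biSup fun φ _ => Continuous.lowerSemicontinuous ?_
  exact (continuous_const.inner continuous_id).enorm

lemma measurable_comp (hN : IsDualNorm N) {X : Type*} [TopologicalSpace X] [MeasurableSpace X]
    [BorelSpace X] {F : X → L2} (hF : Continuous F) : Measurable fun x => N (F x) :=
  (hN.lowerSemicontinuous.comp hF).measurable

lemma le_liminf (hN : IsDualNorm N) {F : ℕ → L2} {f : L2} (h : Tendsto F atTop (𝓝 f)) :
    N f ≤ liminf (fun j => N (F j)) atTop :=
  (lowerSemicontinuous_iff_le_liminf.1 hN.lowerSemicontinuous f).trans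
    (liminf_le_liminf_of_le h)

lemma add_le (hN : IsDualNorm N) (f g : L2) : N (f + g) ≤ N f + N g := by
  obtain ⟨S, hS⟩ := hN
  rw [hS (f + g), hS f, hS g]
  refine iSup₂_le fun φ hφ => ?_
  rw [inner_add_right]
  refine (enorm_add_le _ _).trans ?_
  gcongr
  · exact le_iSup₂ (f := fun φ _ => ‖(inner ℂ φ f : ℂ)‖ₑ) φ hφ
  · exact le_iSup₂ (f := fun φ _ => ‖(inner ℂ φ g : ℂ)‖ₑ) φ hφ

lemma zero (hN : IsDualNorm N) : N 0 = 0 := by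
  obtain ⟨S, hS⟩ := hN
  simp [hS]

/-- Minkowski's inequality for integrals. -/
lemma integral_le (hN : IsDualNorm N) {g : ℝ → L2} (hg : Continuous g) {a b : ℝ} (hab : a ≤ b) :
    N (∫ s in a..b, g s) ≤ ∫⁻ s in Set.Ioc a b, N (g s) := by
  obtain ⟨S, hS⟩ := hN
  rw [hS (∫ s in a..b, g s)]
  refine iSup₂_le fun φ hφ => ?_
  rw [intervalIntegral.integral_of_le hab, ← integral_inner]
  · refine (enorm_integral_le_lintegral_enorm _).trans (lintegral_mono fun s => ?_)
    rw [hS (g s)]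
    exact le_iSup₂ (f := fun φ _ => ‖(inner ℂ φ (g s) : ℂ)‖ₑ) φ hφ
  · exact (hg.intervalIntegrable a b).1

end IsDualNorm

lemma isDualNorm_enorm_comp (B : L2 →L[ℂ] L2) : IsDualNorm fun f => ‖B f‖ₑ := by
  refine ⟨(fun φ => ContinuousLinearMap.adjoint B φ) '' Metric.closedBall 0 1, fun f => ?_⟩
  rw [iSup_image]
  simp only [ContinuousLinearMap.adjoint_inner_left]
  refine le_antisymm ?_ (iSup₂_le fun φ hφ => ?_)
  · by_cases h0 : B f = 0
    · simp [h0]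
    have hn : ‖B f‖ ≠ 0 := norm_ne_zero_iff.2 h0
    let φ : L2 := ((‖B f‖⁻¹ : ℝ) : ℂ) • B f
    have hφ : φ ∈ Metric.closedBall (0 : L2) 1 := by
      rw [mem_closedBall_zero_iff, norm_smul, Complex.norm_real, norm_inv, norm_norm,
        inv_mul_cancel₀ hn]
    refine le_trans (le_of_eq ?_) (le_iSup₂ (f := fun φ _ => ‖(inner ℂ φ (B f) : ℂ)‖ₑ) φ hφ)
    simp only [φ]
    rw [inner_smul_left, inner_self_eq_norm_sq_to_K, Complex.conj_ofReal, ← ofReal_norm,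
      ← ofReal_norm, norm_mul, Complex.norm_real, norm_pow]
    congr 1
    simp
    field_simp
  · have h1 : ‖φ‖ ≤ 1 := mem_closedBall_zero_iff.1 hφ
    rw [← ofReal_norm, ← ofReal_norm]
    refine ENNReal.ofReal_le_ofReal ((norm_inner_le_norm _ _).trans ?_)
    exact mul_le_of_le_one_left (norm_nonneg _) h1

/-- The `L⁶` norm is a dual norm on `L²`: test a function `f` against multiples of the truncations
of `|f|⁴ f` to the sets where `|f|` is bounded. -/
lemma isDualNorm_eLpNorm_six : IsDualNorm fun f => eLpNorm f 6 volume := by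
  have hnorm : ∀ f : L2, eLpNorm f 6 volume = (∫⁻ x, ‖f x‖ₑ ^ (6 : ℝ)) ^ (1 / 6 : ℝ) := fun f => by
    rw [eLpNorm_eq_lintegral_rpow_enorm_toReal (by norm_num) (by norm_num)]
    simp
  refine ⟨{φ : L2 | ∫⁻ x, ‖φ x‖ₑ ^ (6 / 5 : ℝ) ≤ 1}, fun f => ?_⟩
  have hfm : Measurable f := (Lp.stronglyMeasurable f).measurable
  refine le_antisymm ?_ (iSup₂_le fun φ hφ => ?_)
  · set B := ⨆ φ ∈ {φ : L2 | ∫⁻ x, ‖φ x‖ₑ ^ (6 / 5 : ℝ) ≤ 1}, ‖(inner ℂ φ f : ℂ)‖ₑ with hB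
    -- Truncation to `A K` makes `|f|⁴ f` square integrable, and the integral `J` of `|f|⁶` finite.
    let A : ℕ → Set ℝ := fun K => {x | ‖f x‖ ≤ K}
    have hA : ∀ K, MeasurableSet (A K) := fun K => measurableSet_le hfm.norm measurable_const
    have hJ : ∀ K, ∫⁻ x in A K, ‖f x‖ₑ ^ (6 : ℝ) ≤ B ^ (6 : ℝ) := fun K => by
      set J := ∫⁻ x in A K, ‖f x‖ₑ ^ (6 : ℝ) with hJdef
      let ψ : ℝ → ℂ := (A K).indicator fun x => ((‖f x‖ ^ 4 : ℝ) : ℂ) * f x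
      have hψm : Measurable ψ :=
        (Measurable.mul (Complex.measurable_ofReal.comp (hfm.norm.pow_const 4)) hfm).indicator (hA K)
      have hψn : ∀ x, ‖ψ x‖ ≤ (K : ℝ) ^ 4 * ‖f x‖ := fun x => by
        by_cases hx : x ∈ A K
        · have hx' : ‖f x‖ ≤ K := hx
          simp only [ψ, Set.indicator_of_mem hx, norm_mul, Complex.norm_real, norm_pow, norm_norm]
          gcongr
        · simp only [ψ, Set.indicator_of_notMem hx, norm_zero]
          positivity
      have hψ : MemLp ψ 2 volume :=
        (Lp.memLp f).of_le_mul hψm.aestronglyMeasurable (.of_forall hψn)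
      have hJtop : J ≠ ⊤ := by
        have h1 : J ≤ ∫⁻ x, ENNReal.ofReal (K ^ 4) * ‖f x‖ₑ ^ 2 := by
          rw [hJdef, ← lintegral_indicator (hA K)]
          refine lintegral_mono fun x => ?_
          by_cases hx : x ∈ A K
          · have hx' : ‖f x‖ ≤ K := hx
            rw [Set.indicator_of_mem hx, ← ofReal_norm, ENNReal.rpow_ofNat,
              ← ENNReal.ofReal_pow (norm_nonneg _), ← ENNReal.ofReal_pow (norm_nonneg _),
              ← ENNReal.ofReal_mul (by positivity)]
            refine ENNReal.ofReal_le_ofReal ?_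
            calc ‖f x‖ ^ 6 = ‖f x‖ ^ 4 * ‖f x‖ ^ 2 := by ring
              _ ≤ _ := by gcongr
          · rw [Set.indicator_of_notMem hx]; exact zero_le
        rw [lintegral_const_mul _ (by fun_prop), ← enorm_sq_L2] at h1
        exact ne_top_of_le_ne_top (ENNReal.mul_ne_top (by simp) (by simp)) h1
      by_cases hJ0 : J = 0
      · rw [hJ0]; exact zero_le
      obtain ⟨j, hj, hJj⟩ : ∃ j : ℝ, 0 < j ∧ J = ENNReal.ofReal j :=
        ⟨J.toReal, ENNReal.toReal_pos hJ0 hJtop, (ENNReal.ofReal_toReal hJtop).symm⟩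
      -- Normalized in `L^{6/5}`, the conjugate exponent of `6`.
      let φ : L2 := ((j ^ (-(5 / 6) : ℝ) : ℝ) : ℂ) • hψ.toLp ψ
      have hφae : ∀ᵐ x, φ x = ((j ^ (-(5 / 6) : ℝ) : ℝ) : ℂ) * ψ x := by
        filter_upwards [Lp.coeFn_smul ((j ^ (-(5 / 6) : ℝ) : ℝ) : ℂ) (hψ.toLp ψ),
          hψ.coeFn_toLp] with x h1 h2
        rw [h1, Pi.smul_apply, h2, smul_eq_mul]
      have hψpow : ∀ x, ‖ψ x‖ₑ ^ (6 / 5 : ℝ) = (A K).indicator (fun x => ‖f x‖ₑ ^ (6 : ℝ)) x :=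
        fun x => by
          by_cases hx : x ∈ A K
          · simp only [ψ, Set.indicator_of_mem hx, enorm_mul]
            have : ‖((‖f x‖ ^ 4 : ℝ) : ℂ)‖ₑ = ‖f x‖ₑ ^ 4 := by
              rw [← ofReal_norm, Complex.norm_real, norm_pow, norm_norm,
                ENNReal.ofReal_pow (norm_nonneg _), ofReal_norm]
            rw [this, ← pow_succ, ← ENNReal.rpow_natCast, ← ENNReal.rpow_mul]
            norm_num
          · simp only [ψ, Set.indicator_of_notMem hx]
            simp
      have hφS : φ ∈ {φ : L2 | ∫⁻ x, ‖φ x‖ₑ ^ (6 / 5 : ℝ) ≤ 1} := by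
        have h1 : ∫⁻ x, ‖φ x‖ₑ ^ (6 / 5 : ℝ) = ∫⁻ x, ENNReal.ofReal j⁻¹ *
            (A K).indicator (fun x => ‖f x‖ₑ ^ (6 : ℝ)) x := by
          refine lintegral_congr_ae ?_
          filter_upwards [hφae] with x hx
          rw [hx, enorm_mul, ENNReal.mul_rpow_of_nonneg _ _ (by norm_num), hψpow]
          congr 1
          rw [← ofReal_norm, Complex.norm_real, Real.norm_of_nonneg (by positivity),
            ENNReal.ofReal_rpow_of_nonneg (by positivity) (by norm_num), ← Real.rpow_mul hj.le]
          norm_num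
          rw [Real.rpow_neg_one]
        rw [Set.mem_ofPred_eq, h1, lintegral_const_mul' _ _ (by simp), lintegral_indicator (hA K),
          ← hJdef, hJj, ← ENNReal.ofReal_mul (by positivity), inv_mul_cancel₀ hj.ne']
        simp
      have hinner : (inner ℂ φ f : ℂ) = ((j ^ (1 / 6 : ℝ) : ℝ) : ℂ) := by
        have h1 : (inner ℂ φ f : ℂ) = ∫ x, ((j ^ (-(5 / 6) : ℝ) *
            (A K).indicator (fun x => ‖f x‖ ^ 6) x : ℝ) : ℂ) := by
          rw [L2.inner_def]
          refine integral_congr_ae ?_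
          filter_upwards [hφae] with x hx
          simp only [hx, RCLike.inner_apply, map_mul, Complex.conj_ofReal]
          by_cases hxA : x ∈ A K
          · simp only [ψ, Set.indicator_of_mem hxA, map_mul, Complex.conj_ofReal]
            have := Complex.conj_mul' (f x)
            push_cast
            calc _ = (((j ^ (-(5 / 6) : ℝ) : ℝ) : ℂ)) * (‖f x‖ : ℂ) ^ 4 *
                  (starRingEnd ℂ (f x) * f x) := by ring
              _ = _ := by rw [this]; ring
          · simp only [ψ, Set.indicator_of_notMem hxA]
            simp
        rw [h1, integral_complex_ofReal, integral_const_mul, integral_indicator (hA K)]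
        congr 1
        have h2 : ∫ x in A K, ‖f x‖ ^ 6 = j := by
          rw [integral_eq_lintegral_of_nonneg_ae (.of_forall fun x => by positivity)
            (hfm.norm.pow_const 6).aestronglyMeasurable]
          have : ∫⁻ x in A K, ENNReal.ofReal (‖f x‖ ^ 6) = J := by
            rw [hJdef]
            congr with x
            rw [ENNReal.ofReal_pow (norm_nonneg _), ofReal_norm, ENNReal.rpow_ofNat]
          rw [this, hJj, ENNReal.toReal_ofReal hj.le]
        rw [h2]
        nth_rw 2 [← Real.rpow_one j]
        rw [← Real.rpow_add hj]
        norm_num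
      have h1 : ENNReal.ofReal (j ^ (1 / 6 : ℝ)) ≤ B := by
        have := le_iSup₂ (f := fun φ (_ : φ ∈ {φ : L2 | ∫⁻ x, ‖φ x‖ₑ ^ (6 / 5 : ℝ) ≤ 1}) =>
          ‖(inner ℂ φ f : ℂ)‖ₑ) φ hφS
        refine le_trans (le_of_eq ?_) this
        simp only [hinner]
        rw [← ofReal_norm, Complex.norm_real, Real.norm_of_nonneg (by positivity)]
      calc J = ENNReal.ofReal (j ^ (1 / 6 : ℝ)) ^ (6 : ℝ) := by
            rw [ENNReal.ofReal_rpow_of_nonneg (by positivity) (by norm_num), ← Real.rpow_mul hj.le,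
              hJj]
            norm_num
        _ ≤ B ^ (6 : ℝ) := by gcongr
    have hlim : Tendsto (fun K => ∫⁻ x in A K, ‖f x‖ₑ ^ (6 : ℝ)) atTop
        (𝓝 (∫⁻ x, ‖f x‖ₑ ^ (6 : ℝ))) := by
      simp only [← lintegral_indicator (hA _)]
      refine lintegral_tendsto_of_tendsto_of_monotone
        (fun K => ((hfm.enorm.pow_const _).indicator (hA K)).aemeasurable) ?_ ?_
      · refine .of_forall fun x K K' hK => ?_
        refine Set.indicator_le_indicator_of_subset (fun y hy => ?_) (fun _ => zero_le) x
        have hy' : ‖f y‖ ≤ K := hy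
        exact hy'.trans (by exact_mod_cast hK)
      · refine .of_forall fun x => tendsto_const_nhds.congr' ?_
        filter_upwards [tendsto_natCast_atTop_atTop.eventually_ge_atTop ‖f x‖] with K hK
        have hx : x ∈ A K := hK
        rw [Set.indicator_of_mem hx]
    have h6 := le_of_tendsto' hlim hJ
    change eLpNorm f 6 volume ≤ B
    rw [hnorm]
    calc _ ≤ (B ^ (6 : ℝ)) ^ (1 / 6 : ℝ) := by gcongr
      _ = B := by rw [← ENNReal.rpow_mul]; norm_num
  · have hφm : Measurable φ := (Lp.stronglyMeasurable φ).measurable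
    rw [L2.inner_def]
    refine (enorm_integral_le_lintegral_enorm _).trans ?_
    have hol := ENNReal.lintegral_mul_le_Lp_mul_Lq volume
      (p := 6 / 5) (q := 6) (by rw [Real.holderConjugate_iff]; norm_num)
      (f := fun x => ‖φ x‖ₑ) (g := fun x => ‖f x‖ₑ) hφm.enorm.aemeasurable hfm.enorm.aemeasurable
    calc _ = ∫⁻ x, ((fun x => ‖φ x‖ₑ) * fun x => ‖f x‖ₑ) x := by
          congr with x
          simp only [RCLike.inner_apply, enorm_mul, Pi.mul_apply]
          rw [mul_comm]
          congr 1
          exact RCLike.enorm_conj _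
      _ ≤ _ := hol
      _ ≤ 1 ^ (1 / (6 / 5) : ℝ) * (∫⁻ x, ‖f x‖ₑ ^ (6 : ℝ)) ^ (1 / 6 : ℝ) := by
          gcongr
          exact hφ
      _ = _ := by rw [ENNReal.one_rpow, one_mul]; exact (hnorm f).symm

lemma eLpNorm_six_pow_six {f : ℝ → ℂ} : eLpNorm f 6 volume ^ 6 = ∫⁻ x, ‖f x‖ₑ ^ 6 := by
  rw [eLpNorm_eq_lintegral_rpow_enorm_toReal (by norm_num) (by norm_num), ← ENNReal.rpow_natCast,
    ← ENNReal.rpow_mul]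
  norm_num

/-! ### Space-time estimates for the propagator -/

lemma continuous_sharpLow_propagator (J : ℝ) (f : L2) :
    Continuous fun t => propagator t (sharpLow J f) := continuous_propagator_time _

/-- Space-time bounds on free solutions need only be proved for frequency-localized data. -/
lemma lintegral_propagator_le_of_sharpLow {N : L2 → ℝ≥0∞} (hN : IsDualNorm N) {q : ℕ} {C : ℝ≥0∞}
    {f : L2} (h : ∀ J : ℕ, ∫⁻ t, N (propagator t (sharpLow J f)) ^ q ≤ C) :
    ∫⁻ t, N (propagator t f) ^ q ≤ C := by
  have h1 : ∀ t, N (propagator t f) ^ q ≤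
      liminf (fun J : ℕ => N (propagator t (sharpLow J f)) ^ q) atTop := fun t => by
    have hl : Tendsto (fun J : ℕ => propagator t (sharpLow J f)) atTop (𝓝 (propagator t f)) :=
      ((propagatorIsometry t).continuous.tendsto f).comp (tendsto_sharpLow f)
    have hmono : Monotone fun x : ℝ≥0∞ => x ^ q := fun x y hxy => pow_le_pow_left' hxy q
    have h2 := hmono.map_liminf_of_continuousAt (F := atTop)
      (fun J : ℕ => N (propagator t (sharpLow J f))) (ENNReal.continuous_pow q).continuousAt
      (by isBoundedDefault) (by isBoundedDefault)
    refine (hmono (hN.le_liminf hl)).trans ?_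
    exact h2.le
  calc _ ≤ ∫⁻ t, liminf (fun J : ℕ => N (propagator t (sharpLow J f)) ^ q) atTop :=
        lintegral_mono h1
    _ ≤ liminf (fun J : ℕ => ∫⁻ t, N (propagator t (sharpLow J f)) ^ q) atTop :=
        lintegral_liminf_le fun J =>
          (hN.measurable_comp (continuous_sharpLow_propagator J f)).pow_const q
    _ ≤ liminf (fun _ : ℕ => C) atTop := liminf_le_liminf (.of_forall h)
    _ = C := liminf_const C

lemma enorm_sharpLow_profile_le (J : ℝ) (f : L2) :
    ∫⁻ ξ, ‖sharpSymbol J ξ * (𝓕 f : L2) ξ‖ₑ ^ 2 ≤ ‖f‖ₑ ^ 2 := by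
  have h1 : ‖(𝓕 f : L2)‖ₑ = ‖f‖ₑ := by
    rw [← ofReal_norm, Lp.norm_fourier_eq, ofReal_norm]
  rw [← h1, enorm_sq_L2]
  refine lintegral_mono fun ξ => ?_
  rw [enorm_mul]
  gcongr
  exact mul_le_of_le_one_left zero_le (enorm_le_one_of_norm_le_one (norm_sharpSymbol_le J ξ))

/-- The `L⁶` Strichartz estimate on the line. -/
lemma strichartz (f : L2) :
    ∫⁻ t, eLpNorm (propagator t f) 6 volume ^ 6 ≤ 11 * ‖f‖ₑ ^ 6 := by
  refine lintegral_propagator_le_of_sharpLow isDualNorm_eLpNorm_six fun J => ?_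
  let a : ℝ → ℂ := fun ξ => sharpSymbol J ξ * (𝓕 f : L2) ξ
  have ham : Measurable a :=
    (measurable_sharpSymbol J).mul (Lp.stronglyMeasurable (𝓕 f : L2)).measurable
  have hai : Integrable a := integrable_sharpSymbol_mul J _
  have h1 : ∀ t, eLpNorm (propagator t (sharpLow J f)) 6 volume ^ 6
      = ∫⁻ x, ‖freeWave a t x‖ₑ ^ 6 := fun t => by
    rw [eLpNorm_six_pow_six]
    refine lintegral_congr_ae ?_
    filter_upwards [coeFn_propagator_fourierInv ham hai
      (coeFn_mulOperator (hm := memLp_sharpSymbol J) (hb := norm_sharpSymbol_le J) (𝓕 f)) t]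
      with x hx
    rw [← hx]
    rfl
  simp only [h1]
  refine (lintegral_freeWave_pow_six_le ham hai).trans ?_
  calc _ ≤ 11 * (‖f‖ₑ ^ 2) ^ 3 := by gcongr; exact enorm_sharpLow_profile_le J f
    _ = _ := by ring

/-- The integrable weight `(1 + x²)⁻¹`. It localizes in space and, later on, also in time. -/
def weight (x : ℝ) : ℝ := (1 + x ^ 2)⁻¹

lemma weight_pos (x : ℝ) : 0 < weight x := by unfold weight; positivity

lemma weight_le_one (x : ℝ) : weight x ≤ 1 := by
  unfold weight; exact inv_le_one_of_one_le₀ (by nlinarith)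

lemma continuous_weight : Continuous weight := by
  unfold weight
  exact Continuous.inv₀ (by fun_prop) fun x => by positivity

lemma norm_weight_le (x : ℝ) : ‖(weight x : ℂ)‖ ≤ 1 := by
  rw [Complex.norm_real, Real.norm_of_nonneg (weight_pos x).le]
  exact weight_le_one x

lemma memLp_weight : MemLp (fun x => (weight x : ℂ)) ∞ volume :=
  memLp_top_of_bound (Complex.continuous_ofReal.comp continuous_weight).aestronglyMeasurable 1
    (.of_forall norm_weight_le)

lemma enorm_weight (x : ℝ) : ‖(weight x : ℂ)‖ₑ = ENNReal.ofReal (weight x) := by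
  rw [← ofReal_norm, Complex.norm_real, Real.norm_of_nonneg (weight_pos x).le]

lemma measurable_enorm_weight : Measurable fun x : ℝ => ‖(weight x : ℂ)‖ₑ :=
  (Complex.continuous_ofReal.comp continuous_weight).measurable.enorm

lemma lintegral_weight_le : ∫⁻ x, ‖(weight x : ℂ)‖ₑ ≤ 4 := by
  simp only [enorm_weight]
  simp only [weight]
  rw [← ofReal_integral_eq_lintegral_ofReal integrable_inv_one_add_sq
    (.of_forall fun x => by simp only [Pi.zero_apply]; positivity), integral_univ_inv_one_add_sq,
    ENNReal.ofReal_le_iff_le_toReal (by norm_num)]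
  simpa using Real.pi_lt_four.le

lemma lintegral_weight_sq_le : ∫⁻ x, ‖(weight x : ℂ)‖ₑ ^ 2 ≤ 4 := by
  refine (lintegral_mono fun x => ?_).trans lintegral_weight_le
  rw [sq]
  exact mul_le_of_le_one_left zero_le (enorm_le_one_of_norm_le_one (norm_weight_le x))

/-- Multiplication by the weight `(1 + x²)⁻¹` on `L²`. -/
def weightOperator : L2 →L[ℂ] L2 := mulOperator _ memLp_weight norm_weight_le

/-- The weighted high-frequency part `(1 + x²)⁻¹ P_{>K} f`. -/
def weightedHigh (K : ℝ) : L2 →L[ℂ] L2 :=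
  weightOperator.comp (ContinuousLinearMap.id ℂ L2 - sharpLow K)

lemma weightedHigh_apply (K : ℝ) (f : L2) :
    weightedHigh K f = weightOperator (f - sharpLow K f) := rfl

/-- Local smoothing for the propagator: the weighted high-frequency part of a free solution is
small in `L²` of space-time. -/
lemma lintegral_weightedHigh_propagator_le {K : ℝ} (hK : 0 < K) (f : L2) :
    ∫⁻ t, ‖weightedHigh K (propagator t f)‖ₑ ^ 2 ≤ 4 * ENNReal.ofReal (1 / K) * ‖f‖ₑ ^ 2 := by
  refine lintegral_propagator_le_of_sharpLow (isDualNorm_enorm_comp (weightedHigh K)) fun J => ?_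
  let a : ℝ → ℂ := fun ξ => (1 - sharpSymbol K ξ) * (sharpSymbol J ξ * (𝓕 f : L2) ξ)
  have ham : Measurable a := (measurable_const.sub (measurable_sharpSymbol K)).mul
    ((measurable_sharpSymbol J).mul (Lp.stronglyMeasurable (𝓕 f : L2)).measurable)
  have h01 : ∀ ξ, ‖1 - sharpSymbol K ξ‖ ≤ 1 := fun ξ => by
    unfold sharpSymbol
    by_cases h : ξ ∈ Set.Icc (-K) K <;> simp [h]
  have hai : Integrable a :=
    (integrable_sharpSymbol_mul J (𝓕 f : L2)).bdd_mul (c := 1)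
      (measurable_const.sub (measurable_sharpSymbol K)).aestronglyMeasurable (.of_forall h01)
  have hsupp : ∀ ξ, |ξ| ≤ K → a ξ = 0 := fun ξ h => by
    have hξ : ξ ∈ Set.Icc (-K) K := abs_le.1 h
    simp [a, sharpSymbol, hξ]
  set F := sharpLow J f with hF
  have hFf : 𝓕 F = mulOperator (sharpSymbol J) (memLp_sharpSymbol J) (norm_sharpSymbol_le J) (𝓕 f) :=
    fourier_multiplierOperator f
  let g : L2 := 𝓕 (F - sharpLow K F)
  have hga : ⇑g =ᵐ[volume] a := by
    have e1 : g = 𝓕 F - mulOperator (sharpSymbol K) (memLp_sharpSymbol K)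
        (norm_sharpSymbol_le K) (𝓕 F) := by
      have := fourier_multiplierOperator (hm := memLp_sharpSymbol K)
        (hb := norm_sharpSymbol_le K) F
      rw [← this]
      exact (Lp.fourierTransformₗᵢ ℝ ℂ).map_sub F (sharpLow K F)
    rw [e1]
    filter_upwards [Lp.coeFn_sub (𝓕 F) (mulOperator (sharpSymbol K) (memLp_sharpSymbol K)
        (norm_sharpSymbol_le K) (𝓕 F)), coeFn_mulOperator (hm := memLp_sharpSymbol K)
        (hb := norm_sharpSymbol_le K) (𝓕 F), coeFn_mulOperator (hm := memLp_sharpSymbol J)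
        (hb := norm_sharpSymbol_le J) (𝓕 f)] with x h1 h2 h3
    rw [h1, Pi.sub_apply, h2, hFf, h3]
    simp only [a]
    ring
  have h1 : ∀ t, ‖weightedHigh K (propagator t F)‖ₑ ^ 2
      = ∫⁻ x, ‖(weight x : ℂ)‖ₑ ^ 2 * ‖freeWave a t x‖ₑ ^ 2 := fun t => by
    have e1 : propagator t F - sharpLow K (propagator t F) = propagator t (𝓕⁻ g) := by
      rw [FourierTransform.fourierInv_fourier_eq, propagator_sub]
      congr 1
      exact (propagator_multiplierOperator t F).symm
    rw [weightedHigh_apply, e1, enorm_sq_L2]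
    refine lintegral_congr_ae ?_
    filter_upwards [coeFn_mulOperator (hm := memLp_weight) (hb := norm_weight_le)
      (propagator t (𝓕⁻ g)), coeFn_propagator_fourierInv ham hai hga t] with x hx1 hx2
    change ‖mulOperator _ memLp_weight norm_weight_le (propagator t (𝓕⁻ g)) x‖ₑ ^ 2 = _
    rw [hx1, hx2, enorm_mul, mul_pow]
  have hwm : Measurable fun x : ℝ => ‖(weight x : ℂ)‖ₑ ^ 2 := measurable_enorm_weight.pow_const 2
  have hjm : Measurable fun p : ℝ × ℝ => ‖(weight p.2 : ℂ)‖ₑ ^ 2 * ‖freeWave a p.1 p.2‖ₑ ^ 2 :=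
    (hwm.comp measurable_snd).mul ((measurable_freeWave ham).enorm.pow_const 2)
  have ha2 : ∫⁻ ξ, ‖a ξ‖ₑ ^ 2 ≤ ‖f‖ₑ ^ 2 := by
    refine le_trans (lintegral_mono fun ξ => ?_) (enorm_sharpLow_profile_le J f)
    simp only [a]
    rw [enorm_mul (1 - sharpSymbol K ξ)]
    gcongr
    exact mul_le_of_le_one_left zero_le (enorm_le_one_of_norm_le_one (h01 ξ))
  simp only [h1]
  rw [lintegral_lintegral_swap hjm.aemeasurable]
  calc _ ≤ ∫⁻ x, ‖(weight x : ℂ)‖ₑ ^ 2 * (ENNReal.ofReal (1 / K) * ‖f‖ₑ ^ 2) := by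
        refine lintegral_mono fun x => ?_
        change ∫⁻ t, ‖(weight x : ℂ)‖ₑ ^ 2 * ‖freeWave a t x‖ₑ ^ 2 ≤ _
        have hm : Measurable fun t => freeWave a t x :=
          Measurable.of_uncurry_right (f := freeWave a) (measurable_freeWave ham)
        rw [lintegral_const_mul _ (hm.enorm.pow_const 2)]
        gcongr
        exact (lintegral_time_freeWave_sq_le ham hai hK hsupp x).trans (by gcongr)
    _ = (∫⁻ x, ‖(weight x : ℂ)‖ₑ ^ 2) * (ENNReal.ofReal (1 / K) * ‖f‖ₑ ^ 2) :=
        lintegral_mul_const _ hwm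
    _ ≤ 4 * (ENNReal.ofReal (1 / K) * ‖f‖ₑ ^ 2) := by
        gcongr
        exact lintegral_weight_sq_le
    _ = _ := by ring

/-! ### Estimates for inhomogeneous solutions -/

/-- Jensen's inequality with a weight, which is convexity of the power for the measure with
density `w`. -/
lemma lintegral_pow_le_weighted {μ : Measure ℝ} {F w : ℝ → ℝ≥0∞} (hF : Measurable F)
    (hw : Measurable w) (hwt : ∀ s, w s ≠ ⊤) (h0 : ∀ s, w s = 0 → F s = 0) {q : ℕ} (hq : 1 ≤ q) :
    (∫⁻ s, F s ∂μ) ^ q ≤ (∫⁻ s, w s ∂μ) ^ (q - 1) * ∫⁻ s, w s * (F s / w s) ^ q ∂μ := by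
  have hq0 : (0 : ℝ) < q := by exact_mod_cast hq
  let ν := μ.withDensity w
  have hm : Measurable fun s => F s / w s := hF.div hw
  have key := eLpNorm'_le_eLpNorm'_mul_rpow_measure_univ (μ := ν) (p := 1) (q := q)
    (f := fun s => F s / w s) one_pos (by exact_mod_cast hq) hm.aestronglyMeasurable
  simp only [eLpNorm', enorm_eq_self, ENNReal.rpow_one, div_one] at key
  have e1 : ∫⁻ s, F s / w s ∂ν = ∫⁻ s, F s ∂μ := by
    rw [lintegral_withDensity_eq_lintegral_mul μ hw hm]
    congr with s
    simp only [Pi.mul_apply]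
    by_cases hs : w s = 0
    · simp [hs, h0 s hs]
    · exact ENNReal.mul_div_cancel hs (hwt s)
  have e2 : ∫⁻ s, (F s / w s) ^ (q : ℝ) ∂ν = ∫⁻ s, w s * (F s / w s) ^ q ∂μ := by
    rw [lintegral_withDensity_eq_lintegral_mul μ hw (hm.pow_const _)]
    simp only [Pi.mul_apply, ENNReal.rpow_natCast]
  have e3 : ν Set.univ = ∫⁻ s, w s ∂μ := by
    simp [ν, withDensity_apply]
  rw [e1, e2, e3] at key
  calc _ ≤ ((∫⁻ s, w s * (F s / w s) ^ q ∂μ) ^ (1 / q : ℝ)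
            * (∫⁻ s, w s ∂μ) ^ (1 - 1 / q : ℝ)) ^ q := by gcongr
    _ = _ := by
        rw [mul_pow, ← ENNReal.rpow_natCast, ← ENNReal.rpow_natCast, ← ENNReal.rpow_mul,
          ← ENNReal.rpow_mul, mul_comm]
        congr 1
        · rw [← ENNReal.rpow_natCast, Nat.cast_sub hq, sub_mul, one_mul, one_div,
            inv_mul_cancel₀ hq0.ne', Nat.cast_one]
        · rw [one_div, inv_mul_cancel₀ hq0.ne', ENNReal.rpow_one]

/-- A space-time bound for free solutions carries over to inhomogeneous solutions, written in the
interaction picture as `u t = e^{itΔ} (v t)`, with `v` of bounded variation in `L²`. The point is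
that `e^{itΔ} (v t)` is dominated, at every time `t` of the interval, by free solutions alone: the
integral over `s ≤ t` is at most the one over the whole interval. -/
lemma lintegral_propagator_path_le {N : L2 → ℝ≥0∞} (hN : IsDualNorm N) {q : ℕ} (hq : 1 ≤ q)
    {C : ℝ≥0∞} (hC : ∀ f, ∫⁻ t, N (propagator t f) ^ q ≤ C * ‖f‖ₑ ^ q) {g v : ℝ → L2}
    (hg : Continuous g) {a b : ℝ} (hv : ∀ t, v t = v a + ∫ s in a..t, g s) :
    ∫⁻ t in Set.Ioc a b, N (propagator t (v t)) ^ q ≤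
      2 ^ (q - 1) * C * (‖v a‖ₑ ^ q + (∫⁻ s in Set.Ioc a b, ‖g s‖ₑ) ^ q) := by
  set G := ∫⁻ s in Set.Ioc a b, ‖g s‖ₑ
  have hjoint : Measurable fun p : ℝ × ℝ => N (propagator p.1 (g p.2)) :=
    hN.measurable_comp (continuous_propagator_comp continuous_fst (hg.comp continuous_snd))
  have hpt : ∀ t ∈ Set.Ioc a b, N (propagator t (v t)) ^ q ≤ 2 ^ (q - 1) *
      (N (propagator t (v a)) ^ q + (∫⁻ s in Set.Ioc a b, N (propagator t (g s))) ^ q) := by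
    intro t ht
    have h1 : propagator t (v t) = propagator t (v a) + ∫ s in a..t, propagator t (g s) := by
      rw [hv t, propagator_add]
      congr 1
      exact ((propagatorIsometry t).toContinuousLinearMap.intervalIntegral_comp_comm
        (hg.intervalIntegrable a t)).symm
    have h2 : N (propagator t (v t)) ≤
        N (propagator t (v a)) + ∫⁻ s in Set.Ioc a b, N (propagator t (g s)) := by
      rw [h1]
      refine (hN.add_le _ _).trans ?_
      gcongr
      refine (hN.integral_le (continuous_propagator_comp continuous_const hg) ht.1.le).trans ?_
      exact lintegral_mono_set (Set.Ioc_subset_Ioc_right ht.2)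
    refine (pow_le_pow_left' h2 q).trans ?_
    have h3 := ENNReal.rpow_add_le_mul_rpow_add_rpow (N (propagator t (v a)))
      (∫⁻ s in Set.Ioc a b, N (propagator t (g s))) (p := q) (by exact_mod_cast hq)
    simp only [ENNReal.rpow_natCast] at h3
    refine h3.trans (le_of_eq ?_)
    congr 1
    rw [← ENNReal.rpow_natCast, Nat.cast_sub hq, Nat.cast_one]
  have hm1 : Measurable fun t => N (propagator t (v a)) ^ q :=
    (hN.measurable_comp (continuous_propagator_time _)).pow_const q
  -- The free bound for the data `g s`, normalized so that the powers match in Jensen's inequality.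
  have hsmall : ∀ s, ‖g s‖ₑ * ∫⁻ t, (N (propagator t (g s)) / ‖g s‖ₑ) ^ q ≤ ‖g s‖ₑ * C := fun s => by
    by_cases h0 : g s = 0
    · simp [h0]
    have hne : ‖g s‖ₑ ≠ 0 := by simpa using h0
    gcongr
    simp only [div_eq_mul_inv, mul_pow]
    rw [lintegral_mul_const _ ((hN.measurable_comp (continuous_propagator_time _)).pow_const q)]
    refine (mul_le_mul_left (hC (g s)) _).trans (le_of_eq ?_)
    rw [mul_assoc, ← mul_pow, ENNReal.mul_inv_cancel hne (by simp), one_pow, mul_one]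
  have hduh : ∫⁻ t in Set.Ioc a b, (∫⁻ s in Set.Ioc a b, N (propagator t (g s))) ^ q
      ≤ C * G ^ q := by
    -- Jensen's inequality with the weight `‖g s‖`, then exchange the integrals.
    calc _ ≤ ∫⁻ t, G ^ (q - 1) * ∫⁻ s in Set.Ioc a b,
          ‖g s‖ₑ * (N (propagator t (g s)) / ‖g s‖ₑ) ^ q := by
          refine (setLIntegral_le_lintegral _ _).trans (lintegral_mono fun t => ?_)
          refine lintegral_pow_le_weighted
            (hN.measurable_comp (continuous_propagator_comp continuous_const hg))
            hg.enorm.measurable (fun s => by simp) (fun s hs => ?_) hq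
          have : g s = 0 := by simpa using hs
          rw [this]
          have h00 : propagator t 0 = 0 := (propagatorIsometry t).map_zero
          rw [h00, hN.zero]
      _ = G ^ (q - 1) * ∫⁻ s in Set.Ioc a b, ‖g s‖ₑ *
          ∫⁻ t, (N (propagator t (g s)) / ‖g s‖ₑ) ^ q := by
          have hjm : Measurable fun p : ℝ × ℝ =>
              ‖g p.2‖ₑ * (N (propagator p.1 (g p.2)) / ‖g p.2‖ₑ) ^ q := by
            have : Measurable fun p : ℝ × ℝ => ‖g p.2‖ₑ := hg.enorm.measurable.comp measurable_snd
            exact this.mul ((hjoint.div this).pow_const q)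
          rw [lintegral_const_mul _ hjm.lintegral_prod_right',
            lintegral_lintegral_swap hjm.aemeasurable]
          congr 1
          refine lintegral_congr fun s => ?_
          have : Measurable fun t => N (propagator t (g s)) :=
            hN.measurable_comp (continuous_propagator_time _)
          exact lintegral_const_mul ‖g s‖ₑ ((this.div_const ‖g s‖ₑ).pow_const q)
      _ ≤ G ^ (q - 1) * ∫⁻ s in Set.Ioc a b, ‖g s‖ₑ * C := by
          exact mul_le_mul_right (lintegral_mono hsmall) _
      _ = C * G ^ q := by
          rw [lintegral_mul_const _ hg.enorm.measurable, ← mul_assoc, pow_sub_one_mul (by omega),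
            mul_comm]
  calc _ ≤ ∫⁻ t in Set.Ioc a b, 2 ^ (q - 1) *
        (N (propagator t (v a)) ^ q + (∫⁻ s in Set.Ioc a b, N (propagator t (g s))) ^ q) :=
        setLIntegral_mono' measurableSet_Ioc hpt
    _ = 2 ^ (q - 1) * ((∫⁻ t in Set.Ioc a b, N (propagator t (v a)) ^ q) +
        ∫⁻ t in Set.Ioc a b, (∫⁻ s in Set.Ioc a b, N (propagator t (g s))) ^ q) := by
        rw [lintegral_const_mul' _ _ (by simp), lintegral_add_left hm1]
    _ ≤ 2 ^ (q - 1) * (C * ‖v a‖ₑ ^ q + C * G ^ q) := by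
        gcongr
        exact (setLIntegral_le_lintegral _ _).trans (hC _)
    _ = _ := by ring

/-! ### The truncated nonlinearity -/

/-- `P_{≤ N}` as a continuous linear operator. -/
def lowFreqOperator (χ : LowFreqCutoff) (N : ℝ) : L2 →L[ℂ] L2 :=
  multiplierOperator (lowFreqSymbol χ N) (memLp_lowFreqSymbol χ N) (norm_lowFreqSymbol_le χ N)

lemma lowFreqOperator_apply (χ : LowFreqCutoff) (N : ℝ) (f : L2) :
    lowFreqOperator χ N f = lowFreq χ N f := rfl

lemma norm_lowFreq_le (χ : LowFreqCutoff) (N : ℝ) (f : L2) : ‖lowFreq χ N f‖ ≤ ‖f‖ :=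
  norm_multiplierOperator_le (hb := norm_lowFreqSymbol_le χ N) f

lemma propagator_lowFreq (χ : LowFreqCutoff) (N t : ℝ) (f : L2) :
    propagator t (lowFreq χ N f) = lowFreq χ N (propagator t f) :=
  propagator_multiplierOperator (hb := norm_lowFreqSymbol_le χ N) t f

lemma inner_lowFreq_left (χ : LowFreqCutoff) (N : ℝ) (f g : L2) :
    inner ℂ (lowFreq χ N f) g = inner ℂ f (lowFreq χ N g) :=
  inner_multiplierOperator_left (hb := norm_lowFreqSymbol_le χ N)
    (fun _ => Complex.conj_ofReal _) f g

/-- Bernstein's inequality: `P_{≤ N}` maps `L²` to `L^∞`. The constant depends on `N`. -/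
lemma exists_enorm_lowFreq_le (χ : LowFreqCutoff) {N : ℝ} (hN : 0 < N) :
    ∃ C : ℝ, 0 ≤ C ∧ ∀ f : L2, ∀ᵐ x, ‖lowFreq χ N f x‖ ≤ C * ‖f‖ := by
  have hm : MemLp (lowFreqSymbol χ N) 2 volume :=
    (continuous_lowFreqSymbol χ N).memLp_of_hasCompactSupport
      (hasCompactSupport_lowFreqSymbol χ hN)
  refine ⟨‖hm.toLp _‖, norm_nonneg _, fun f => ?_⟩
  set g : L2 := (memLp_lowFreqSymbol χ N).toLp _ • 𝓕 f with hg
  have hgi : Integrable g := integrable_symbol_mul χ hN f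
  have h1 : ∫⁻ ξ, ‖g ξ‖ₑ ≤ ENNReal.ofReal (‖hm.toLp _‖ * ‖f‖) := by
    have hol := ENNReal.lintegral_mul_le_Lp_mul_Lq volume Real.HolderConjugate.two_two
      (f := fun ξ => ‖lowFreqSymbol χ N ξ‖ₑ) (g := fun ξ => ‖(𝓕 f : L2) ξ‖ₑ)
      (continuous_lowFreqSymbol χ N).measurable.enorm.aemeasurable
      (Lp.stronglyMeasurable (𝓕 f : L2)).measurable.enorm.aemeasurable
    have e1 : ∫⁻ ξ, ‖g ξ‖ₑ
        = ∫⁻ ξ, ((fun ξ => ‖lowFreqSymbol χ N ξ‖ₑ) * fun ξ => ‖(𝓕 f : L2) ξ‖ₑ) ξ := by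
      refine lintegral_congr_ae ?_
      filter_upwards [coeFn_mulOperator (hm := memLp_lowFreqSymbol χ N)
        (hb := norm_lowFreqSymbol_le χ N) (𝓕 f)] with x hx
      change ‖mulOperator _ (memLp_lowFreqSymbol χ N) (norm_lowFreqSymbol_le χ N) (𝓕 f) x‖ₑ = _
      rw [hx, enorm_mul]
      rfl
    have e2 : ∀ h : L2, (∫⁻ ξ, ‖h ξ‖ₑ ^ (2 : ℝ)) ^ (1 / 2 : ℝ) = ‖h‖ₑ := fun h => by
      simp only [ENNReal.rpow_ofNat]
      rw [← enorm_sq_L2, ← ENNReal.rpow_ofNat, ← ENNReal.rpow_mul]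
      norm_num
    have e3 : ∫⁻ ξ, ‖lowFreqSymbol χ N ξ‖ₑ ^ (2 : ℝ) = ∫⁻ ξ, ‖hm.toLp _ ξ‖ₑ ^ (2 : ℝ) :=
      lintegral_congr_ae (hm.coeFn_toLp.mono fun x hx => by simp only [hx])
    rw [e1, ENNReal.ofReal_mul (norm_nonneg _), ofReal_norm, ofReal_norm]
    refine hol.trans (le_of_eq ?_)
    rw [e3, e2, e2]
    congr 1
    rw [← ofReal_norm, Lp.norm_fourier_eq, ofReal_norm]
  filter_upwards [coeFn_fourierInv g hgi] with x hx
  have hx' : lowFreq χ N f x = 𝓕⁻ (g : ℝ → ℂ) x := hx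
  rw [hx']
  refine (VectorFourier.norm_fourierIntegral_le_integral_norm _ _ _ _ _).trans ?_
  rw [integral_norm_eq_lintegral_enorm hgi.aestronglyMeasurable]
  exact ENNReal.toReal_le_of_le_ofReal (by positivity) h1

lemma norm_cubic {σ : ℝ} (hσ : |σ| = 1) (z : ℂ) : ‖cubic σ z‖ = ‖z‖ ^ 3 := by
  simp only [cubic, norm_mul, norm_pow, Complex.norm_real, Real.norm_eq_abs, abs_norm, hσ]
  ring

lemma norm_cubic_sub_le {σ : ℝ} (hσ : |σ| = 1) (z w : ℂ) :
    ‖cubic σ z - cubic σ w‖ ≤ 2 * (‖z‖ ^ 2 + ‖w‖ ^ 2) * ‖z - w‖ := by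
  have e : cubic σ z - cubic σ w = (σ : ℂ) * (((‖z‖ ^ 2 : ℝ) : ℂ) * (z - w) +
      (((‖z‖ - ‖w‖) * (‖z‖ + ‖w‖) : ℝ) : ℂ) * w) := by
    simp only [cubic]
    push_cast
    ring
  rw [e, norm_mul, Complex.norm_real, Real.norm_eq_abs, hσ, one_mul]
  refine (norm_add_le _ _).trans ?_
  rw [norm_mul, norm_mul, Complex.norm_real, Complex.norm_real, Real.norm_eq_abs, Real.norm_eq_abs,
    abs_of_nonneg (by positivity), abs_mul, abs_of_nonneg (by positivity : 0 ≤ ‖z‖ + ‖w‖)]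
  have h1 := abs_norm_sub_norm_le z w
  have h2 : |‖z‖ - ‖w‖| * (‖z‖ + ‖w‖) * ‖w‖ ≤ ‖z - w‖ * (‖z‖ + ‖w‖) * ‖w‖ := by gcongr
  have h3 : 0 ≤ ‖z - w‖ * ((‖z‖ - ‖w‖) ^ 2 + ‖z‖ ^ 2 + ‖w‖ ^ 2) := by positivity
  nlinarith [h2, h3]

lemma continuous_truncatedCubic (χ : LowFreqCutoff) {σ : ℝ} (hσ : |σ| = 1) {N : ℝ} (hN : 0 < N) :
    Continuous (truncatedCubic χ σ hN) := by
  obtain ⟨C, hC0, hC⟩ := exists_enorm_lowFreq_le χ hN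
  have hlip : ∀ f g : L2, ‖truncatedCubic χ σ hN f - truncatedCubic χ σ hN g‖
      ≤ 2 * ((C * ‖f‖) ^ 2 + (C * ‖g‖) ^ 2) * ‖f - g‖ := fun f g => by
    have e1 : truncatedCubic χ σ hN f - truncatedCubic χ σ hN g
        = lowFreqOperator χ N ((memLp_cubic_lowFreq χ σ hN f).toLp _
          - (memLp_cubic_lowFreq χ σ hN g).toLp _) := by
      rw [map_sub]; rfl
    rw [e1]
    refine (norm_lowFreq_le χ N _).trans ?_
    have e2 : ‖(memLp_cubic_lowFreq χ σ hN f).toLp _ - (memLp_cubic_lowFreq χ σ hN g).toLp _‖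
        ≤ 2 * ((C * ‖f‖) ^ 2 + (C * ‖g‖) ^ 2) * ‖lowFreqOperator χ N (f - g)‖ := by
      refine Lp.norm_le_mul_norm_of_ae_le_mul ?_
      rw [map_sub]
      filter_upwards [hC f, hC g, Lp.coeFn_sub ((memLp_cubic_lowFreq χ σ hN f).toLp _)
        ((memLp_cubic_lowFreq χ σ hN g).toLp _), (memLp_cubic_lowFreq χ σ hN f).coeFn_toLp,
        (memLp_cubic_lowFreq χ σ hN g).coeFn_toLp,
        Lp.coeFn_sub (lowFreqOperator χ N f) (lowFreqOperator χ N g)] with x h1 h2 h3 h4 h5 h6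
      rw [h3, h6, Pi.sub_apply, Pi.sub_apply, h4, h5]
      refine (norm_cubic_sub_le hσ _ _).trans ?_
      simp only [lowFreqOperator_apply]
      gcongr
    refine e2.trans ?_
    gcongr
    exact norm_lowFreq_le χ N _
  rw [continuous_iff_continuousAt]
  intro g
  rw [ContinuousAt, tendsto_iff_norm_sub_tendsto_zero]
  refine squeeze_zero (fun _ => norm_nonneg _) (fun f => hlip f g) ?_
  have : Continuous fun f : L2 => 2 * ((C * ‖f‖) ^ 2 + (C * ‖g‖) ^ 2) * ‖f - g‖ := by fun_prop
  simpa using this.tendsto g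

lemma enorm_truncatedCubic_sq_le (χ : LowFreqCutoff) {σ : ℝ} (hσ : |σ| = 1) {N : ℝ} (hN : 0 < N)
    (f : L2) : ‖truncatedCubic χ σ hN f‖ₑ ^ 2 ≤ eLpNorm (lowFreq χ N f) 6 volume ^ 6 := by
  have h1 : ‖truncatedCubic χ σ hN f‖ₑ ≤ ‖(memLp_cubic_lowFreq χ σ hN f).toLp _‖ₑ := by
    rw [← ofReal_norm, ← ofReal_norm]
    exact ENNReal.ofReal_le_ofReal (norm_lowFreq_le χ N _)
  refine (pow_le_pow_left' h1 2).trans (le_of_eq ?_)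
  rw [enorm_sq_L2, eLpNorm_six_pow_six]
  refine lintegral_congr_ae ?_
  filter_upwards [(memLp_cubic_lowFreq χ σ hN f).coeFn_toLp] with x hx
  rw [hx, ← ofReal_norm, norm_cubic hσ, ENNReal.ofReal_pow (norm_nonneg _), ofReal_norm, ← pow_mul]

/-- The truncated nonlinearity is a Hamiltonian vector field of a gauge invariant energy. -/
lemma inner_truncatedCubic_im (χ : LowFreqCutoff) (σ : ℝ) {N : ℝ} (hN : 0 < N) (f : L2) :
    (inner ℂ f (truncatedCubic χ σ hN f) : ℂ).im = 0 := by
  rw [truncatedCubic, ← inner_lowFreq_left, L2.inner_def]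
  have : ∫ x, inner ℂ (lowFreq χ N f x) ((memLp_cubic_lowFreq χ σ hN f).toLp _ x)
      = ∫ x, ((σ * ‖lowFreq χ N f x‖ ^ 4 : ℝ) : ℂ) := by
    refine integral_congr_ae ?_
    filter_upwards [(memLp_cubic_lowFreq χ σ hN f).coeFn_toLp] with x hx
    rw [hx]
    simp only [RCLike.inner_apply, cubic]
    have := Complex.mul_conj' (lowFreq χ N f x)
    push_cast
    calc _ = (σ : ℂ) * (‖lowFreq χ N f x‖ : ℂ) ^ 2 *
          (lowFreq χ N f x * starRingEnd ℂ (lowFreq χ N f x)) := by ring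
      _ = _ := by rw [this]; ring
  rw [this, integral_complex_ofReal, Complex.ofReal_im]

/-! ### The interaction picture and conservation of mass -/

namespace IsSolution

variable {χ : LowFreqCutoff} {σ N : ℝ} {hN : 0 < N} {u : ℝ × ℝ → ℂ}

/-- The solution as a path in `L²`. -/
def path (hu : IsSolution χ σ hN u) (t : ℝ) : L2 := (hu.memLp_two t).toLp _

/-- The interaction picture `v t = e^{-itΔ} u t` of a solution. -/
def profile (hu : IsSolution χ σ hN u) (t : ℝ) : L2 := propagator (-t) (hu.path t)

/-- The time derivative of the interaction picture. -/
def force (hu : IsSolution χ σ hN u) (t : ℝ) : L2 :=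
  -Complex.I • propagator (-t) (truncatedCubic χ σ hN (hu.path t))

lemma propagator_profile (hu : IsSolution χ σ hN u) (t : ℝ) :
    propagator t (hu.profile t) = hu.path t := by
  rw [profile, propagator_propagator, add_neg_cancel, propagator_zero]

lemma continuous_force (hu : IsSolution χ σ hN u) (hσ : |σ| = 1) : Continuous hu.force := by
  have h1 : Continuous fun t => truncatedCubic χ σ hN (hu.path t) :=
    (continuous_truncatedCubic χ hσ hN).comp hu.continuous
  exact (continuous_propagator_comp continuous_neg h1).const_smul (-Complex.I)

lemma profile_eq_add_integral (hu : IsSolution χ σ hN u) (hσ : |σ| = 1) (a t : ℝ) :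
    hu.profile t = hu.profile a + ∫ s in a..t, hu.force s := by
  have hc := hu.continuous_force hσ
  -- The Duhamel formula, propagated back to time `0`.
  have h0 : ∀ t, hu.profile t = hu.path 0 + ∫ s in (0 : ℝ)..t, hu.force s := fun t => by
    have h := congrArg (propagator (-t)) (hu.duhamel t)
    rw [propagator_sub, propagator_propagator, neg_add_cancel, propagator_zero,
      propagator_smul] at h
    have h1 : Continuous fun s => truncatedCubic χ σ hN (hu.path s) :=
      (continuous_truncatedCubic χ hσ hN).comp hu.continuous
    have hint : Continuous fun s => propagator (t - s) (truncatedCubic χ σ hN (hu.path s)) :=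
      continuous_propagator_comp (by fun_prop) h1
    have h2 := (propagatorIsometry (-t)).toContinuousLinearMap.intervalIntegral_comp_comm
      (hint.intervalIntegrable (μ := volume) 0 t)
    have h3 : ∀ s, (propagatorIsometry (-t)).toContinuousLinearMap (propagator (t - s)
        (truncatedCubic χ σ hN (hu.path s)))
        = propagator (-s) (truncatedCubic χ σ hN (hu.path s)) := fun s => by
      change propagator (-t) (propagator (t - s) _) = _
      rw [propagator_propagator]
      congr 1
      ring
    rw [funext h3] at h2
    change hu.profile t = hu.path 0 - Complex.I • (propagatorIsometry (-t)).toContinuousLinearMap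
      (∫ s in (0 : ℝ)..t, propagator (t - s) (truncatedCubic χ σ hN (hu.path s))) at h
    rw [h, ← h2]
    simp only [force]
    rw [intervalIntegral.integral_smul, neg_smul, sub_eq_add_neg]
  rw [h0 t, h0 a, add_assoc, intervalIntegral.integral_add_adjacent_intervals
    (hc.intervalIntegrable _ _) (hc.intervalIntegrable _ _)]

lemma hasDerivAt_profile (hu : IsSolution χ σ hN u) (hσ : |σ| = 1) (t : ℝ) :
    HasDerivAt hu.profile (hu.force t) t := by
  have h1 : hu.profile = fun t => hu.profile 0 + ∫ s in (0 : ℝ)..t, hu.force s :=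
    funext fun t => hu.profile_eq_add_integral hσ 0 t
  rw [h1]
  exact ((hu.continuous_force hσ).integral_hasStrictDerivAt 0 t).hasDerivAt.const_add _

/-- Conservation of mass. -/
lemma norm_profile (hu : IsSolution χ σ hN u) (hσ : |σ| = 1) (t : ℝ) :
    ‖hu.profile t‖ = ‖hu.path 0‖ := by
  -- The force is orthogonal to the profile in the real inner product.
  have hre : ∀ t, (inner ℂ (hu.profile t) (hu.force t) : ℂ).re = 0 := fun t => by
    rw [force, inner_smul_right, profile]
    have h1 := (propagatorIsometry (-t)).inner_map_map (hu.path t)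
      (truncatedCubic χ σ hN (hu.path t))
    rw [propagatorIsometry_apply, propagatorIsometry_apply] at h1
    rw [h1]
    simp [inner_truncatedCubic_im χ σ hN (hu.path t)]
  have hd : ∀ t, HasDerivAt (fun t => (inner ℂ (hu.profile t) (hu.profile t) : ℂ)) 0 t :=
    fun t => by
      have h := (hu.hasDerivAt_profile hσ t).inner ℂ (hu.hasDerivAt_profile hσ t)
      convert! h using 1
      rw [← inner_conj_symm (hu.force t), Complex.add_conj, hre]
      simp
  have hconst := is_const_of_deriv_eq_zero (fun t => (hd t).differentiableAt)
    (fun t => (hd t).deriv) t 0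
  have h2 : ‖hu.profile t‖ ^ 2 = ‖hu.profile 0‖ ^ 2 := by
    rw [inner_self_eq_norm_sq_to_K, inner_self_eq_norm_sq_to_K] at hconst
    exact_mod_cast hconst
  rw [pow_left_inj₀ (norm_nonneg _) (norm_nonneg _) two_ne_zero] at h2
  rw [h2, profile, norm_propagator]

lemma norm_path (hu : IsSolution χ σ hN u) (hσ : |σ| = 1) (t : ℝ) : ‖hu.path t‖ = ‖hu.path 0‖ := by
  rw [← hu.norm_profile hσ t, profile, norm_propagator]

lemma enorm_force_sq_le (hu : IsSolution χ σ hN u) (hσ : |σ| = 1) (t : ℝ) :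
    ‖hu.force t‖ₑ ^ 2 ≤ eLpNorm (lowFreq χ N (hu.path t)) 6 volume ^ 6 := by
  refine le_trans (le_of_eq ?_) (enorm_truncatedCubic_sq_le χ hσ hN (hu.path t))
  congr 1
  rw [force, ← ofReal_norm, ← ofReal_norm, norm_smul, norm_propagator]
  simp

end IsSolution

/-! ### A priori bounds that are uniform in the frequency cutoff -/

namespace IsSolution

variable {χ : LowFreqCutoff} {σ N : ℝ} {hN : 0 < N} {u : ℝ × ℝ → ℂ}

/-- The density in time of the sixth power of the `L⁶` norm of `P_{≤ N} u`. -/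
def lowDensity (hu : IsSolution χ σ hN u) (t : ℝ) : ℝ≥0∞ :=
  eLpNorm (lowFreq χ N (hu.path t)) 6 volume ^ 6

lemma measurable_lowDensity (hu : IsSolution χ σ hN u) : Measurable hu.lowDensity := by
  have h : Continuous fun t => lowFreqOperator χ N (hu.path t) :=
    (lowFreqOperator χ N).continuous.comp hu.continuous
  exact (isDualNorm_eLpNorm_six.measurable_comp h).pow_const 6

/-- For a fixed solution the density is bounded, with a constant depending on `N`. -/
lemma exists_lowDensity_le (hu : IsSolution χ σ hN u) (hσ : |σ| = 1) :
    ∃ c : ℝ, 0 ≤ c ∧ ∀ t, hu.lowDensity t ≤ ENNReal.ofReal c := by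
  obtain ⟨C, hC0, hC⟩ := exists_enorm_lowFreq_le χ hN
  refine ⟨(C * ‖hu.path 0‖) ^ 4 * ‖hu.path 0‖ ^ 2, by positivity, fun t => ?_⟩
  rw [lowDensity, eLpNorm_six_pow_six, ENNReal.ofReal_mul (by positivity)]
  calc _ ≤ ∫⁻ x, ENNReal.ofReal ((C * ‖hu.path 0‖) ^ 4) * ‖lowFreq χ N (hu.path t) x‖ₑ ^ 2 := by
        refine lintegral_mono_ae ?_
        filter_upwards [hC (hu.path t)] with x hx
        rw [hu.norm_path hσ] at hx
        rw [← ofReal_norm, ← ENNReal.ofReal_pow (norm_nonneg _),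
          ← ENNReal.ofReal_pow (norm_nonneg _), ← ENNReal.ofReal_mul (by positivity)]
        refine ENNReal.ofReal_le_ofReal ?_
        rw [show ‖lowFreq χ N (hu.path t) x‖ ^ 6
          = ‖lowFreq χ N (hu.path t) x‖ ^ 4 * ‖lowFreq χ N (hu.path t) x‖ ^ 2 by ring]
        gcongr
    _ = ENNReal.ofReal ((C * ‖hu.path 0‖) ^ 4) * ‖lowFreq χ N (hu.path t)‖ₑ ^ 2 := by
        rw [lintegral_const_mul' _ _ ENNReal.ofReal_ne_top, ← enorm_sq_L2]
    _ ≤ _ := by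
        gcongr
        rw [ENNReal.ofReal_pow (norm_nonneg _), ← ofReal_norm, ← hu.norm_path hσ t]
        gcongr
        exact norm_lowFreq_le χ N _

/-- The force in `L¹_t L²_x`, by the Cauchy–Schwarz inequality in time. -/
lemma lintegral_force_sq_le (hu : IsSolution χ σ hN u) (hσ : |σ| = 1) (a b : ℝ) :
    (∫⁻ s in Set.Ioc a b, ‖hu.force s‖ₑ) ^ 2 ≤
      ENNReal.ofReal (b - a) * ∫⁻ s in Set.Ioc a b, hu.lowDensity s := by
  have h := lintegral_pow_le_weighted (μ := volume.restrict (Set.Ioc a b))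
    (F := fun s => ‖hu.force s‖ₑ) (w := fun _ => 1) (hu.continuous_force hσ).enorm.measurable
    measurable_const (fun _ => by simp) (fun _ h => by simp at h) (q := 2) (by norm_num)
  simp only [div_one, one_mul, lintegral_const, Measure.restrict_apply_univ, Real.volume_Ioc,
    Nat.add_one_sub_one, pow_one] at h
  refine h.trans ?_
  gcongr with s
  exact hu.enorm_force_sq_le hσ s

/-- Strichartz and Duhamel for the truncated solution `P_{≤ N} u`, which solves an equation with the
same force up to one more projection. The constant is `352 = 2⁵ * 11`. -/
lemma lintegral_lowDensity_le (hu : IsSolution χ σ hN u) (hσ : |σ| = 1) (a b : ℝ) :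
    ∫⁻ t in Set.Ioc a b, hu.lowDensity t ≤
      352 * (‖hu.path 0‖ₑ ^ 6 +
        (ENNReal.ofReal (b - a) * ∫⁻ t in Set.Ioc a b, hu.lowDensity t) ^ 3) := by
  have hcf := hu.continuous_force hσ
  have h := lintegral_propagator_path_le isDualNorm_eLpNorm_six (q := 6) (by norm_num) strichartz
    (g := fun t => lowFreqOperator χ N (hu.force t))
    (v := fun t => lowFreqOperator χ N (hu.profile t))
    ((lowFreqOperator χ N).continuous.comp hcf) (a := a) (b := b) (fun t => by
      rw [(lowFreqOperator χ N).intervalIntegral_comp_comm (hcf.intervalIntegrable a t),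
        ← map_add, ← hu.profile_eq_add_integral hσ a t])
  have e1 : ∀ t, propagator t (lowFreqOperator χ N (hu.profile t)) = lowFreq χ N (hu.path t) :=
    fun t => by rw [lowFreqOperator_apply, propagator_lowFreq, hu.propagator_profile]
  have e2 : ∀ f : L2, ‖lowFreqOperator χ N f‖ₑ ≤ ‖f‖ₑ := fun f => by
    rw [← ofReal_norm, ← ofReal_norm]
    exact ENNReal.ofReal_le_ofReal (norm_lowFreq_le χ N f)
  have e3 : ‖hu.profile a‖ₑ = ‖hu.path 0‖ₑ := by
    rw [← ofReal_norm, hu.norm_profile hσ, ofReal_norm]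
  simp only [e1] at h
  refine h.trans ?_
  calc _ ≤ 2 ^ (6 - 1) * 11 * (‖hu.path 0‖ₑ ^ 6 + (∫⁻ s in Set.Ioc a b, ‖hu.force s‖ₑ) ^ 6) := by
        gcongr with s
        · exact (e2 _).trans e3.le
        · exact e2 _
    _ = 352 * (‖hu.path 0‖ₑ ^ 6 + ((∫⁻ s in Set.Ioc a b, ‖hu.force s‖ₑ) ^ 2) ^ 3) := by
        rw [← pow_mul]; norm_num
    _ ≤ _ := by
        gcongr
        exact hu.lintegral_force_sq_le hσ a b

/-- The local theory: on time intervals whose length depends only on the mass, the `L⁶` norm of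
`P_{≤ N} u` is bounded in terms of the mass. This is a continuity argument in the length of the
interval, based on `lintegral_lowDensity_le`. -/
lemma lintegral_lowDensity_short_le (hu : IsSolution χ σ hN u) (hσ : |σ| = 1) {M : ℝ}
    (hM : ‖hu.path 0‖ ≤ M) (a : ℝ) :
    ∫⁻ t in Set.Ioc a (a + 1 / (9 * (352 * M ^ 6 + 1))), hu.lowDensity t
      ≤ ENNReal.ofReal (352 * M ^ 6 + 1) := by
  have hM0 : 0 ≤ M := (norm_nonneg _).trans hM
  set B := 352 * M ^ 6 + 1 with hB
  have hB0 : 0 < B := by positivity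
  set δ := 1 / (9 * B) with hδ
  have hδ0 : 0 < δ := by positivity
  -- The bound depending on `N` is used only for the continuity of `y` below.
  obtain ⟨c, hc0, hc⟩ := hu.exists_lowDensity_le hσ
  have htop : ∀ t, hu.lowDensity t ≠ ⊤ := fun t => ne_top_of_le_ne_top (by simp) (hc t)
  let n : ℝ → ℝ := fun t => (hu.lowDensity t).toReal
  have hnm : Measurable n := hu.measurable_lowDensity.ennreal_toReal
  have hn0 : ∀ t, 0 ≤ n t := fun t => ENNReal.toReal_nonneg
  have hnc : ∀ t, ‖n t‖ ≤ c := fun t => by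
    rw [Real.norm_of_nonneg (hn0 t)]
    exact ENNReal.toReal_le_of_le_ofReal hc0 (hc t)
  have hint : ∀ s t, IntervalIntegrable n volume s t := fun s t =>
    (intervalIntegrable_const : IntervalIntegrable (fun _ => c) volume s t).mono_fun
      hnm.aestronglyMeasurable (.of_forall fun t => (hnc t).trans (le_abs_self c))
  let y : ℝ → ℝ := fun τ => ∫ s in a..(a + τ), n s
  have hyc : Continuous y :=
    (intervalIntegral.continuous_primitive hint a).comp (by fun_prop : Continuous fun τ => a + τ)
  have hyY : ∀ τ, 0 ≤ τ → ∫⁻ t in Set.Ioc a (a + τ), hu.lowDensity t = ENNReal.ofReal (y τ) :=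
    fun τ hτ => by
      have hle : a ≤ a + τ := by linarith
      simp only [y]
      rw [intervalIntegral.integral_of_le hle, ofReal_integral_eq_lintegral_ofReal
        (hint a (a + τ)).1 (.of_forall hn0)]
      exact lintegral_congr fun t => (ENNReal.ofReal_toReal (htop t)).symm
  have hy0 : ∀ τ, 0 ≤ τ → 0 ≤ y τ := fun τ hτ =>
    intervalIntegral.integral_nonneg (by linarith) fun t _ => hn0 t
  have hboot : ∀ τ, 0 ≤ τ → y τ ≤ 352 * (M ^ 6 + (τ * y τ) ^ 3) := fun τ hτ => by
    have h := hu.lintegral_lowDensity_le hσ a (a + τ)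
    have h0 := hy0 τ hτ
    rw [hyY τ hτ, add_sub_cancel_left, ← ENNReal.ofReal_mul hτ] at h
    have h1 : ENNReal.ofReal (y τ) ≤ ENNReal.ofReal (352 * (M ^ 6 + (τ * y τ) ^ 3)) := by
      rw [ENNReal.ofReal_mul (by norm_num), ENNReal.ofReal_add (by positivity) (by positivity),
        ENNReal.ofReal_pow (by positivity), ENNReal.ofReal_pow (by positivity)]
      refine h.trans ?_
      rw [← ofReal_norm, ENNReal.ofReal_ofNat]
      gcongr
    exact (ENNReal.ofReal_le_ofReal_iff (by positivity)).1 h1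
  rw [hyY δ hδ0.le]
  refine ENNReal.ofReal_le_ofReal ?_
  -- If `y δ > B`, then `y τ = B` for some `τ ≤ δ`, but there the a priori inequality gives
  -- `B ≤ 352 * M ^ 6 + 352 / 9 ^ 3 < B`.
  by_contra! hlt
  have hyzero : y 0 = 0 := by simp [y]
  obtain ⟨τ, hτ, hτB⟩ := intermediate_value_Icc hδ0.le hyc.continuousOn
    (show B ∈ Set.Icc (y 0) (y δ) from ⟨by rw [hyzero]; exact hB0.le, hlt.le⟩)
  have h := hboot τ hτ.1
  rw [hτB] at h
  have h2 : τ * B ≤ 1 / 9 := by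
    calc τ * B ≤ δ * B := by gcongr; exact hτ.2
      _ = 1 / 9 := by rw [hδ]; field_simp
  have h3 : (τ * B) ^ 3 ≤ (1 / 9) ^ 3 :=
    pow_le_pow_left₀ (mul_nonneg hτ.1 hB0.le) h2 3
  norm_num at h3
  linarith

end IsSolution

lemma lintegral_Ioc_add_nsmul_le {f : ℝ → ℝ≥0∞} {δ : ℝ} (hδ : 0 ≤ δ) {B : ℝ≥0∞}
    (h : ∀ a, ∫⁻ t in Set.Ioc a (a + δ), f t ≤ B) (a : ℝ) (n : ℕ) :
    ∫⁻ t in Set.Ioc a (a + n * δ), f t ≤ n * B := by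
  induction n with
  | zero => simp
  | succ n ih =>
    have h0 : 0 ≤ (n : ℝ) * δ := by positivity
    have e : Set.Ioc a (a + (n + 1 : ℕ) * δ)
        = Set.Ioc a (a + n * δ) ∪ Set.Ioc (a + n * δ) (a + n * δ + δ) := by
      rw [Set.Ioc_union_Ioc_eq_Ioc (by linarith) (by linarith)]
      push_cast
      congr 1
      ring
    rw [e]
    refine (lintegral_union_le _ _ _).trans ?_
    push_cast
    rw [add_mul, one_mul]
    gcongr
    exact h _

/-- Global-in-time control of solutions in terms of the mass alone: the interaction picture is
Hölder continuous of order `1/2`, the solution is bounded in `L⁶`, and its high frequencies are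
small in a weighted `L²` space. -/
theorem exists_uniform_bound (M T : ℝ) : ∃ A : ℝ≥0∞, A ≠ ⊤ ∧
    ∀ (χ : LowFreqCutoff) (σ N : ℝ) (hN : 0 < N) (u : ℝ × ℝ → ℂ) (hu : IsSolution χ σ hN u),
      |σ| = 1 → ‖hu.path 0‖ ≤ M →
      (∀ s t, -T ≤ s → s ≤ t → t ≤ T →
        ‖hu.profile t - hu.profile s‖ₑ ^ 2 ≤ A * ENNReal.ofReal (t - s)) ∧
      (∫⁻ t in Set.Ioc (-T) T, eLpNorm (hu.path t) 6 volume ^ 6 ≤ A) ∧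
      (∀ K > (0 : ℝ), ∫⁻ t in Set.Ioc (-T) T, ‖weightedHigh K (hu.path t)‖ₑ ^ 2
        ≤ A * ENNReal.ofReal (1 / K)) := by
  set B := 352 * M ^ 6 + 1 with hB
  have hB0 : 0 < B := by positivity
  set δ := 1 / (9 * B) with hδ
  have hδ0 : 0 < δ := by positivity
  obtain ⟨n, hn⟩ := exists_nat_ge (2 * T / δ)
  set Y : ℝ≥0∞ := n * ENNReal.ofReal B with hY
  have hYt : Y ≠ ⊤ := ENNReal.mul_ne_top (by simp) (by simp)
  set D : ℝ≥0∞ := ENNReal.ofReal (T - -T) * Y with hD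
  have hDt : D ≠ ⊤ := ENNReal.mul_ne_top (by simp) hYt
  set m : ℝ≥0∞ := ENNReal.ofReal M with hm
  have hmt : m ≠ ⊤ := by simp [hm]
  refine ⟨Y + 352 * (m ^ 6 + D ^ 3) + 8 * (m ^ 2 + D), ?_, ?_⟩
  · simp [ENNReal.add_eq_top, ENNReal.mul_eq_top, ENNReal.pow_eq_top_iff, hYt, hDt, hmt]
  intro χ σ N hN u hu hσ hM
  -- Conservation of mass allows iteration of the local bound, over `n` intervals of length `δ`.
  have hYle : ∫⁻ t in Set.Ioc (-T) T, hu.lowDensity t ≤ Y := by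
    refine (lintegral_mono_set (Set.Ioc_subset_Ioc_right ?_)).trans
      (lintegral_Ioc_add_nsmul_le hδ0.le (hu.lintegral_lowDensity_short_le hσ hM) (-T) n)
    have := (div_le_iff₀ hδ0).1 hn
    linarith
  have hcf := hu.continuous_force hσ
  have hva : ‖hu.profile (-T)‖ₑ ≤ m := by
    rw [← ofReal_norm, hu.norm_profile hσ]
    exact ENNReal.ofReal_le_ofReal hM
  have hGD : (∫⁻ s in Set.Ioc (-T) T, ‖hu.force s‖ₑ) ^ 2 ≤ D :=
    (hu.lintegral_force_sq_le hσ _ _).trans (mul_le_mul_right hYle _)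
  refine ⟨fun s t hs hst ht => ?_, ?_, fun K hK => ?_⟩
  · have h1 : hu.profile t - hu.profile s = ∫ r in s..t, hu.force r := by
      rw [hu.profile_eq_add_integral hσ s t, add_sub_cancel_left]
    calc ‖hu.profile t - hu.profile s‖ₑ ^ 2 ≤ (∫⁻ r in Set.Ioc s t, ‖hu.force r‖ₑ) ^ 2 := by
          rw [h1, intervalIntegral.integral_of_le hst]
          gcongr
          exact enorm_integral_le_lintegral_enorm _
      _ ≤ ENNReal.ofReal (t - s) * ∫⁻ r in Set.Ioc s t, hu.lowDensity r :=
          hu.lintegral_force_sq_le hσ s t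
      _ ≤ ENNReal.ofReal (t - s) * Y := by
          gcongr
          exact (lintegral_mono_set (Set.Ioc_subset_Ioc hs ht)).trans hYle
      _ = Y * ENNReal.ofReal (t - s) := mul_comm _ _
      _ ≤ _ := by
          gcongr
          rw [add_assoc]
          exact le_self_add
  · have h := lintegral_propagator_path_le isDualNorm_eLpNorm_six (q := 6) (by norm_num) strichartz
      hcf (b := T) (hu.profile_eq_add_integral hσ (-T))
    simp only [hu.propagator_profile] at h
    calc _ ≤ 352 * (m ^ 6 + D ^ 3) := by
          refine h.trans ?_
          rw [show (2 : ℝ≥0∞) ^ (6 - 1) * 11 = 352 by norm_num, show (6 : ℕ) = 2 * 3 from rfl,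
            pow_mul (∫⁻ s in Set.Ioc (-T) T, ‖hu.force s‖ₑ)]
          gcongr
      _ ≤ _ := by
          rw [add_comm Y, add_assoc]
          exact le_self_add
  · have h := lintegral_propagator_path_le (isDualNorm_enorm_comp (weightedHigh K)) (q := 2)
      (by norm_num) (lintegral_weightedHigh_propagator_le hK) hcf (b := T)
      (hu.profile_eq_add_integral hσ (-T))
    simp only [hu.propagator_profile] at h
    calc _ ≤ 2 ^ (2 - 1) * (4 * ENNReal.ofReal (1 / K)) * (m ^ 2 + D) := by
          refine h.trans ?_
          gcongr
      _ = 8 * (m ^ 2 + D) * ENNReal.ofReal (1 / K) := by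
          norm_num
          ring
      _ ≤ _ := by
          gcongr
          exact le_add_self

/-! ### Weak compactness in the interaction picture -/

lemma cauchySeq_of_forall_close {a : ℕ → ℂ}
    (h : ∀ ε > (0 : ℝ), ∃ b : ℕ → ℂ, CauchySeq b ∧ ∀ n, ‖a n - b n‖ ≤ ε) : CauchySeq a := by
  rw [Metric.cauchySeq_iff]
  intro ε hε
  obtain ⟨b, hb, hab⟩ := h (ε / 4) (by positivity)
  obtain ⟨n₀, hn₀⟩ := Metric.cauchySeq_iff.1 hb (ε / 4) (by positivity)
  refine ⟨n₀, fun m hm n hn => ?_⟩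
  have h1 := hn₀ m hm n hn
  rw [dist_eq_norm] at h1 ⊢
  calc ‖a m - a n‖ = ‖(a m - b m) + (b m - b n) - (a n - b n)‖ := by congr 1; ring
    _ ≤ ‖a m - b m‖ + ‖b m - b n‖ + ‖a n - b n‖ :=
        (norm_sub_le _ _).trans (by gcongr; exact norm_add_le _ _)
    _ < ε := by linarith [hab m, hab n]

/-- An Arzelà–Ascoli theorem for the weak topology: a bounded and equicontinuous sequence of paths
in a separable Hilbert space has a subsequence that is weakly Cauchy at every time. -/
lemma exists_subseq_weakly_cauchy {H : Type*} [NormedAddCommGroup H] [InnerProductSpace ℂ H]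
    [TopologicalSpace.SeparableSpace H] (v : ℕ → ℝ → H) {M : ℝ} (hM : ∀ n t, ‖v n t‖ ≤ M)
    (heq : ∀ t, ∀ ε > (0 : ℝ), ∃ δ > (0 : ℝ), ∀ s, |s - t| < δ → ∀ n, ‖v n s - v n t‖ ≤ ε) :
    ∃ φ : ℕ → ℕ, StrictMono φ ∧
      ∀ (t : ℝ) (g : H), CauchySeq fun k => (inner ℂ g (v (φ k) t) : ℂ) := by
  have : Nonempty H := ⟨0⟩
  let d : ℕ → H := TopologicalSpace.denseSeq H
  -- Tychonoff's theorem for the pairings with a dense sequence at rational times.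
  let X : ℕ → ℕ × ℚ → ℂ := fun n i => inner ℂ (d i.1) (v n i.2)
  have hcomp : IsCompact (Set.univ.pi fun i : ℕ × ℚ => Metric.closedBall (0 : ℂ) (‖d i.1‖ * M)) :=
    isCompact_univ_pi fun i => isCompact_closedBall _ _
  obtain ⟨x, -, φ, hφ, hlim⟩ := hcomp.tendsto_subseq (x := X) fun n i _ => by
    rw [mem_closedBall_zero_iff]
    refine (norm_inner_le_norm _ _).trans ?_
    gcongr
    exact hM n _
  rw [tendsto_pi_nhds] at hlim
  refine ⟨φ, hφ, fun t g => cauchySeq_of_forall_close fun ε hε => ?_⟩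
  have hM0 : 0 ≤ M := (norm_nonneg _).trans (hM 0 0)
  obtain ⟨j, hj⟩ := (TopologicalSpace.denseRange_denseSeq H).exists_dist_lt g
    (show 0 < ε / (2 * (M + 1)) by positivity)
  obtain ⟨δ, hδ, hδv⟩ := heq t (ε / (2 * (‖d j‖ + 1))) (by positivity)
  obtain ⟨q, hq1, hq2⟩ := exists_rat_btwn (show t - δ < t + δ by linarith)
  refine ⟨fun k => X (φ k) (j, q), (hlim (j, q)).cauchySeq, fun k => ?_⟩
  have e : (inner ℂ g (v (φ k) t) : ℂ) - X (φ k) (j, q)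
      = inner ℂ (g - d j) (v (φ k) t) - inner ℂ (d j) (v (φ k) q - v (φ k) t) := by
    simp only [X, inner_sub_left, inner_sub_right]
    ring
  have h1 : ‖g - d j‖ * ‖v (φ k) t‖ ≤ ε / 2 := by
    have : ‖g - d j‖ ≤ ε / (2 * (M + 1)) := by rw [← dist_eq_norm]; exact hj.le
    calc _ ≤ ε / (2 * (M + 1)) * (M + 1) := by
          gcongr
          exact (hM _ _).trans (by linarith)
      _ = ε / 2 := by field_simp
  have h2 : ‖d j‖ * ‖v (φ k) q - v (φ k) t‖ ≤ ε / 2 := by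
    have := hδv q (abs_lt.2 ⟨by linarith, by linarith⟩) (φ k)
    calc _ ≤ (‖d j‖ + 1) * (ε / (2 * (‖d j‖ + 1))) := by
          gcongr
          linarith
      _ = ε / 2 := by field_simp
  rw [e]
  refine (norm_sub_le _ _).trans ?_
  linarith [norm_inner_le_norm (𝕜 := ℂ) (g - d j) (v (φ k) t),
    norm_inner_le_norm (𝕜 := ℂ) (d j) (v (φ k) q - v (φ k) t)]

/-! ### Strong compactness of low frequencies -/

lemma coeFn_sharpLow (K : ℝ) (f : L2) :
    ⇑(sharpLow K f) =ᵐ[volume] 𝓕⁻ (fun ξ => sharpSymbol K ξ * (𝓕 f : L2) ξ) := by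
  have h1 := coeFn_mulOperator (hm := memLp_sharpSymbol K) (hb := norm_sharpSymbol_le K) (𝓕 f)
  have h2 : Integrable (mulOperator _ (memLp_sharpSymbol K) (norm_sharpSymbol_le K) (𝓕 f)) :=
    (integrable_sharpSymbol_mul K (𝓕 f)).congr h1.symm
  refine (coeFn_fourierInv _ h2).trans (.of_forall fun x => ?_)
  rw [Real.fourierInv_eq, Real.fourierInv_eq]
  exact integral_congr_ae (h1.mono fun v hv => by simp only [hv])

/-- Point evaluation of the low-frequency part is a bounded functional, with a norm that is uniform
in the point. -/
lemma exists_inner_eq_sharpLow (K x : ℝ) : ∃ e : L2, ‖e‖ ≤ ‖(memLp_two_sharpSymbol K).toLp _‖ ∧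
    ∀ f : L2, 𝓕⁻ (fun ξ => sharpSymbol K ξ * (𝓕 f : L2) ξ) x = inner ℂ e f := by
  let ε : ℝ → ℂ := fun ξ => Complex.exp (↑(-(2 * Real.pi * (ξ * x))) * Complex.I) * sharpSymbol K ξ
  have hεn : ∀ ξ, ‖ε ξ‖ ≤ ‖sharpSymbol K ξ‖ := fun ξ => by
    simp only [ε, norm_mul]
    rw [Complex.norm_exp_ofReal_mul_I, one_mul]
  have hε : MemLp ε 2 volume := by
    refine (memLp_two_sharpSymbol K).of_le (Measurable.aestronglyMeasurable ?_) (.of_forall hεn)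
    exact Measurable.mul (Continuous.measurable (by fun_prop)) (measurable_sharpSymbol K)
  refine ⟨𝓕⁻ (hε.toLp ε), ?_, fun f => ?_⟩
  · rw [norm_fourierInv_L2]
    refine Lp.norm_le_norm_of_ae_le ?_
    filter_upwards [hε.coeFn_toLp, (memLp_two_sharpSymbol K).coeFn_toLp] with ξ h1 h2
    rw [h1, h2]
    exact hεn ξ
  · rw [← Lp.inner_fourier_eq, FourierTransform.fourier_fourierInv_eq, L2.inner_def,
      Real.fourierInv_eq']
    refine integral_congr_ae ?_
    filter_upwards [hε.coeFn_toLp] with ξ h1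
    rw [h1]
    have hs : starRingEnd ℂ (sharpSymbol K ξ) = sharpSymbol K ξ := by
      unfold sharpSymbol
      by_cases h : ξ ∈ Set.Icc (-K) K <;> simp [h]
    simp only [ε, RCLike.inner_apply, map_mul, hs, ← Complex.exp_conj, Complex.conj_ofReal,
      Complex.conj_I, smul_eq_mul, conj_trivial]
    rw [mul_comm x ξ, show (↑(-(2 * Real.pi * (ξ * x))) * -Complex.I : ℂ)
      = ↑(2 * Real.pi * (ξ * x)) * Complex.I by push_cast; ring]
    ring

lemma enorm_weightOperator_sq {f : L2} {z : ℝ → ℂ} (h : ⇑f =ᵐ[volume] z) :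
    ‖weightOperator f‖ₑ ^ 2 = ∫⁻ x, ‖(weight x : ℂ)‖ₑ ^ 2 * ‖z x‖ₑ ^ 2 := by
  rw [enorm_sq_L2]
  refine lintegral_congr_ae ?_
  filter_upwards [coeFn_mulOperator (hm := memLp_weight) (hb := norm_weight_le) f, h] with x h1 h2
  change ‖mulOperator _ memLp_weight norm_weight_le f x‖ₑ ^ 2 = _
  rw [h1, h2, enorm_mul, mul_pow]

lemma norm_weightOperator_le (f : L2) : ‖weightOperator f‖ ≤ ‖f‖ :=
  norm_mulOperator_le (hb := norm_weight_le) f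

/-- The weighted low-frequency projection is a compact operator: it maps bounded weakly Cauchy
sequences to norm Cauchy sequences. The low-frequency parts converge pointwise and are bounded
uniformly, so that the weight permits dominated convergence. -/
lemma tendsto_weightOperator_sharpLow {f : ℕ → L2} {M : ℝ} (hM : ∀ k, ‖f k‖ ≤ M)
    (hf : ∀ g : L2, CauchySeq fun k => (inner ℂ g (f k) : ℂ)) (K : ℝ) :
    Tendsto (fun p : ℕ × ℕ => ‖weightOperator (sharpLow K (f p.1 - f p.2))‖ₑ ^ 2) atTop (𝓝 0) := by
  let z : ℕ → ℝ → ℂ := fun k => 𝓕⁻ (fun ξ => sharpSymbol K ξ * (𝓕 (f k) : L2) ξ)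
  have hM0 : 0 ≤ M := (norm_nonneg _).trans (hM 0)
  set c := ‖(memLp_two_sharpSymbol K).toLp _‖ * M with hc
  have hc0 : 0 ≤ c := by positivity
  have hz : ∀ k, ⇑(sharpLow K (f k)) =ᵐ[volume] z k := fun k => coeFn_sharpLow K (f k)
  have hzc : ∀ k x, ‖z k x‖ ≤ c := fun k x => by
    obtain ⟨e, he, hef⟩ := exists_inner_eq_sharpLow K x
    simp only [z]
    rw [hef]
    refine (norm_inner_le_norm _ _).trans ?_
    rw [hc]
    gcongr
    exact hM k
  have hzx : ∀ x, Tendsto (fun p : ℕ × ℕ => z p.1 x - z p.2 x) atTop (𝓝 0) := fun x => by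
    obtain ⟨e, he, hef⟩ := exists_inner_eq_sharpLow K x
    have h := cauchySeq_iff_tendsto_dist_atTop_0.1 (hf e)
    rw [tendsto_zero_iff_norm_tendsto_zero]
    refine h.congr fun p => ?_
    simp only [z]
    rw [hef, hef, dist_eq_norm]
  have h1 : ∀ p : ℕ × ℕ, ‖weightOperator (sharpLow K (f p.1 - f p.2))‖ₑ ^ 2
      = ∫⁻ x, ‖(weight x : ℂ)‖ₑ ^ 2 * ‖z p.1 x - z p.2 x‖ₑ ^ 2 := fun p => by
    refine enorm_weightOperator_sq ?_
    rw [map_sub]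
    filter_upwards [Lp.coeFn_sub (sharpLow K (f p.1)) (sharpLow K (f p.2)), hz p.1, hz p.2]
      with x h1 h2 h3
    rw [h1, Pi.sub_apply, h2, h3]
  simp only [h1]
  have := tendsto_lintegral_filter_of_dominated_convergence (μ := (volume : Measure ℝ))
    (l := (atTop : Filter (ℕ × ℕ))) (f := fun _ => 0)
    (F := fun p x => ‖(weight x : ℂ)‖ₑ ^ 2 * ‖z p.1 x - z p.2 x‖ₑ ^ 2)
    (fun x => ‖(weight x : ℂ)‖ₑ ^ 2 * ENNReal.ofReal (2 * c) ^ 2)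
    (.of_forall fun p => (measurable_enorm_weight.pow_const 2).mul
      (((measurable_fourierInv _).sub (measurable_fourierInv _)).enorm.pow_const 2))
    (.of_forall fun p => .of_forall fun x => ?_) ?_ ?_
  · simpa using this
  · gcongr
    rw [← ofReal_norm]
    refine ENNReal.ofReal_le_ofReal ((norm_sub_le _ _).trans ?_)
    linarith [hzc p.1 x, hzc p.2 x]
  · rw [lintegral_mul_const _ (measurable_enorm_weight.pow_const 2)]
    exact ENNReal.mul_ne_top (ne_top_of_le_ne_top (by norm_num) lintegral_weight_sq_le)
      (ENNReal.pow_ne_top ENNReal.ofReal_ne_top)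
  · refine .of_forall fun x => ?_
    have h := ENNReal.Tendsto.const_mul (a := ‖(weight x : ℂ)‖ₑ ^ 2)
      (ENNReal.Tendsto.pow (n := 2) (hzx x).enorm) (Or.inr (by simp))
    simpa using h

/-! ### Strong convergence in weighted space-time `L²` -/

/-- Weakly Cauchy paths with uniformly small high frequencies converge strongly in the weighted
space, locally in time. -/
lemma tendsto_lintegral_weightOperator {U : ℕ → ℝ → L2} (hU : ∀ k, Continuous (U k)) {M : ℝ}
    (hM : ∀ k t, ‖U k t‖ ≤ M)
    (hcauchy : ∀ (t : ℝ) (g : L2), CauchySeq fun k => (inner ℂ g (U k t) : ℂ)) {T : ℝ} {A : ℝ≥0∞}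
    (hA : A ≠ ⊤) (hhigh : ∀ K > (0 : ℝ), ∀ k, ∫⁻ t in Set.Ioc (-T) T, ‖weightedHigh K (U k t)‖ₑ ^ 2
      ≤ A * ENNReal.ofReal (1 / K)) :
    Tendsto (fun p : ℕ × ℕ => ∫⁻ t in Set.Ioc (-T) T, ‖weightOperator (U p.1 t - U p.2 t)‖ₑ ^ 2)
      atTop (𝓝 0) := by
  have htwo : ∀ f g : L2, ‖f + g‖ₑ ^ 2 ≤ 2 * (‖f‖ₑ ^ 2 + ‖g‖ₑ ^ 2) := fun f g => by
    have h1 := ENNReal.rpow_add_le_mul_rpow_add_rpow ‖f‖ₑ ‖g‖ₑ (p := 2) (by norm_num)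
    norm_num at h1
    exact (pow_le_pow_left' (enorm_add_le f g) 2).trans h1
  have hsub : ∀ f g : L2, ‖f - g‖ₑ ^ 2 ≤ 2 * (‖f‖ₑ ^ 2 + ‖g‖ₑ ^ 2) := fun f g => by
    rw [sub_eq_add_neg, ← enorm_neg g]
    exact htwo f (-g)
  have hlowc : ∀ (K : ℝ) (p : ℕ × ℕ), Continuous fun t =>
      weightOperator (sharpLow K (U p.1 t - U p.2 t)) := fun K p =>
    weightOperator.continuous.comp ((sharpLow K).continuous.comp ((hU p.1).sub (hU p.2)))
  have hhighc : ∀ (K : ℝ) (k : ℕ), Continuous fun t => weightedHigh K (U k t) := fun K k =>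
    (weightedHigh K).continuous.comp (hU k)
  have hlow : ∀ K : ℝ, Tendsto (fun p : ℕ × ℕ => ∫⁻ t in Set.Ioc (-T) T,
      ‖weightOperator (sharpLow K (U p.1 t - U p.2 t))‖ₑ ^ 2) atTop (𝓝 0) := fun K => by
    have := tendsto_lintegral_filter_of_dominated_convergence
      (μ := volume.restrict (Set.Ioc (-T) T))
      (l := (atTop : Filter (ℕ × ℕ))) (f := fun _ => 0)
      (F := fun p t => ‖weightOperator (sharpLow K (U p.1 t - U p.2 t))‖ₑ ^ 2)
      (fun _ => ENNReal.ofReal (2 * M) ^ 2)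
      (.of_forall fun p => ((hlowc K p).enorm.measurable.pow_const 2))
      (.of_forall fun p => .of_forall fun t => ?_) ?_ ?_
    · simpa using this
    · gcongr
      rw [← ofReal_norm]
      refine ENNReal.ofReal_le_ofReal ?_
      refine (norm_weightOperator_le _).trans
        ((norm_multiplierOperator_le (hb := norm_sharpSymbol_le K) _).trans
          ((norm_sub_le _ _).trans ?_))
      linarith [hM p.1 t, hM p.2 t]
    · rw [setLIntegral_const]
      exact ENNReal.mul_ne_top (ENNReal.pow_ne_top ENNReal.ofReal_ne_top) (by simp)
    · exact .of_forall fun t => tendsto_weightOperator_sharpLow (fun k => hM k t) (hcauchy t) K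
  -- Low frequencies converge for each fixed `K`, high frequencies are uniformly small as `K → ∞`.
  have hsplit : ∀ (K : ℝ) (p : ℕ × ℕ) (t : ℝ), ‖weightOperator (U p.1 t - U p.2 t)‖ₑ ^ 2 ≤
      2 * ‖weightOperator (sharpLow K (U p.1 t - U p.2 t))‖ₑ ^ 2 +
        4 * (‖weightedHigh K (U p.1 t)‖ₑ ^ 2 + ‖weightedHigh K (U p.2 t)‖ₑ ^ 2) := fun K p t => by
    have e : weightOperator (U p.1 t - U p.2 t)
        = weightOperator (sharpLow K (U p.1 t - U p.2 t)) +
          (weightedHigh K (U p.1 t) - weightedHigh K (U p.2 t)) := by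
      simp only [weightedHigh_apply, map_sub]
      abel
    rw [e]
    refine (htwo _ _).trans ?_
    rw [mul_add]
    refine add_le_add le_rfl ?_
    calc _ ≤ 2 * (2 * (‖weightedHigh K (U p.1 t)‖ₑ ^ 2 + ‖weightedHigh K (U p.2 t)‖ₑ ^ 2)) :=
          mul_le_mul_right (hsub _ _) _
      _ = _ := by rw [← mul_assoc]; norm_num
  have hbound : ∀ (K : ℝ), 0 < K → ∀ p : ℕ × ℕ,
      ∫⁻ t in Set.Ioc (-T) T, ‖weightOperator (U p.1 t - U p.2 t)‖ₑ ^ 2 ≤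
        2 * (∫⁻ t in Set.Ioc (-T) T, ‖weightOperator (sharpLow K (U p.1 t - U p.2 t))‖ₑ ^ 2) +
        8 * A * ENNReal.ofReal (1 / K) := fun K hK p => by
    refine (lintegral_mono fun t => hsplit K p t).trans ?_
    have hm1 : ∀ k, Measurable fun t => ‖weightedHigh K (U k t)‖ₑ ^ 2 := fun k =>
      (hhighc K k).enorm.measurable.pow_const 2
    rw [lintegral_add_left (((hlowc K p).enorm.measurable.pow_const 2).const_mul 2),
      lintegral_const_mul' _ _ (by simp), lintegral_const_mul' _ _ (by simp),
      lintegral_add_left (hm1 _)]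
    refine add_le_add le_rfl ?_
    calc _ ≤ 4 * (A * ENNReal.ofReal (1 / K) + A * ENNReal.ofReal (1 / K)) :=
          mul_le_mul_right (add_le_add (hhigh K hK _) (hhigh K hK _)) _
      _ = _ := by ring
  rw [ENNReal.tendsto_nhds_zero]
  intro ε hε
  have hKlim : Tendsto (fun K : ℝ => 8 * A * ENNReal.ofReal (1 / K)) atTop (𝓝 0) := by
    have h1 : Tendsto (fun K : ℝ => ENNReal.ofReal (1 / K)) atTop (𝓝 0) := by
      have := ENNReal.tendsto_ofReal (tendsto_inv_atTop_zero (𝕜 := ℝ))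
      simpa [one_div] using this
    have h2 := ENNReal.Tendsto.const_mul (a := 8 * A) h1
      (Or.inr (ENNReal.mul_ne_top (by norm_num) hA))
    simpa using h2
  have hε2 : 0 < ε / 2 := ENNReal.half_pos hε.ne'
  obtain ⟨K, hKε, hK0⟩ := ((ENNReal.tendsto_nhds_zero.1 hKlim (ε / 2) hε2).and
    (eventually_gt_atTop 0)).exists
  have hlow2 : Tendsto (fun p : ℕ × ℕ => 2 * ∫⁻ t in Set.Ioc (-T) T,
      ‖weightOperator (sharpLow K (U p.1 t - U p.2 t))‖ₑ ^ 2) atTop (𝓝 0) := by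
    have := ENNReal.Tendsto.const_mul (a := 2) (hlow K) (Or.inr (by simp))
    simpa using this
  filter_upwards [ENNReal.tendsto_nhds_zero.1 hlow2 (ε / 2) hε2] with p hp
  calc _ ≤ _ := hbound K hK0 p
    _ ≤ ε / 2 + ε / 2 := add_le_add hp hKε
    _ = ε := ENNReal.add_halves ε

/-- A weight in time makes the convergence global in time. -/
lemma tendsto_lintegral_weight_weightOperator {U : ℕ → ℝ → L2} (hU : ∀ k, Continuous (U k)) {M : ℝ}
    (hM : ∀ k t, ‖U k t‖ ≤ M)
    (hcauchy : ∀ (t : ℝ) (g : L2), CauchySeq fun k => (inner ℂ g (U k t) : ℂ))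
    (hhigh : ∀ T : ℝ, ∃ A : ℝ≥0∞, A ≠ ⊤ ∧ ∀ K > (0 : ℝ), ∀ k,
      ∫⁻ t in Set.Ioc (-T) T, ‖weightedHigh K (U k t)‖ₑ ^ 2 ≤ A * ENNReal.ofReal (1 / K)) :
    Tendsto (fun p : ℕ × ℕ => ∫⁻ t, ‖(weight t : ℂ)‖ₑ ^ 2 *
      ‖weightOperator (U p.1 t - U p.2 t)‖ₑ ^ 2) atTop (𝓝 0) := by
  set c : ℝ≥0∞ := ENNReal.ofReal (2 * M) ^ 2 with hc
  have hEc : ∀ (p : ℕ × ℕ) t, ‖weightOperator (U p.1 t - U p.2 t)‖ₑ ^ 2 ≤ c := fun p t => by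
    rw [hc]
    gcongr
    rw [← ofReal_norm]
    refine ENNReal.ofReal_le_ofReal ((norm_weightOperator_le _).trans ((norm_sub_le _ _).trans ?_))
    linarith [hM p.1 t, hM p.2 t]
  have htail : ∀ T > (0 : ℝ), ∀ p : ℕ × ℕ, ∫⁻ t in (Set.Ioc (-T) T)ᶜ, ‖(weight t : ℂ)‖ₑ ^ 2 *
      ‖weightOperator (U p.1 t - U p.2 t)‖ₑ ^ 2 ≤ 4 * c * ENNReal.ofReal (1 / T) := by
    intro T hT p
    calc _ ≤ ∫⁻ t in (Set.Ioc (-T) T)ᶜ, (c * ENNReal.ofReal (1 / T)) * ‖(weight t : ℂ)‖ₑ := by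
          refine setLIntegral_mono (measurable_enorm_weight.const_mul _) fun t ht => ?_
          -- One factor of the weight is small on the tail, the other one is integrable.
          have hwt : ‖(weight t : ℂ)‖ₑ ≤ ENNReal.ofReal (1 / T) := by
            rw [enorm_weight]
            refine ENNReal.ofReal_le_ofReal ?_
            have hTt : T ^ 2 ≤ t ^ 2 := by
              rw [sq_le_sq, abs_of_pos hT]
              by_contra! h
              exact ht ⟨(abs_lt.1 h).1, (abs_lt.1 h).2.le⟩
            unfold weight
            rw [← one_div]
            refine one_div_le_one_div_of_le hT ?_
            nlinarith [sq_nonneg (T - 1)]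
          calc _ ≤ (‖(weight t : ℂ)‖ₑ * ENNReal.ofReal (1 / T)) * c := by
                rw [sq]
                gcongr
                exact hEc p t
            _ = _ := by ring
      _ ≤ (c * ENNReal.ofReal (1 / T)) * 4 := by
          rw [lintegral_const_mul _ measurable_enorm_weight]
          gcongr
          exact (setLIntegral_le_lintegral _ _).trans lintegral_weight_le
      _ = _ := by ring
  rw [ENNReal.tendsto_nhds_zero]
  intro ε hε
  have hε2 : 0 < ε / 2 := ENNReal.half_pos hε.ne'
  have hTlim : Tendsto (fun T : ℝ => 4 * c * ENNReal.ofReal (1 / T)) atTop (𝓝 0) := by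
    have h1 : Tendsto (fun K : ℝ => ENNReal.ofReal (1 / K)) atTop (𝓝 0) := by
      have := ENNReal.tendsto_ofReal (tendsto_inv_atTop_zero (𝕜 := ℝ))
      simpa [one_div] using this
    have h2 := ENNReal.Tendsto.const_mul (a := 4 * c) h1
      (Or.inr (ENNReal.mul_ne_top (by norm_num)
        (ENNReal.pow_ne_top ENNReal.ofReal_ne_top)))
    simpa using h2
  obtain ⟨T, hTε, hT0⟩ := ((ENNReal.tendsto_nhds_zero.1 hTlim (ε / 2) hε2).and
    (eventually_gt_atTop 0)).exists
  obtain ⟨A, hA, hAK⟩ := hhigh T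
  have hloc := tendsto_lintegral_weightOperator hU hM hcauchy hA hAK
  filter_upwards [ENNReal.tendsto_nhds_zero.1 hloc (ε / 2) hε2] with p hp
  rw [← lintegral_add_compl _ (measurableSet_Ioc (a := -T) (b := T))]
  calc _ ≤ ε / 2 + ε / 2 := by
        refine add_le_add (le_trans (lintegral_mono fun t => ?_) hp) ((htail T hT0 p).trans hTε)
        refine mul_le_of_le_one_left zero_le (pow_le_one' ?_ 2)
        exact enorm_le_one_of_norm_le_one (norm_weight_le t)
    _ = ε := ENNReal.add_halves ε

/-! ### From strong local convergence in `L²` to `L^p` with `p < 6` -/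

/-- Convergence in `L²` and boundedness in `L⁶` imply convergence in `L^p` for `p < 6`, on a finite
measure space. -/
lemma tendsto_eLpNorm_of_two_of_six {α : Type*} [MeasurableSpace α] {μ : Measure α}
    [IsFiniteMeasure μ] {f : ℕ → α → ℂ} (hf : ∀ k, AEStronglyMeasurable (f k) μ)
    (h2 : Tendsto (fun k => eLpNorm (f k) 2 μ) atTop (𝓝 0)) {C : ℝ≥0∞} (hC : C ≠ ⊤)
    (h6 : ∀ k, eLpNorm (f k) 6 μ ≤ C) {p : ℝ≥0∞} (hp : p < 6) :
    Tendsto (fun k => eLpNorm (f k) p μ) atTop (𝓝 0) := by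
  wlog hp2 : 2 ≤ p generalizing p
  · have hb : ∀ k, eLpNorm (f k) p μ ≤ eLpNorm (f k) 2 μ *
        μ Set.univ ^ (1 / p.toReal - 1 / (2 : ℝ≥0∞).toReal) := fun k =>
      eLpNorm_le_eLpNorm_mul_rpow_measure_univ (not_le.1 hp2).le (hf k)
    by_cases hp0 : p = 0
    · simp [hp0]
    refine tendsto_of_tendsto_of_tendsto_of_le_of_le tendsto_const_nhds ?_ (fun _ => zero_le) hb
    have hfin : μ Set.univ ^ (1 / p.toReal - 1 / (2 : ℝ≥0∞).toReal) ≠ ⊤ := by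
      refine ENNReal.rpow_ne_top_of_nonneg (sub_nonneg.2 ?_) (measure_ne_top _ _)
      exact one_div_le_one_div_of_le (ENNReal.toReal_pos hp0 hp.ne_top)
        (ENNReal.toReal_mono (by norm_num) (not_le.1 hp2).le)
    simpa using ENNReal.Tendsto.mul_const h2 (Or.inr hfin)
  set r := p.toReal with hr
  have hpt : p ≠ ⊤ := hp.ne_top
  have hp0 : p ≠ 0 := (lt_of_lt_of_le (by norm_num) hp2).ne'
  have hr2 : 2 ≤ r := by
    have := ENNReal.toReal_mono hpt hp2
    simpa using this
  have hr6 : r < 6 := by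
    have := (ENNReal.toReal_lt_toReal hpt (by norm_num)).2 hp
    simpa using this
  -- Hölder's inequality with `r = 2θ + 6(1 - θ)`.
  set θ := (6 - r) / 4 with hθ
  have hθ0 : 0 < θ := by rw [hθ]; linarith
  have hθ1 : 0 ≤ 1 - θ := by rw [hθ]; linarith
  have key : ∀ k, eLpNorm (f k) p μ ≤
      ((eLpNorm (f k) 2 μ ^ (2 : ℝ)) ^ θ * (C ^ (6 : ℝ)) ^ (1 - θ)) ^ (1 / r) := fun k => by
    have e2 : ∫⁻ x, ‖f k x‖ₑ ^ (2 : ℝ) ∂μ = eLpNorm (f k) 2 μ ^ (2 : ℝ) := by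
      rw [eLpNorm_eq_lintegral_rpow_enorm_toReal (by norm_num) (by norm_num), ← ENNReal.rpow_mul]
      norm_num
    have e6 : ∫⁻ x, ‖f k x‖ₑ ^ (6 : ℝ) ∂μ = eLpNorm (f k) 6 μ ^ (6 : ℝ) := by
      rw [eLpNorm_eq_lintegral_rpow_enorm_toReal (by norm_num) (by norm_num), ← ENNReal.rpow_mul]
      norm_num
    rw [eLpNorm_eq_lintegral_rpow_enorm_toReal hp0 hpt]
    refine ENNReal.rpow_le_rpow ?_ (by positivity)
    have h := ENNReal.lintegral_mul_norm_pow_le (μ := μ) (f := fun x => ‖f k x‖ₑ ^ (2 : ℝ))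
      (g := fun x => ‖f k x‖ₑ ^ (6 : ℝ)) ((hf k).enorm.pow_const _) ((hf k).enorm.pow_const _)
      hθ0.le hθ1 (by ring)
    rw [e2, e6] at h
    refine (le_of_eq (lintegral_congr fun x => ?_)).trans (h.trans ?_)
    · rw [← ENNReal.rpow_mul, ← ENNReal.rpow_mul,
        ← ENNReal.rpow_add_of_nonneg _ _ (by positivity) (by positivity)]
      congr 1
      rw [hθ]
      ring
    · gcongr
      exact h6 k
  refine tendsto_of_tendsto_of_tendsto_of_le_of_le tendsto_const_nhds ?_ (fun _ => zero_le) key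
  have hc : (C ^ (6 : ℝ)) ^ (1 - θ) ≠ ⊤ :=
    ENNReal.rpow_ne_top_of_nonneg hθ1 (ENNReal.rpow_ne_top_of_nonneg (by norm_num) hC)
  have t1 := (h2.ennrpow_const 2).ennrpow_const θ
  have t2 := (ENNReal.Tendsto.mul_const t1 (Or.inr hc)).ennrpow_const (1 / r)
  rw [ENNReal.zero_rpow_of_pos (by norm_num), ENNReal.zero_rpow_of_pos hθ0, zero_mul,
    ENNReal.zero_rpow_of_pos (by positivity)] at t2
  exact t2

/-- Fatou's lemma: a limit in `L²` inherits bounds in `L⁶`. -/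
lemma eLpNorm_six_le_of_tendsto {α : Type*} [MeasurableSpace α] {μ : Measure α}
    {f : ℕ → α → ℂ} {v : α → ℂ} (hf : ∀ k, AEStronglyMeasurable (f k) μ)
    (hv : AEStronglyMeasurable v μ)
    (h2 : Tendsto (fun k => eLpNorm (f k - v) 2 μ) atTop (𝓝 0)) {C : ℝ≥0∞}
    (h6 : ∀ k, eLpNorm (f k) 6 μ ≤ C) : eLpNorm v 6 μ ≤ C := by
  obtain ⟨ns, -, hns⟩ :=
    (tendstoInMeasure_of_tendsto_eLpNorm (by norm_num) hf hv h2).exists_seq_tendsto_ae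
  refine (Lp.eLpNorm_lim_le_liminf_eLpNorm (fun k => hf (ns k)) v hns).trans ?_
  refine (liminf_le_liminf (Eventually.of_forall fun k => h6 (ns k))).trans ?_
  simp

/-- A sequence that is Cauchy in a weighted `L²` space, with a weight `W` that vanishes nowhere,
converges there. -/
lemma exists_tendsto_eLpNorm_mul {α : Type*} [MeasurableSpace α] {μ : Measure α} {W : α → ℂ}
    (hW : AEStronglyMeasurable W μ) (hW0 : ∀ x, W x ≠ 0) {f : ℕ → α → ℂ}
    (hf : ∀ k, MemLp (fun x => W x * f k x) 2 μ)
    (hc : Tendsto (fun p : ℕ × ℕ => eLpNorm (fun x => W x * (f p.1 x - f p.2 x)) 2 μ)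
      atTop (𝓝 0)) :
    ∃ v : α → ℂ, AEStronglyMeasurable v μ ∧
      Tendsto (fun k => eLpNorm (fun x => W x * (f k x - v x)) 2 μ) atTop (𝓝 0) := by
  have hcs : CauchySeq fun k => (hf k).toLp _ := by
    rw [Lp.cauchySeq_Lp_iff_cauchySeq_eLpNorm]
    refine hc.congr fun p => eLpNorm_congr_ae ?_
    filter_upwards [(hf p.1).coeFn_toLp, (hf p.2).coeFn_toLp] with x h1 h2
    rw [Pi.sub_apply, h1, h2, mul_sub]
  obtain ⟨V, hV⟩ := cauchySeq_tendsto_of_complete hcs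
  rw [Lp.tendsto_Lp_iff_tendsto_eLpNorm'] at hV
  refine ⟨fun x => V x / W x, (Lp.aestronglyMeasurable V).div₀ hW, ?_⟩
  refine hV.congr fun k => eLpNorm_congr_ae ?_
  filter_upwards [(hf k).coeFn_toLp] with x h1
  rw [Pi.sub_apply, h1, mul_sub, mul_div_cancel₀ _ (hW0 x)]

/-- The space-time weight `(1 + t²)⁻¹ (1 + x²)⁻¹`. -/
def spaceTimeWeight (p : ℝ × ℝ) : ℂ := weight p.1 * weight p.2

lemma continuous_spaceTimeWeight : Continuous spaceTimeWeight := by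
  have := continuous_weight
  unfold spaceTimeWeight
  fun_prop

lemma spaceTimeWeight_ne_zero (p : ℝ × ℝ) : spaceTimeWeight p ≠ 0 := by
  have h1 := (weight_pos p.1).ne'
  have h2 := (weight_pos p.2).ne'
  simp [spaceTimeWeight, h1, h2]

/-- On bounded boxes the space-time weight is bounded below. -/
lemma eLpNorm_restrict_box_le (g : ℝ × ℝ → ℂ) (T R : ℝ) (p : ℝ≥0∞) :
    eLpNorm g p (volume.restrict (Set.Icc (-T) T ×ˢ Set.Icc (-R) R)) ≤
      ENNReal.ofReal ((1 + T ^ 2) * (1 + R ^ 2)) *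
        eLpNorm (fun x => spaceTimeWeight x * g x) p volume := by
  refine (eLpNorm_le_mul_eLpNorm_of_ae_le_mul (c := (1 + T ^ 2) * (1 + R ^ 2))
    (g := fun x => spaceTimeWeight x * g x) ?_ p).trans ?_
  · filter_upwards [ae_restrict_mem (measurableSet_Icc.prod measurableSet_Icc)] with x hx
    obtain ⟨h1, h2⟩ := hx
    have key : ∀ {a S : ℝ}, a ∈ Set.Icc (-S) S → 1 ≤ (1 + S ^ 2) * weight a := fun {a S} h => by
      rw [weight, ← div_eq_mul_inv, le_div_iff₀ (by positivity), one_mul]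
      have := sq_le_sq' h.1 h.2
      linarith
    rw [norm_mul, spaceTimeWeight, norm_mul, Complex.norm_real, Complex.norm_real,
      Real.norm_of_nonneg (weight_pos _).le, Real.norm_of_nonneg (weight_pos _).le]
    have h3 : 1 ≤ ((1 + T ^ 2) * weight x.1) * ((1 + R ^ 2) * weight x.2) :=
      one_le_mul_of_one_le_of_one_le (key h1) (key h2)
    calc ‖g x‖ ≤ ((1 + T ^ 2) * weight x.1) * ((1 + R ^ 2) * weight x.2) * ‖g x‖ :=
          le_mul_of_one_le_left (norm_nonneg _) h3
      _ = _ := by ring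
  · exact mul_le_mul_right (eLpNorm_mono_measure _ Measure.restrict_le_self) _

/-- The weighted `L²` norm in space-time, computed on time slices. -/
lemma eLpNorm_spaceTimeWeight_sq {g : ℝ × ℝ → ℂ} (hg : AEStronglyMeasurable g volume)
    {U : ℝ → L2} (hU : ∀ t, ⇑(U t) =ᵐ[volume] fun x => g (t, x)) :
    eLpNorm (fun x => spaceTimeWeight x * g x) 2 volume ^ 2 =
      ∫⁻ t, ‖(weight t : ℂ)‖ₑ ^ 2 * ‖weightOperator (U t)‖ₑ ^ 2 := by
  rw [eLpNorm_eq_lintegral_rpow_enorm_toReal (by norm_num) (by norm_num), ← ENNReal.rpow_natCast,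
    ← ENNReal.rpow_mul]
  have hm : AEMeasurable (fun x => ‖spaceTimeWeight x * g x‖ₑ ^ (2 : ℝ))
      (volume : Measure (ℝ × ℝ)) :=
    (continuous_spaceTimeWeight.aestronglyMeasurable.mul hg).enorm.pow_const _
  norm_num
  rw [Measure.volume_eq_prod] at hm ⊢
  simp only [ENNReal.rpow_ofNat, enorm_mul] at hm
  rw [lintegral_prod _ hm]
  refine lintegral_congr fun t => ?_
  rw [enorm_weightOperator_sq (hU t), ← lintegral_const_mul' _ _ (by finiteness)]
  refine lintegral_congr fun x => ?_
  rw [spaceTimeWeight, enorm_mul]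
  ring

/-- The `L⁶` norm on a box is bounded by the `L⁶` norms of the time slices. -/
lemma eLpNorm_six_restrict_box_pow_le {g : ℝ × ℝ → ℂ} (hg : AEStronglyMeasurable g volume)
    {U : ℝ → L2} (hU : ∀ t, ⇑(U t) =ᵐ[volume] fun x => g (t, x)) (T R : ℝ) :
    eLpNorm g 6 (volume.restrict (Set.Icc (-T) T ×ˢ Set.Icc (-R) R)) ^ 6 ≤
      ∫⁻ t in Set.Ioc (-T) T, eLpNorm (U t) 6 volume ^ 6 := by
  have h1 : eLpNorm g 6 (volume.restrict (Set.Icc (-T) T ×ˢ Set.Icc (-R) R)) ≤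
      eLpNorm g 6 (volume.restrict (Set.Icc (-T) T ×ˢ Set.univ)) :=
    eLpNorm_mono_measure _ (Measure.restrict_mono
      (Set.prod_mono subset_rfl (Set.subset_univ _)) le_rfl)
  refine (pow_le_pow_left' h1 6).trans (le_of_eq ?_)
  rw [eLpNorm_eq_lintegral_rpow_enorm_toReal (by norm_num) (by norm_num), ← ENNReal.rpow_natCast,
    ← ENNReal.rpow_mul]
  have hm : AEMeasurable (fun x => ‖g x‖ₑ ^ 6)
      (volume.restrict (Set.Icc (-T) T ×ˢ (Set.univ : Set ℝ))) :=
    (hg.enorm.pow_const _).restrict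
  norm_num
  rw [Measure.volume_eq_prod, ← Measure.prod_restrict] at hm ⊢
  rw [lintegral_prod _ hm, ← restrict_Ioc_eq_restrict_Icc]
  refine lintegral_congr fun t => ?_
  rw [eLpNorm_six_pow_six, Measure.restrict_univ]
  exact lintegral_congr_ae ((hU t).mono fun x hx => by simp only [hx])

/-! ### Compactness of the sequence of solutions -/

/-- Compactness for a sequence of solutions with a uniform bound on the mass. No relation between
the frequency parameters `N n` is needed, because the bounds in `exists_uniform_bound` do not
depend on them. -/
theorem exists_subseq_tendsto {χ : LowFreqCutoff} {σ : ℝ} (hσ : |σ| = 1) {N : ℕ → ℝ}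
    {hN : ∀ n, 0 < N n} {u : ℕ → ℝ × ℝ → ℂ} (hu : ∀ n, IsSolution χ σ (hN n) (u n)) {M : ℝ}
    (hM : ∀ n, ‖(hu n).path 0‖ ≤ M) :
    ∃ v : ℝ × ℝ → ℂ, AEStronglyMeasurable v volume ∧
      ∃ φ : ℕ → ℕ, StrictMono φ ∧
        ∀ R T : ℝ, ∀ p : ℝ≥0∞, p < 6 →
          Tendsto (fun k => eLpNorm (u (φ k) - v) p
            (volume.restrict (Set.Icc (-T) T ×ˢ Set.Icc (-R) R))) atTop (𝓝 0) := by
  have hM' : ∀ n t, ‖(hu n).path t‖ ≤ M := fun n t => ((hu n).norm_path hσ t).le.trans (hM n)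
  have : Fact ((2 : ℝ≥0∞) ≠ (⊤ : ℝ≥0∞)) := ⟨by norm_num⟩
  obtain ⟨φ, hφ, hφc⟩ := exists_subseq_weakly_cauchy (fun n => (hu n).profile)
    (fun n t => ((hu n).norm_profile hσ t).le.trans (hM n)) (fun t ε hε => by
      obtain ⟨A, hA, hAb⟩ := exists_uniform_bound M (|t| + 1)
      -- the profiles are Hölder continuous of order `1/2`, uniformly in `n`
      refine ⟨min 1 (ε ^ 2 / (A.toReal + 1)), by positivity, fun s hs n => ?_⟩
      have hst : ∀ a b : ℝ, -(|t| + 1) ≤ a → a ≤ b → b ≤ |t| + 1 → b - a = |s - t| →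
          ‖(hu n).profile b - (hu n).profile a‖ ≤ ε := fun a b ha hab hb he => by
        have h1 := (hAb χ σ (N n) (hN n) (u n) (hu n) hσ (hM n)).1 a b ha hab hb
        rw [← ofReal_norm, ← ENNReal.ofReal_pow (norm_nonneg _), ← ENNReal.ofReal_toReal hA,
          ← ENNReal.ofReal_mul ENNReal.toReal_nonneg, he] at h1
        have h2 := (ENNReal.ofReal_le_ofReal_iff (by positivity)).1 h1
        have h3 : |s - t| * (A.toReal + 1) < ε ^ 2 :=
          (lt_div_iff₀ (by positivity)).1 (hs.trans_le (min_le_right _ _))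
        refine (pow_le_pow_iff_left₀ (norm_nonneg _) hε.le two_ne_zero).1 ?_
        nlinarith [abs_nonneg (s - t)]
      have hs1 := abs_lt.1 (hs.trans_le (min_le_left _ _))
      have ht1 := abs_le.1 (le_refl |t|)
      rcases le_total t s with h | h
      · exact hst t s (by linarith) h (by linarith) (abs_of_nonneg (by linarith)).symm
      · rw [norm_sub_rev]
        refine hst s t (by linarith) h (by linarith) ?_
        rw [abs_of_nonpos (by linarith)]
        ring)
  have hslice : ∀ n t, ⇑((hu n).path t) =ᵐ[volume] fun x => u n (t, x) :=
    fun n t => ((hu n).memLp_two t).coeFn_toLp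
  have hcauchy := tendsto_lintegral_weight_weightOperator (U := fun k => (hu (φ k)).path)
    (fun k => (hu (φ k)).continuous) (fun k => hM' (φ k))
    (fun t g => by
      have h := hφc t (propagator (-t) g)
      simp only [inner_propagator_left, neg_neg, (hu _).propagator_profile] at h
      exact h)
    (fun T => by
      obtain ⟨A, hA, hAb⟩ := exists_uniform_bound M T
      exact ⟨A, hA, fun K hK k =>
        (hAb χ σ (N (φ k)) (hN (φ k)) (u (φ k)) (hu (φ k)) hσ (hM (φ k))).2.2 K hK⟩)
  have hmeas := fun n => (hu n).aestronglyMeasurable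
  -- Mass conservation makes the solutions square integrable against the space-time weight.
  have hWu : ∀ n, MemLp (fun x => spaceTimeWeight x * u n x) 2 volume := fun n => by
    refine ⟨continuous_spaceTimeWeight.aestronglyMeasurable.mul (hmeas n), ?_⟩
    have h1 : eLpNorm (fun x => spaceTimeWeight x * u n x) 2 volume ^ 2 ≤
        4 * ENNReal.ofReal M ^ 2 := by
      rw [eLpNorm_spaceTimeWeight_sq (hmeas n) (hslice n)]
      calc _ ≤ ∫⁻ t, ‖(weight t : ℂ)‖ₑ ^ 2 * ENNReal.ofReal M ^ 2 := by
            refine lintegral_mono fun t => mul_le_mul_right (pow_le_pow_left' ?_ 2) _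
            rw [← ofReal_norm]
            exact ENNReal.ofReal_le_ofReal ((norm_weightOperator_le _).trans (hM' n t))
        _ ≤ _ := by
            rw [lintegral_mul_const' _ _ (ENNReal.pow_ne_top ENNReal.ofReal_ne_top)]
            exact mul_le_mul_left lintegral_weight_sq_le _
    have h2 : eLpNorm (fun x => spaceTimeWeight x * u n x) 2 volume ^ 2 < ⊤ :=
      h1.trans_lt (ENNReal.mul_lt_top (by norm_num)
        (ENNReal.pow_lt_top ENNReal.ofReal_lt_top))
    exact (ENNReal.pow_lt_top_iff.1 h2).resolve_right two_ne_zero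
  -- A single limit in the weighted space serves for all boxes and all exponents.
  obtain ⟨v, hv, hlim⟩ := exists_tendsto_eLpNorm_mul
    continuous_spaceTimeWeight.aestronglyMeasurable spaceTimeWeight_ne_zero
    (f := fun k => u (φ k)) (fun k => hWu (φ k)) (by
      refine tendsto_zero_of_sq (hcauchy.congr fun p => ?_)
      rw [← eLpNorm_spaceTimeWeight_sq ((hmeas (φ p.1)).sub (hmeas (φ p.2))) fun t => ?_]
      · rfl
      · filter_upwards [Lp.coeFn_sub ((hu (φ p.1)).path t) ((hu (φ p.2)).path t),
          hslice (φ p.1) t, hslice (φ p.2) t] with x h1 h2 h3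
        rw [h1, Pi.sub_apply, h2, h3, Pi.sub_apply])
  refine ⟨v, hv, φ, hφ, fun R T p hp => ?_⟩
  set μ : Measure (ℝ × ℝ) := volume.restrict (Set.Icc (-T) T ×ˢ Set.Icc (-R) R) with hμ
  have hfin : IsFiniteMeasure μ :=
    ⟨by
      rw [hμ, Measure.restrict_apply_univ]
      exact (isCompact_Icc.prod isCompact_Icc).measure_lt_top⟩
  have h2 : Tendsto (fun k => eLpNorm (u (φ k) - v) 2 μ) atTop (𝓝 0) := by
    refine tendsto_of_tendsto_of_tendsto_of_le_of_le tendsto_const_nhds ?_ (fun _ => zero_le)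
      (fun k => eLpNorm_restrict_box_le (u (φ k) - v) T R 2)
    simpa using! ENNReal.Tendsto.const_mul hlim (Or.inr ENNReal.ofReal_ne_top)
  obtain ⟨A, hA, hAb⟩ := exists_uniform_bound M T
  have h6 : ∀ k, eLpNorm (u (φ k)) 6 μ ≤ A ^ (1 / 6 : ℝ) := fun k => by
    have h := (eLpNorm_six_restrict_box_pow_le (hmeas (φ k)) (hslice (φ k)) T R).trans
      (hAb χ σ (N (φ k)) (hN (φ k)) (u (φ k)) (hu (φ k)) hσ (hM (φ k))).2.1
    rw [one_div, ENNReal.le_rpow_inv_iff (by norm_num)]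
    exact_mod_cast h
  have h6v := eLpNorm_six_le_of_tendsto (fun k => (hmeas (φ k)).restrict) hv.restrict h2 h6
  refine tendsto_eLpNorm_of_two_of_six (fun k => ((hmeas (φ k)).sub hv).restrict) h2
    (C := A ^ (1 / 6 : ℝ) + A ^ (1 / 6 : ℝ)) ?_ (fun k => ?_) hp
  · exact ENNReal.add_ne_top.2 ⟨ENNReal.rpow_ne_top_of_nonneg (by norm_num) hA,
      ENNReal.rpow_ne_top_of_nonneg (by norm_num) hA⟩
  · exact (eLpNorm_sub_le (hmeas (φ k)).restrict hv.restrict (by norm_num)).trans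
      (add_le_add (h6 k) h6v)

end TruncatedNLS

end

theorem proposition4p2 (χ : TruncatedNLS.LowFreqCutoff) (σ : ℝ) (hσ : σ = 1 ∨ σ = -1)
    (N : ℕ → ℝ) (hN : ∀ n, 0 < N n) (u : ℕ → ℝ × ℝ → ℂ)
    (hu : ∀ n, TruncatedNLS.IsSolution χ σ (hN n) (u n))
    (hM : ⨆ n, eLpNorm (fun x => u n (0, x)) 2 volume < (⊤ : ℝ≥0∞)) :
    ∃ v : ℝ × ℝ → ℂ, AEStronglyMeasurable v volume ∧
      ∃ φ : ℕ → ℕ, StrictMono φ ∧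
        ∀ R > (0 : ℝ), ∀ T > (0 : ℝ), ∀ p : ℝ≥0∞, 1 ≤ p → p < 6 →
          Tendsto (fun k => eLpNorm (u (φ k) - v) p
            (volume.restrict (Set.Icc (-T) T ×ˢ Set.Icc (-R) R))) atTop (𝓝 0) := by
  have hσ' : |σ| = 1 := by rcases hσ with rfl | rfl <;> simp
  obtain ⟨v, hv, φ, hφ, h⟩ := TruncatedNLS.exists_subseq_tendsto hσ' hu
    (M := (⨆ n, eLpNorm (fun x => u n (0, x)) 2 volume).toReal) fun n => by
      rw [TruncatedNLS.IsSolution.path, Lp.norm_toLp]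
      exact ENNReal.toReal_mono hM.ne (le_iSup (fun n => eLpNorm (fun x => u n (0, x)) 2 volume) n)
  exact ⟨v, hv, φ, hφ, fun R _ T _ p _ hp => h R T p hp⟩
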